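/- Let $n\ge 0$ be an integer, $\kappa\in(0,1)$, and $\delta,\theta,A>0$. Let $\mathcal H^{s}$ denote $s$-dimensional Hausdorff measure on $\mathbb R^{n+1}$ (with any fixed normalization). There is a constant $C\in(0,\infty)$, depending only on $n,\kappa,\delta,\theta$ and $A$, such that the following holds. Let $\Omega\subset\mathbb R^{n+1}$ be a bounded open set with boundary $M=\partial\Omega$ such that $\mathcal H^{n+\kappa}(M)\le A$ and $$\frac{\mathcal H^{n+\kappa}(M\cap B(p,\gamma))}{\gamma^{n+\kappa}}\ \ge\ \theta\qquad\text{for all } p\in M \text{ and } \gamma\in(0,\delta].$$ Let $\varepsilon\in(0,1)$, and let $u$ be the solution of the $\varepsilon$-Allen–Cahn equation $$\partial_t u=\Delta u-\frac{1}{\varepsilon^{2}}f(u),\qquad f(u)=2u(u^2-1),\qquad u(\cdot,0)=2\chi_\Omega-1,$$ that is, $u\in L^\infty(\mathbb R^{n+1}\times[0,T])$ for all $T>0$, $u$ is continuous from $[0,\infty)$ to $\mathcal D'(\mathbb R^{n+1})$ with $u(\cdot,0)=2\chi_\Omega-1$, and the equation holds in the sense of distributions on $\mathbb R^{n+1}\times(0,\infty)$.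 Then, for every $t\in(0,\varepsilon^2)$, $u(\cdot,t)$ has a (unique) continuously differentiable representative, and for this representative $$\int_{\mathbb R^{n+1}}\left(\varepsilon\,\frac{|Du(x,t)|^2}{2}+\frac{(u(x,t)^2-1)^2}{2\varepsilon}\right)dx\ \le\ C\,\varepsilon\,t^{-\frac{1+\kappa}{2}}.$$ -/

import Mathlib

open MeasureTheory Set
open scoped ContDiff NNReal ENNReal

/-- `Ω ⊆ ℝⁿ⁺¹` is a bounded open set whose boundary `M = ∂Ω` is a generalised hypersurface of
dimension `n + κ`: it has finite `(n + κ)`-dimensional Hausdorff measure, and the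
`(n + κ)`-dimensional density of `M` in the balls of radius `γ ∈ (0, δ]` centred on `M` is
at least `θ`. -/
structure BoundsGeneralisedHypersurface (n : ℕ) (κ δ θ : ℝ)
    (Ω : Set (EuclideanSpace ℝ (Fin (n + 1)))) : Prop where
  isOpen : IsOpen Ω
  isBounded : Bornology.IsBounded Ω
  finite_measure : Measure.hausdorffMeasure ((n : ℝ) + κ) (frontier Ω) < ⊤
  lower_density : ∀ p ∈ frontier Ω, ∀ γ ∈ Ioc (0 : ℝ) δ,
    ENNReal.ofReal θ ≤
      Measure.hausdorffMeasure ((n : ℝ) + κ) (frontier Ω ∩ Metric.ball p γ) /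
        ENNReal.ofReal (γ ^ ((n : ℝ) + κ))

/-- The double-well potential `F(u) = (1 - u²)² / 2`. -/
noncomputable def wellPotential (u : ℝ) : ℝ := (1 - u ^ 2) ^ 2 / 2

/-- The derivative `f = F'` of the potential, `f(u) = 2 u (u² - 1)`. -/
def wellForce (u : ℝ) : ℝ := 2 * u * (u ^ 2 - 1)

theorem hasDerivAt_wellPotential (u : ℝ) : HasDerivAt wellPotential (wellForce u) u := by
  have h := ((((hasDerivAt_id u).pow 2).const_sub 1).pow 2).div_const 2
  refine h.congr_deriv ?_
  simp [wellForce]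
  ring

/-- The initial datum `2 χ_Ω - 1`: it is `1` on `Ω` and `-1` off `Ω`. -/
noncomputable def phaseDatum {X : Type*} (Ω : Set X) (x : X) : ℝ :=
  2 * Ω.indicator (fun _ => (1 : ℝ)) x - 1

/-- `u(x, t)`, `t ≥ 0`, solves the initial value problem
`∂ₜ u = Δ u - ε⁻² f(u)`, `u(·, 0) = u₀` on `ℝᵈ`:
`u ∈ L^∞(ℝᵈ × [0, T])` for all `T > 0`, `u` is continuous from `[0, ∞)` to `𝒟'(ℝᵈ)` with value
`u₀` at `0`, and the equation holds in the sense of distributions on `ℝᵈ × (0, ∞)`.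
No differentiability of `u` is required. -/
structure IsAllenCahnSolution {d : ℕ} (ε : ℝ) (u₀ : EuclideanSpace ℝ (Fin d) → ℝ)
    (u : EuclideanSpace ℝ (Fin d) → ℝ → ℝ) : Prop where
  memLp_top : ∀ T : ℝ, 0 < T →
    MemLp (fun z : EuclideanSpace ℝ (Fin d) × ℝ => u z.1 z.2) ⊤
      (volume.restrict (univ ×ˢ Icc 0 T))
  locallyIntegrable : ∀ t : ℝ, 0 ≤ t → LocallyIntegrable (fun x => u x t) volume
  continuousOn_pairing : ∀ φ : EuclideanSpace ℝ (Fin d) → ℝ,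
    ContDiff ℝ ∞ φ → HasCompactSupport φ →
      ContinuousOn (fun t : ℝ => ∫ x, u x t * φ x) (Ici 0)
  initial : ∀ᵐ x : EuclideanSpace ℝ (Fin d), u x 0 = u₀ x
  equation : ∀ φ : EuclideanSpace ℝ (Fin d) × ℝ → ℝ,
    ContDiff ℝ ∞ φ → HasCompactSupport φ → tsupport φ ⊆ univ ×ˢ Ioi 0 →
      ∫ z : EuclideanSpace ℝ (Fin d) × ℝ,
        (u z.1 z.2 * (deriv (fun s => φ (z.1, s)) z.2
            + Laplacian.laplacian (fun y => φ (y, z.2)) z.1)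
          - (1 / ε ^ 2) * wellForce (u z.1 z.2) * φ z) = 0

/-- The `ε`-Allen–Cahn energy `∫ ε |Dv|² / 2 + F(v) / ε` of a differentiable function `v`,
as an element of `[0, ∞]`. -/
noncomputable def allenCahnEnergy {d : ℕ} (ε : ℝ) (v : EuclideanSpace ℝ (Fin d) → ℝ) : ℝ≥0∞ :=
  ∫⁻ x, ENNReal.ofReal (ε * ‖fderiv ℝ v x‖ ^ 2 / 2 + wellPotential (v x) / ε)

/-! Up to time ε² the reaction term is only a bounded perturbation of the heat flow, and the heat
flow of 2χ_Ω − 1 is controlled by how much volume lies near ∂Ω.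

Geometry. Cover M = ∂Ω by enlargements of disjoint balls of radius γ. Each ball carries (n+κ)-mass
at least θγ^(n+κ), so the bound A on the total mass bounds their number, and the r-tube around M has
volume O(r^(1−κ) + r^(n+1)) (`exists_volume_thickening_le`). The datum u₀ differs from its translate
by y only inside a tube of radius 3‖y‖. Averaging over y with the heat kernel p_τ, τ ≤ 2, gives ∫
p_τ(y) ‖u₀(· − y) − u₀‖_{L¹} dy ≤ Cτ^((1−κ)/2) (`exists_lintegral_heatKernel_mul_translate_le`). Let
D be such a bound for τ ≤ 2t. It controls ‖p_τ * u₀ − u₀‖_{L¹} and, since Dp_τ has mean zero and is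
bounded by Cτ^(−1/2) p_{2τ}, also ‖Dp_t * u₀‖_{L¹} ≤ Ct^(−1/2) D.

Analysis. Duhamel's formula u(t) = p_t * u₀ − ε^(−2) ∫₀ᵗ p_{t−s} * f(u(s)) ds holds for the weak
solution (`IsWeakHeatSolution.duhamel`), and a comparison argument built on it yields |u| ≤ 1. As f
vanishes at both values of u₀, |f(u)| ≤ 4|u − u₀|. An L¹ Grönwall inequality over a time shorter
than ε², where the rate ε^(−2) integrates to at most 1, then gives ‖u(s) − u₀‖_{L¹} ≤ CD for almost
every s < t (`IsAllenCahnSolution.ae_lintegral_enorm_sub_le`). Hence the source has sup norm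
O(ε^(−2)) and L¹ norm O(ε^(−2)D). The singularity (t−s)^(−1/2) of the gradient kernel integrates to
2√t, and √t ε^(−2) ≤ t^(−1/2), so the source obeys the same bounds as the initial term: |Du| ≤
Ct^(−1/2) and ‖Du‖_{L¹} ≤ Ct^(−1/2) D.

Energy. ∫ |Du|² ≤ sup|Du| · ‖Du‖_{L¹} ≤ Ct^(−1) D, while F(u) ≤ C|u − u₀| and 1/ε ≤ ε/t bound the
potential part by C(ε/t)D. With D of order t^((1−κ)/2) the total is Cεt^(−(1+κ)/2). -/

/-! ### The heat kernel: Gaussian bounds, derivatives, total mass. -/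

section HeatKernel

variable {E : Type*} [NormedAddCommGroup E] [InnerProductSpace ℝ E]

/-- The heat kernel `(4πτ)^(-d/2) exp(-|x|²/(4τ))` on a Euclidean space of dimension `d`. -/
noncomputable def heatKernel (τ : ℝ) (x : E) : ℝ :=
  (4 * Real.pi * τ) ^ (-(Module.finrank ℝ E / 2 : ℝ)) * Real.exp (-‖x‖ ^ 2 / (4 * τ))

theorem heatKernel_pos {τ : ℝ} (hτ : 0 < τ) (x : E) : 0 < heatKernel τ x := by
  unfold heatKernel
  have := Real.pi_pos
  positivity

theorem heatKernel_neg (τ : ℝ) (x : E) : heatKernel τ (-x) = heatKernel τ x := by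
  simp [heatKernel]

theorem heatKernel_sub_comm (τ : ℝ) (x y : E) : heatKernel τ (x - y) = heatKernel τ (y - x) := by
  rw [← heatKernel_neg, neg_sub]

theorem continuous_heatKernel (τ : ℝ) : Continuous (heatKernel τ : E → ℝ) := by
  unfold heatKernel
  fun_prop

theorem contDiff_heatKernel (τ : ℝ) {k : WithTop ℕ∞} : ContDiff ℝ k (heatKernel τ : E → ℝ) := by
  unfold heatKernel
  exact contDiff_const.mul (((contDiff_norm_sq ℝ).neg.div_const _).exp)

theorem contDiffAt_heatKernel_uncurry {q : E × ℝ} (hq : 0 < q.2) {k : WithTop ℕ∞} :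
    ContDiffAt ℝ k (fun q : E × ℝ => heatKernel q.2 q.1) q := by
  unfold heatKernel
  have := Real.pi_pos
  refine ContDiffAt.mul ?_ (ContDiffAt.exp ?_)
  · refine ContDiffAt.rpow_const_of_ne (contDiffAt_const.mul contDiffAt_snd) ?_
    positivity
  · refine ContDiffAt.div ?_ (contDiffAt_const.mul contDiffAt_snd) (by positivity)
    exact ((contDiff_norm_sq ℝ).contDiffAt.comp q contDiffAt_fst).neg

/-- All real times are admitted, even τ ≤ 0 where the formula means nothing, because the kernel is
later composed with t − s before s is restricted. -/
theorem measurable_heatKernel_uncurry [MeasurableSpace E] [OpensMeasurableSpace E] :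
    Measurable (fun q : E × ℝ => heatKernel q.2 q.1) := by
  unfold heatKernel
  have h : Measurable fun q : E × ℝ => ‖q.1‖ := measurable_norm.comp measurable_fst
  exact ((measurable_const.mul measurable_snd).pow_const _).mul
    (((h.pow_const 2).neg.div (measurable_const.mul measurable_snd)).exp)

/-- The power of τ decreases in time and the Gaussian factor increases, so one is estimated at τ₀
and the other at τ₁. This yields one integrable majorant for a compact range of times. -/
theorem heatKernel_le_of_le {τ₀ τ τ₁ : ℝ} (h₀ : 0 < τ₀) (h : τ₀ ≤ τ) (h₁ : τ ≤ τ₁) (x : E) :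
    heatKernel τ x ≤ (τ₁ / τ₀) ^ (Module.finrank ℝ E / 2 : ℝ) * heatKernel τ₁ x := by
  have hτ : 0 < τ := h₀.trans_le h
  have hτ₁ : 0 < τ₁ := hτ.trans_le h₁
  have hπ := Real.pi_pos
  have e : (4 * Real.pi * τ₀) ^ (-(Module.finrank ℝ E / 2 : ℝ))
      = (τ₁ / τ₀) ^ (Module.finrank ℝ E / 2 : ℝ)
        * (4 * Real.pi * τ₁) ^ (-(Module.finrank ℝ E / 2 : ℝ)) := by
    rw [Real.rpow_neg (by positivity), Real.rpow_neg (by positivity), ← Real.inv_rpow (by positivity),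
      ← Real.inv_rpow (by positivity), ← Real.mul_rpow (by positivity) (by positivity)]
    congr 1
    field_simp
  unfold heatKernel
  rw [← mul_assoc, ← e]
  refine mul_le_mul ?_ (Real.exp_le_exp.2 ?_) (by positivity) (by positivity)
  · refine Real.rpow_le_rpow_of_nonpos (by positivity) (by gcongr) ?_
    have : (0 : ℝ) ≤ Module.finrank ℝ E := by positivity
    linarith
  · rw [neg_div, neg_div]
    gcongr

/-- The heat kernel at time `τ`, written through the heat kernel at time `2τ`. -/
theorem heatKernel_eq_two_mul {τ : ℝ} (hτ : 0 < τ) (x : E) :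
    heatKernel τ x = (2 : ℝ) ^ (Module.finrank ℝ E / 2 : ℝ) * Real.exp (-‖x‖ ^ 2 / (8 * τ))
      * heatKernel (2 * τ) x := by
  have hπ := Real.pi_pos
  unfold heatKernel
  have e : (4 * Real.pi * τ) ^ (-(Module.finrank ℝ E / 2 : ℝ))
      = (2 : ℝ) ^ (Module.finrank ℝ E / 2 : ℝ)
        * (4 * Real.pi * (2 * τ)) ^ (-(Module.finrank ℝ E / 2 : ℝ)) := by
    rw [Real.rpow_neg (by positivity), Real.rpow_neg (by positivity), ← Real.inv_rpow (by positivity),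
      ← Real.inv_rpow (by positivity), ← Real.mul_rpow (by positivity) (by positivity)]
    congr 1
    field_simp
  have e' : Real.exp (-‖x‖ ^ 2 / (4 * τ))
      = Real.exp (-‖x‖ ^ 2 / (8 * τ)) * Real.exp (-‖x‖ ^ 2 / (4 * (2 * τ))) := by
    rw [← Real.exp_add]
    congr 1
    field_simp
    ring
  rw [e, e']
  ring

/-- Half of the Gaussian exponent pays for the weight: completing the square gives a‖x‖ − ‖x‖²/(8τ)
≤ 2a²τ, and what remains is the kernel at time 2τ, still of mass 1. -/
theorem exp_mul_heatKernel_le {τ : ℝ} (hτ : 0 < τ) (a : ℝ) (x : E) :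
    Real.exp (a * ‖x‖) * heatKernel τ x
      ≤ (2 : ℝ) ^ (Module.finrank ℝ E / 2 : ℝ) * Real.exp (2 * a ^ 2 * τ)
        * heatKernel (2 * τ) x := by
  rw [heatKernel_eq_two_mul hτ, ← mul_assoc]
  refine mul_le_mul_of_nonneg_right ?_ (heatKernel_pos (by positivity) x).le
  rw [mul_left_comm, ← Real.exp_add]
  refine mul_le_mul_of_nonneg_left (Real.exp_le_exp.2 ?_) (by positivity)
  rw [← sub_nonneg]
  have : 2 * a ^ 2 * τ - (a * ‖x‖ + -‖x‖ ^ 2 / (8 * τ)) = (‖x‖ - 4 * a * τ) ^ 2 / (8 * τ) := by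
    field_simp
    ring
  rw [this]
  positivity

/-- With y = ‖x‖/√τ one has y^β ≤ exp(βy), which reduces to the exponential weight with a = β/√τ.
For this a the exponent 2a²τ = 2β² does not depend on τ, so the time scale enters only through
τ^(β/2). -/
theorem rpow_mul_heatKernel_le {τ β : ℝ} (hτ : 0 < τ) (hβ : 0 ≤ β) (x : E) :
    ‖x‖ ^ β * heatKernel τ x
      ≤ ((2 : ℝ) ^ (Module.finrank ℝ E / 2 : ℝ) * Real.exp (2 * β ^ 2)) * τ ^ (β / 2)
        * heatKernel (2 * τ) x := by
  have hs : 0 < Real.sqrt τ := Real.sqrt_pos.2 hτ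
  have h1 : ‖x‖ ^ β ≤ τ ^ (β / 2) * Real.exp (β / Real.sqrt τ * ‖x‖) := by
    have e : ‖x‖ = Real.sqrt τ * (‖x‖ / Real.sqrt τ) := by field_simp
    have hy : 0 ≤ ‖x‖ / Real.sqrt τ := by positivity
    have h2 : (‖x‖ / Real.sqrt τ) ^ β ≤ Real.exp (β * (‖x‖ / Real.sqrt τ)) := by
      have : ‖x‖ / Real.sqrt τ ≤ Real.exp (‖x‖ / Real.sqrt τ) := by
        linarith [Real.add_one_le_exp (‖x‖ / Real.sqrt τ)]
      calc (‖x‖ / Real.sqrt τ) ^ β ≤ (Real.exp (‖x‖ / Real.sqrt τ)) ^ β :=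
            Real.rpow_le_rpow hy this hβ
        _ = _ := by rw [← Real.exp_mul, mul_comm]
    calc ‖x‖ ^ β = (Real.sqrt τ * (‖x‖ / Real.sqrt τ)) ^ β := by rw [← e]
      _ = τ ^ (β / 2) * (‖x‖ / Real.sqrt τ) ^ β := by
          rw [Real.mul_rpow hs.le hy, Real.sqrt_eq_rpow, ← Real.rpow_mul hτ.le]
          congr 2
          ring
      _ ≤ τ ^ (β / 2) * Real.exp (β * (‖x‖ / Real.sqrt τ)) := by gcongr
      _ = _ := by congr 2; ring
  have h3 := exp_mul_heatKernel_le hτ (β / Real.sqrt τ) x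
  have e3 : 2 * (β / Real.sqrt τ) ^ 2 * τ = 2 * β ^ 2 := by
    rw [div_pow, Real.sq_sqrt hτ.le]
    field_simp
  rw [e3] at h3
  calc ‖x‖ ^ β * heatKernel τ x
      ≤ τ ^ (β / 2) * Real.exp (β / Real.sqrt τ * ‖x‖) * heatKernel τ x :=
        mul_le_mul_of_nonneg_right h1 (heatKernel_pos hτ x).le
    _ = τ ^ (β / 2) * (Real.exp (β / Real.sqrt τ * ‖x‖) * heatKernel τ x) := by ring
    _ ≤ τ ^ (β / 2) * _ := mul_le_mul_of_nonneg_left h3 (by positivity)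
    _ = _ := by ring

theorem hasFDerivAt_heatKernel (τ : ℝ) (x : E) :
    HasFDerivAt (heatKernel τ : E → ℝ) (-(heatKernel τ x / (2 * τ)) • innerSL ℝ x) x := by
  have h := ((((hasStrictFDerivAt_norm_sq x).hasFDerivAt).neg.mul_const (4 * τ)⁻¹).exp).const_mul
    ((4 * Real.pi * τ) ^ (-(Module.finrank ℝ E / 2 : ℝ)))
  have h' : HasFDerivAt (heatKernel τ : E → ℝ) _ x := h
  refine h'.congr_fderiv ?_
  ext v
  simp [heatKernel, div_eq_mul_inv]
  ring

theorem fderiv_heatKernel (τ : ℝ) :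
    fderiv ℝ (heatKernel τ : E → ℝ) = fun x => -(heatKernel τ x / (2 * τ)) • innerSL ℝ x :=
  funext fun x => (hasFDerivAt_heatKernel τ x).fderiv

theorem fderiv_heatKernel_neg (τ : ℝ) (x : E) :
    fderiv ℝ (heatKernel τ : E → ℝ) (-x) = -fderiv ℝ (heatKernel τ) x := by
  simp [fderiv_heatKernel, heatKernel_neg]

theorem continuous_fderiv_heatKernel (τ : ℝ) : Continuous (fderiv ℝ (heatKernel τ : E → ℝ)) :=
  (contDiff_heatKernel τ).continuous_fderiv one_ne_zero

theorem norm_fderiv_heatKernel {τ : ℝ} (hτ : 0 < τ) (x : E) :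
    ‖fderiv ℝ (heatKernel τ : E → ℝ) x‖ = heatKernel τ x / (2 * τ) * ‖x‖ := by
  have := heatKernel_pos hτ x
  rw [fderiv_heatKernel, norm_smul, innerSL_apply_norm, norm_neg, Real.norm_of_nonneg (by positivity)]

/-- The differential is −p_τ(x)⟨x, ·⟩/(2τ); the factor ‖x‖ costs √τ, leaving τ^(−1/2). This is the
origin of every negative power of time in the proof. -/
theorem norm_fderiv_heatKernel_le {τ : ℝ} (hτ : 0 < τ) (x : E) :
    ‖fderiv ℝ (heatKernel τ : E → ℝ) x‖
      ≤ ((2 : ℝ) ^ (Module.finrank ℝ E / 2 : ℝ) * Real.exp 2) * τ ^ (-(1 / 2) : ℝ)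
        * heatKernel (2 * τ) x := by
  have h := rpow_mul_heatKernel_le hτ zero_le_one x
  rw [Real.rpow_one] at h
  rw [norm_fderiv_heatKernel hτ]
  have hk := heatKernel_pos (show 0 < 2 * τ by positivity) x
  have e : τ ^ (-(1 / 2) : ℝ) = τ ^ (1 / 2 : ℝ) / τ := by
    rw [show (-(1 / 2) : ℝ) = 1 / 2 - 1 by norm_num, Real.rpow_sub hτ, Real.rpow_one]
  calc heatKernel τ x / (2 * τ) * ‖x‖ = (‖x‖ * heatKernel τ x) / (2 * τ) := by ring
    _ ≤ _ := div_le_div_of_nonneg_right h (by positivity)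
    _ = (((2 : ℝ) ^ (Module.finrank ℝ E / 2 : ℝ) * Real.exp 2) * τ ^ (-(1 / 2) : ℝ)
        * heatKernel (2 * τ) x) / 2 := by
        rw [e]; norm_num; field_simp
    _ ≤ _ := by
        have : 0 ≤ ((2 : ℝ) ^ (Module.finrank ℝ E / 2 : ℝ) * Real.exp 2) * τ ^ (-(1 / 2) : ℝ)
          * heatKernel (2 * τ) x := by positivity
        linarith

theorem hasDerivAt_heatKernel_time {τ : ℝ} (hτ : 0 < τ) (x : E) :
    HasDerivAt (fun τ => heatKernel τ x)
      ((‖x‖ ^ 2 / (4 * τ ^ 2) - Module.finrank ℝ E / (2 * τ)) * heatKernel τ x) τ := by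
  have hπ := Real.pi_pos
  have h1 : HasDerivAt (fun τ : ℝ => 4 * Real.pi * τ) (4 * Real.pi) τ := by
    simpa using (hasDerivAt_id τ).const_mul (4 * Real.pi)
  have h2 := h1.rpow_const (p := (-(Module.finrank ℝ E / 2 : ℝ))) (Or.inl (by positivity))
  have h3 : HasDerivAt (fun τ : ℝ => -‖x‖ ^ 2 / (4 * τ)) (‖x‖ ^ 2 / (4 * τ ^ 2)) τ := by
    have := (((hasDerivAt_id τ).const_mul 4).fun_inv (by simpa using hτ.ne')).const_mul (-‖x‖ ^ 2)
    refine this.congr_deriv ?_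
    simp
    field_simp
  refine (h2.mul h3.exp).congr_deriv ?_
  unfold heatKernel
  rw [Real.rpow_sub_one (by positivity)]
  field_simp
  ring

theorem iteratedFDeriv_two_heatKernel (τ : ℝ) (x : E) (m : Fin 2 → E) :
    iteratedFDeriv ℝ 2 (heatKernel τ : E → ℝ) x m =
      heatKernel τ x / (2 * τ) * (inner ℝ x (m 0) * inner ℝ x (m 1) / (2 * τ)
        - inner ℝ (m 0) (m 1)) := by
  rw [iteratedFDeriv_two_apply]
  have hi : HasFDerivAt (fun y : E => (innerSL ℝ y : E →L[ℝ] ℝ))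
      (innerSL ℝ : E →L[ℝ] E →L[ℝ] ℝ) x :=
    ContinuousLinearMap.hasFDerivAt (innerSL ℝ : E →L[ℝ] E →L[ℝ] ℝ)
  have hc := ((hasFDerivAt_heatKernel τ x).mul_const (2 * τ)⁻¹).fun_neg
  have h := hc.fun_smul hi
  have e : fderiv ℝ (heatKernel τ : E → ℝ)
      = fun y => -(heatKernel τ y * (2 * τ)⁻¹) • (innerSL ℝ y : E →L[ℝ] ℝ) := by
    rw [fderiv_heatKernel]
    rfl
  rw [e]
  rw [h.fderiv]
  have e2 : (innerSL ℝ : E →L[ℝ] E →L[ℝ] ℝ) (m 0) (m 1) = inner ℝ (m 0) (m 1) := rfl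
  simp [e2]
  ring

theorem norm_iteratedFDeriv_two_heatKernel_le {τ : ℝ} (hτ : 0 < τ) (x : E) :
    ‖iteratedFDeriv ℝ 2 (heatKernel τ : E → ℝ) x‖
      ≤ heatKernel τ x / (2 * τ) * (‖x‖ ^ 2 / (2 * τ) + 1) := by
  have hk := heatKernel_pos hτ x
  refine ContinuousMultilinearMap.opNorm_le_bound (by positivity) fun m => ?_
  rw [iteratedFDeriv_two_heatKernel, Fin.prod_univ_two, norm_mul,
    Real.norm_of_nonneg (show 0 ≤ heatKernel τ x / (2 * τ) by positivity), mul_assoc]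
  gcongr
  refine (norm_sub_le _ _).trans ?_
  rw [norm_div, norm_mul, Real.norm_of_nonneg (show 0 ≤ 2 * τ by positivity)]
  have h0 := norm_inner_le_norm (𝕜 := ℝ) x (m 0)
  have h1 := norm_inner_le_norm (𝕜 := ℝ) x (m 1)
  have h2 := norm_inner_le_norm (𝕜 := ℝ) (m 0) (m 1)
  calc ‖inner ℝ x (m 0)‖ * ‖inner ℝ x (m 1)‖ / (2 * τ) + ‖inner ℝ (m 0) (m 1)‖
      ≤ (‖x‖ * ‖m 0‖) * (‖x‖ * ‖m 1‖) / (2 * τ) + ‖m 0‖ * ‖m 1‖ := by gcongr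
    _ = _ := by ring

/-- The right-hand side is the one in `hasDerivAt_heatKernel_time`; together the two say that the
kernel solves the heat equation. -/
theorem laplacian_heatKernel [FiniteDimensional ℝ E] {τ : ℝ} (hτ : 0 < τ) (x : E) :
    Laplacian.laplacian (heatKernel τ : E → ℝ) x
      = (‖x‖ ^ 2 / (4 * τ ^ 2) - Module.finrank ℝ E / (2 * τ)) * heatKernel τ x := by
  rw [InnerProductSpace.laplacian_eq_iteratedFDeriv_stdOrthonormalBasis]
  simp only [iteratedFDeriv_two_heatKernel]
  simp only [Matrix.cons_val_zero, Matrix.cons_val_one, OrthonormalBasis.inner_eq_one]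
  rw [← Finset.mul_sum, Finset.sum_sub_distrib, ← Finset.sum_div]
  have : ∑ i, inner ℝ x (stdOrthonormalBasis ℝ E i) * inner ℝ x (stdOrthonormalBasis ℝ E i)
      = ‖x‖ ^ 2 := by
    rw [← (stdOrthonormalBasis ℝ E).sum_sq_norm_inner_left x]
    refine Finset.sum_congr rfl fun i _ => ?_
    rw [Real.norm_eq_abs, sq_abs, sq]
  rw [this]
  simp
  field_simp
  ring

variable [FiniteDimensional ℝ E] [MeasurableSpace E] [BorelSpace E]

theorem integral_heatKernel {τ : ℝ} (hτ : 0 < τ) : ∫ x : E, heatKernel τ x = 1 := by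
  have hπ := Real.pi_pos
  have h := GaussianFourier.integral_rexp_neg_mul_sq_norm (V := E)
    (show 0 < (4 * τ)⁻¹ by positivity)
  unfold heatKernel
  rw [integral_const_mul]
  have e : ∀ x : E, -‖x‖ ^ 2 / (4 * τ) = -(4 * τ)⁻¹ * ‖x‖ ^ 2 := fun x => by ring
  simp only [e]
  rw [h, Real.rpow_neg (by positivity), show Real.pi / (4 * τ)⁻¹ = 4 * Real.pi * τ by field_simp]
  exact inv_mul_cancel₀ (by positivity)

theorem integrable_heatKernel {τ : ℝ} (hτ : 0 < τ) : Integrable (heatKernel τ : E → ℝ) := by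
  -- A non-integrable function has Bochner integral 0 by convention, so having integral 1 forces
  -- integrability.
  by_contra h
  have := integral_heatKernel (E := E) hτ
  rw [integral_undef h] at this
  exact zero_ne_one this

theorem lintegral_heatKernel {τ : ℝ} (hτ : 0 < τ) :
    ∫⁻ x : E, ENNReal.ofReal (heatKernel τ x) = 1 := by
  rw [← ofReal_integral_eq_lintegral_ofReal (integrable_heatKernel hτ)
    (ae_of_all _ fun x => (heatKernel_pos hτ x).le), integral_heatKernel hτ, ENNReal.ofReal_one]

end HeatKernel

/-! ### The heat semigroup on bounded functions. -/

section HeatConvolution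
open Filter Topology

variable {E : Type*} [NormedAddCommGroup E] [InnerProductSpace ℝ E] [FiniteDimensional ℝ E]
  [MeasurableSpace E] [BorelSpace E]

/-- The heat semigroup `p_τ * g`. -/
noncomputable def heatConv (τ : ℝ) (g : E → ℝ) (z : E) : ℝ := ∫ x, heatKernel τ (z - x) * g x

theorem integrable_heatKernel_sub {τ : ℝ} (hτ : 0 < τ) (z : E) :
    Integrable fun x : E => heatKernel τ (z - x) :=
  (integrable_heatKernel hτ).comp_sub_left z

theorem integral_heatKernel_sub {τ : ℝ} (hτ : 0 < τ) (z : E) :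
    ∫ x : E, heatKernel τ (z - x) = 1 := by
  rw [integral_sub_left_eq_self (heatKernel τ) volume z, integral_heatKernel hτ]

theorem integrable_heatKernel_mul {τ : ℝ} (hτ : 0 < τ) (z : E) {g : E → ℝ} {R : ℝ}
    (hg : AEStronglyMeasurable g) (hR : ∀ᵐ x, |g x| ≤ R) :
    Integrable fun x : E => heatKernel τ (z - x) * g x :=
  (integrable_heatKernel_sub hτ z).mul_bdd hg hR

theorem abs_heatConv_le {τ : ℝ} (hτ : 0 < τ) (z : E) {g : E → ℝ} {R : ℝ}
    (hR : ∀ᵐ x, |g x| ≤ R) : |heatConv τ g z| ≤ R := by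
  have h := norm_integral_le_of_norm_le (f := fun x => heatKernel τ (z - x) * g x)
    ((integrable_heatKernel_sub hτ z).mul_const R) (by
      filter_upwards [hR] with x hx
      rw [norm_mul, Real.norm_of_nonneg (heatKernel_pos hτ _).le]
      exact mul_le_mul_of_nonneg_left hx (heatKernel_pos hτ _).le)
  rwa [integral_mul_const, integral_heatKernel_sub hτ, one_mul] at h

theorem heatConv_const {τ : ℝ} (hτ : 0 < τ) (c : ℝ) (z : E) :
    heatConv τ (fun _ => c) z = c := by
  rw [heatConv, integral_mul_const, integral_heatKernel_sub hτ, one_mul]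

/-- L¹ continuity of the kernel in time makes p_τ * g continuous in τ uniformly over all g with a
common sup bound, which is what is needed when g itself varies with time. -/
theorem tendsto_integral_abs_heatKernel_sub {τ₀ : ℝ} (hτ₀ : 0 < τ₀) :
    Tendsto (fun τ => ∫ x : E, |heatKernel τ x - heatKernel τ₀ x|) (𝓝 τ₀) (𝓝 0) := by
  have h0 : (0 : ℝ) = ∫ x : E, |heatKernel τ₀ x - heatKernel τ₀ x| := by simp
  rw [h0]
  have hk := integrable_heatKernel (E := E) (show 0 < 2 * τ₀ by positivity)
  refine tendsto_integral_filter_of_dominated_convergence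
    (fun x => 2 * ((2 * τ₀ / (τ₀ / 2)) ^ (Module.finrank ℝ E / 2 : ℝ) * heatKernel (2 * τ₀) x))
    (Eventually.of_forall fun τ => ?_) ?_ ((hk.const_mul _).const_mul _) (ae_of_all _ fun x => ?_)
  · exact ((continuous_heatKernel τ).sub (continuous_heatKernel τ₀)).abs.aestronglyMeasurable
  · filter_upwards [Ioo_mem_nhds (show τ₀ / 2 < τ₀ by linarith) (show τ₀ < 2 * τ₀ by linarith)]
      with τ hτ
    refine ae_of_all _ fun x => ?_
    have h1 := heatKernel_le_of_le (by positivity) hτ.1.le hτ.2.le x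
    have h2 := heatKernel_le_of_le (show 0 < τ₀ / 2 by positivity)
      (show τ₀ / 2 ≤ τ₀ by linarith) (show τ₀ ≤ 2 * τ₀ by linarith) x
    have h3 := heatKernel_pos (show 0 < τ by linarith [hτ.1]) x
    have h4 := heatKernel_pos hτ₀ x
    rw [norm_abs_eq_norm, Real.norm_eq_abs, abs_le]
    constructor <;> linarith
  · exact (((hasDerivAt_heatKernel_time hτ₀ x).continuousAt.tendsto).sub tendsto_const_nhds).abs

theorem abs_heatConv_sub_heatConv_le {τ τ₀ : ℝ} (hτ : 0 < τ) (hτ₀ : 0 < τ₀) (z : E) {g : E → ℝ}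
    {R : ℝ} (hg : AEStronglyMeasurable g) (hR : ∀ᵐ x, |g x| ≤ R) :
    |heatConv τ g z - heatConv τ₀ g z|
      ≤ (∫ x : E, |heatKernel τ x - heatKernel τ₀ x|) * R := by
  have hi : Integrable fun x : E => |heatKernel τ x - heatKernel τ₀ x| :=
    ((integrable_heatKernel hτ).sub (integrable_heatKernel hτ₀)).abs
  rw [heatConv, heatConv, ← integral_sub (integrable_heatKernel_mul hτ z hg hR)
    (integrable_heatKernel_mul hτ₀ z hg hR),
    ← integral_sub_left_eq_self (fun x : E => |heatKernel τ x - heatKernel τ₀ x|) volume z,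
    ← integral_mul_const]
  change ‖(_ : ℝ)‖ ≤ _
  refine norm_integral_le_of_norm_le ((hi.comp_sub_left z).mul_const R) ?_
  filter_upwards [hR] with x hx
  rw [← sub_mul, norm_mul]
  exact mul_le_mul_of_nonneg_left hx (abs_nonneg _)

theorem tendsto_heatConv_time {τ₀ : ℝ} (hτ₀ : 0 < τ₀) (z : E) {g : E → ℝ} {R : ℝ}
    (hg : AEStronglyMeasurable g) (hR : ∀ᵐ x, |g x| ≤ R) :
    Tendsto (fun τ => heatConv τ g z) (𝓝 τ₀) (𝓝 (heatConv τ₀ g z)) := by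
  rw [tendsto_iff_norm_sub_tendsto_zero]
  refine squeeze_zero' (Eventually.of_forall fun _ => norm_nonneg _) ?_
    (by simpa using (tendsto_integral_abs_heatKernel_sub (E := E) hτ₀).mul_const R)
  filter_upwards [lt_mem_nhds hτ₀] with τ hτ
  exact abs_heatConv_sub_heatConv_le hτ hτ₀ z hg hR

theorem measurable_heatConv_uncurry {U : E × ℝ → ℝ} (hU : Measurable U) (t : ℝ) :
    Measurable fun q : E × ℝ => heatConv (t - q.2) (fun x => U (x, q.2)) q.1 := by
  refine (StronglyMeasurable.integral_prod_right
    (f := fun q : E × ℝ => fun x : E => heatKernel (t - q.2) (q.1 - x) * U (x, q.2)) ?_).measurable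
  refine Measurable.stronglyMeasurable ?_
  refine Measurable.mul ?_ (hU.comp (by fun_prop))
  exact measurable_heatKernel_uncurry.comp
    (show Measurable fun q : (E × ℝ) × E => (q.1.1 - q.2, t - q.1.2) by fun_prop)

theorem measurable_heatConv_time {U : E × ℝ → ℝ} (hU : Measurable U) (t : ℝ) (z : E) :
    Measurable fun s : ℝ => heatConv (t - s) (fun x => U (x, s)) z :=
  (measurable_heatConv_uncurry hU t).comp (measurable_const.prodMk measurable_id)

theorem measurable_heatConv {g : E → ℝ} (hg : Measurable g) (τ : ℝ) : Measurable (heatConv τ g) := by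
  have h := (measurable_heatConv_uncurry (hg.comp measurable_fst) τ).comp
    (measurable_id.prodMk (measurable_const (a := (0 : ℝ))))
  simpa [Function.comp_def] using h

end HeatConvolution

/-! ### The du Bois-Reymond lemma in one variable. -/

section DuBoisReymond
open Filter Topology

/-- A primitive of a bump function: a smooth step from `0` to `1`. -/
theorem exists_smooth_step (φ : ContDiffBump (0 : ℝ)) (a : ℝ) :
    ∃ P : ℝ → ℝ, ContDiff ℝ ∞ P ∧ (∀ s, deriv P s = φ.normed volume (a - s)) ∧
      (∀ s, s ≤ a - φ.rOut → P s = 0) ∧ (∀ s, a + φ.rOut ≤ s → P s = 1) ∧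
      ∀ s, 0 ≤ P s ∧ P s ≤ 1 := by
  set ρ : ℝ → ℝ := fun s => φ.normed volume (a - s) with hρ
  have hc : ContDiff ℝ ∞ ρ := φ.contDiff_normed.comp (contDiff_const.sub contDiff_id)
  have hnn : ∀ s, 0 ≤ ρ s := fun s => φ.nonneg_normed _
  have hz : ∀ s, φ.rOut ≤ |s - a| → ρ s = 0 := fun s hs => by
    have : a - s ∉ Function.support (φ.normed volume) := by
      rw [φ.support_normed_eq, Metric.mem_ball, dist_zero_right, Real.norm_eq_abs, not_lt, abs_sub_comm]
      exact hs
    simpa using this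
  have hint : Integrable ρ := φ.integrable_normed.comp_sub_left a
  have hone : ∫ s, ρ s = 1 := by
    rw [hρ, integral_sub_left_eq_self (φ.normed volume) volume a, φ.integral_normed]
  have hz1 : ∀ s ∈ Iic (a - φ.rOut), ρ s = 0 := fun s hs => hz s (by
    rw [abs_sub_comm]; exact le_trans (by linarith [mem_Iic.1 hs]) (le_abs_self _))
  have hd : ∀ s, HasDerivAt (fun s => ∫ r in Iic s, ρ r) (ρ s) s := fun s => by
    have h1 : ∀ s, ∫ r in Iic s, ρ r = (∫ r in Iic 0, ρ r) + ∫ r in (0 : ℝ)..s, ρ r := fun s => by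
      rw [intervalIntegral.integral_Iic_sub_Iic hint.integrableOn hint.integrableOn |>.symm]
      ring
    rw [funext h1]
    exact (intervalIntegral.integral_hasDerivAt_right (hc.continuous.intervalIntegrable _ _)
      hc.continuous.stronglyMeasurable.stronglyMeasurableAtFilter hc.continuous.continuousAt).const_add _
  refine ⟨fun s => ∫ r in Iic s, ρ r, ?_, fun s => (hd s).deriv, fun s hs => ?_, fun s hs => ?_,
    fun s => ⟨integral_nonneg hnn, ?_⟩⟩
  · rw [contDiff_infty_iff_deriv]
    refine ⟨fun s => (hd s).differentiableAt, ?_⟩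
    rwa [funext fun s => (hd s).deriv]
  · exact setIntegral_eq_zero_of_forall_eq_zero fun r hr => hz1 r (le_trans hr hs)
  · rw [← hone]
    refine setIntegral_eq_integral_of_forall_compl_eq_zero fun r hr => hz r ?_
    exact le_trans (by simp at hr; linarith) (le_abs_self _)
  · rw [← hone]
    exact setIntegral_le_integral hint (ae_of_all _ hnn)

/-- If `J' = H` weakly on `(0, b)`, `J` is continuous on `[0, b)` and `H` is integrable, then `J` is
a primitive of `H` on `[0, b)`. -/
theorem sub_eq_integral_of_weak_deriv {J H : ℝ → ℝ} {b : ℝ} (hJ : ContinuousOn J (Ico 0 b))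
    (hH : IntegrableOn H (Ioo 0 b))
    (h : ∀ η : ℝ → ℝ, ContDiff ℝ ∞ η → HasCompactSupport η → tsupport η ⊆ Ioo 0 b →
      ∫ s in Ioo 0 b, (deriv η s * J s + η s * H s) = 0) {t : ℝ} (ht : t ∈ Ico 0 b) :
    J t - J 0 = ∫ s in Ioo 0 t, H s := by
  have hJo : ContinuousOn J (Ioo 0 b) := hJ.mono Ioo_subset_Ico_self
  have key : ∀ a c, 0 < a → a < c → c < b → J c - J a = ∫ s in Ioo a c, H s := by
    intro a c ha hac hcb
    set J' : ℝ → ℝ := (Ioo 0 b).indicator J with hJ'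
    have hJ'm : AEStronglyMeasurable J' :=
      (aestronglyMeasurable_indicator_iff measurableSet_Ioo).2
        (hJo.aestronglyMeasurable measurableSet_Ioo)
    -- Mollifiers will have radius at most m/4, so that [a − m/4, c + m/4] stays inside (0, b).
    set m : ℝ := min a (min (c - a) (b - c)) with hm
    have hm0 : 0 < m := lt_min ha (lt_min (by linarith) (by linarith))
    have hma : m ≤ a := min_le_left _ _
    have hmc : m ≤ c - a := (min_le_right _ _).trans (min_le_left _ _)
    have hmb : m ≤ b - c := (min_le_right _ _).trans (min_le_right _ _)
    set φ : ℕ → ContDiffBump (0 : ℝ) := fun k =>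
      ⟨m / (k + 4) / 2, m / (k + 4), by positivity, half_lt_self (by positivity)⟩ with hφ
    have hr : ∀ k, (φ k).rOut = m / (k + 4) := fun k => rfl
    have hr4 : ∀ k, (φ k).rOut ≤ m / 4 := fun k => by
      rw [hr]
      have : (0 : ℝ) ≤ k := by positivity
      gcongr
      linarith
    have hr0 : Tendsto (fun k => (φ k).rOut) atTop (𝓝 0) := by
      simp only [hr]
      have := (tendsto_const_div_atTop_nhds_zero_nat m).comp (tendsto_add_atTop_nat 4)
      refine this.congr fun k => ?_
      simp
    have hconv : ∀ e ∈ Ioo 0 b, Tendsto (fun k => ∫ s, (φ k).normed volume (e - s) * J' s) atTop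
        (𝓝 (J e)) := by
      intro e he
      have hat : ContinuousAt J' e := by
        have h1 : ContinuousAt J e := hJo.continuousAt (Ioo_mem_nhds he.1 he.2)
        refine h1.congr ?_
        filter_upwards [Ioo_mem_nhds he.1 he.2] with s hs
        rw [hJ', indicator_of_mem hs]
      have := ContDiffBump.convolution_tendsto_right (μ := volume) (φ := φ) (l := atTop)
        (g := fun _ => J') (x₀ := e) (z₀ := J e) (k := fun _ => e) hr0
        (Eventually.of_forall fun _ => hJ'm) (by
          have : J e = J' e := by rw [hJ', indicator_of_mem he]
          rw [this]
          exact hat.tendsto.comp tendsto_snd) tendsto_const_nhds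
      refine this.congr fun k => ?_
      rw [convolution_eq_swap]
      rfl
    choose P hPs hPd hP0 hP1 hPb using fun k e => exists_smooth_step (φ k) e
    -- A smoothed indicator of (a, c), with derivative a mollifier at a minus a mollifier at c.
    -- Hence ∫ η'J tends to J a − J c and ∫ ηH to the integral of H over (a, c).
    set η : ℕ → ℝ → ℝ := fun k s => P k a s - P k c s with hη
    have hηd : ∀ k s, deriv (η k) s = (φ k).normed volume (a - s) - (φ k).normed volume (c - s) := by
      intro k s
      rw [hη]
      have h1 := ((hPs k a).differentiable (by simp)).differentiableAt (x := s)
      have h2 := ((hPs k c).differentiable (by simp)).differentiableAt (x := s)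
      rw [deriv_fun_sub h1 h2, hPd, hPd]
    have hsupp : ∀ k, Function.support (η k) ⊆ Icc (a - m / 4) (c + m / 4) := by
      intro k s hs
      by_contra hn
      refine hs ?_
      rw [mem_Icc, not_and_or, not_le, not_le] at hn
      have := hr4 k
      rcases hn with hn | hn
      · have h1 := hP0 k a s (by linarith)
        have h2 := hP0 k c s (by linarith)
        simp [hη, h1, h2]
      · have h1 := hP1 k a s (by linarith)
        have h2 := hP1 k c s (by linarith)
        simp [hη, h1, h2]
    have hts : ∀ k, tsupport (η k) ⊆ Icc (a - m / 4) (c + m / 4) := fun k =>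
      closure_minimal (hsupp k) isClosed_Icc
    have hsub : Icc (a - m / 4) (c + m / 4) ⊆ Ioo 0 b := fun s hs =>
      ⟨by linarith [hs.1], by linarith [hs.2]⟩
    have hηabs : ∀ k s, |η k s| ≤ 1 := fun k s => by
      have h1 := hPb k a s
      have h2 := hPb k c s
      rw [abs_le]
      constructor <;> simp only [hη] <;> linarith [h1.1, h1.2, h2.1, h2.2]
    have hz : ∀ k, ∫ s in Ioo 0 b, (deriv (η k) s * J s + η k s * H s) = 0 := fun k =>
      h (η k) ((hPs k a).sub (hPs k c))
        (HasCompactSupport.of_support_subset_isCompact isCompact_Icc (hsupp k))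
        ((hts k).trans hsub)
    have hint2 : ∀ k, IntegrableOn (fun s => η k s * H s) (Ioo 0 b) := fun k =>
      Integrable.bdd_mul hH ((hPs k a).sub (hPs k c)).continuous.aestronglyMeasurable
        (c := 1) (ae_of_all _ fun s => hηabs k s)
    have hint1' : ∀ k (e : ℝ), a ≤ e → e ≤ c →
        Integrable (fun s => (φ k).normed volume (e - s) * J' s) := by
      intro k e hae hec
      have hsub' : Metric.closedBall e (φ k).rOut ⊆ Ioo 0 b := by
        rw [Real.closedBall_eq_Icc]
        refine (Icc_subset_Icc ?_ ?_).trans hsub <;> linarith [hr4 k]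
      have hcont : ContinuousOn (fun s => (φ k).normed volume (e - s) * J s)
          (Metric.closedBall e (φ k).rOut) :=
        (((φ k).continuous_normed.comp (continuous_const.sub continuous_id)).continuousOn).mul
          (hJo.mono hsub')
      have hi := hcont.integrableOn_compact (μ := volume) (isCompact_closedBall _ _)
      rw [← integrable_indicator_iff Metric.isClosed_closedBall.measurableSet] at hi
      refine hi.congr (ae_of_all _ fun s => ?_)
      by_cases hs : s ∈ Metric.closedBall e (φ k).rOut
      · simp only [indicator_of_mem hs, hJ', indicator_of_mem (hsub' hs)]
      · simp only [indicator_of_notMem hs]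
        have : e - s ∉ Function.support ((φ k).normed volume) := by
          rw [(φ k).support_normed_eq, Metric.mem_ball, dist_zero_right, not_lt]
          rw [Metric.mem_closedBall, dist_comm, dist_eq_norm, not_le] at hs
          exact hs.le
        simp at this
        simp [this]
    have hdJ : ∀ k, ∫ s in Ioo 0 b, deriv (η k) s * J s
        = (∫ s, (φ k).normed volume (a - s) * J' s) - ∫ s, (φ k).normed volume (c - s) * J' s := by
      intro k
      rw [← integral_sub (hint1' k a le_rfl hac.le) (hint1' k c hac.le le_rfl),
        ← integral_indicator measurableSet_Ioo]
      refine integral_congr_ae (ae_of_all _ fun s => ?_)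
      by_cases hs : s ∈ Ioo 0 b
      · simp only [indicator_of_mem hs, hJ', hηd]
        ring
      · simp only [indicator_of_notMem hs, hJ']
        ring
    have hintJ : ∀ k, IntegrableOn (fun s => deriv (η k) s * J s) (Ioo 0 b) := by
      intro k
      have h1 := (hint1' k a le_rfl hac.le).sub (hint1' k c hac.le le_rfl)
      refine (h1.integrableOn (s := Ioo 0 b)).congr_fun (fun s hs => ?_) measurableSet_Ioo
      simp only [Pi.sub_apply, hJ', hηd, indicator_of_mem hs]
      ring
    have hlim1 := (hconv a ⟨ha, hac.trans hcb⟩).sub (hconv c ⟨ha.trans hac, hcb⟩)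
    have hlim2 : Tendsto (fun k => ∫ s in Ioo 0 b, η k s * H s) atTop
        (𝓝 (∫ s in Ioo 0 b, (Ioo a c).indicator H s)) := by
      refine tendsto_integral_of_dominated_convergence (fun s => |H s|)
        (fun k => (hint2 k).aestronglyMeasurable) hH.abs (fun k => ae_of_all _ fun s => ?_) ?_
      · rw [norm_mul]
        exact mul_le_of_le_one_left (abs_nonneg _) (hηabs k s)
      · have hne : ∀ᵐ s ∂volume.restrict (Ioo 0 b), s ≠ a ∧ s ≠ c :=
          ae_restrict_of_ae ((ae_iff.2 (by simp)).and (ae_iff.2 (by simp)))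
        filter_upwards [hne] with s hs
        have hev : ∀ e : ℝ, s ≠ e → ∀ᶠ k in atTop, (φ k).rOut < |s - e| := fun e he =>
          hr0.eventually_lt_const (abs_pos.2 (sub_ne_zero.2 he))
        refine tendsto_const_nhds.congr' ?_
        filter_upwards [hev a hs.1, hev c hs.2] with k ka kc
        have hval : ∀ e : ℝ, (φ k).rOut < |s - e| →
            P k e s = if e < s then 1 else 0 := by
          intro e he
          split_ifs with hlt
          · rw [abs_of_pos (by linarith)] at he
            exact hP1 k e s (by linarith)
          · rw [abs_of_nonpos (by linarith)] at he
            exact hP0 k e s (by linarith)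
        have h1 := hval a ka
        have h2 := hval c kc
        simp only [hη, h1, h2]
        by_cases h3 : a < s
        · by_cases h4 : c < s
          · have : s ∉ Ioo a c := fun hh => by linarith [hh.2]
            simp [this, h3, h4]
          · have : s ∈ Ioo a c := ⟨h3, lt_of_le_of_ne (not_lt.1 h4) hs.2⟩
            simp [this, h3, h4]
        · have h4 : ¬ c < s := fun hh => h3 (hac.trans hh)
          have : s ∉ Ioo a c := fun hh => h3 hh.1
          simp [this, h3, h4]
    have hsum := hlim1.add hlim2
    have hzero : J a - J c + ∫ s in Ioo 0 b, (Ioo a c).indicator H s = 0 := by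
      refine tendsto_nhds_unique hsum (tendsto_const_nhds.congr fun k => ?_)
      rw [← hdJ, ← integral_add (hintJ k) (hint2 k)]
      exact (hz k).symm
    rw [setIntegral_indicator measurableSet_Ioo, inter_eq_right.2
      (Ioo_subset_Ioo ha.le hcb.le)] at hzero
    linarith
  rcases eq_or_lt_of_le ht.1 with rfl | h0
  · simp
  -- Only interior endpoints are covered so far; the initial value is reached by letting a ↓ 0,
  -- using continuity of J at 0 from the right and integrability of H.
  have hlimJ : Tendsto (fun a => J t - J a) (𝓝[>] 0) (𝓝 (J t - J 0)) := by
    refine tendsto_const_nhds.sub ?_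
    have : ContinuousWithinAt J (Ico 0 b) 0 := hJ 0 ⟨le_rfl, h0.trans ht.2⟩
    refine this.tendsto.mono_left ?_
    rw [← nhdsWithin_Ioo_eq_nhdsGT (h0.trans ht.2)]
    exact nhdsWithin_mono _ Ioo_subset_Ico_self
  have hHt : IntervalIntegrable H volume 0 t := by
    rw [intervalIntegrable_iff_integrableOn_Ioo_of_le h0.le]
    exact hH.mono_set (Ioo_subset_Ioo le_rfl ht.2.le)
  have hlimH : Tendsto (fun a => ∫ s in a..t, H s) (𝓝[>] 0) (𝓝 (∫ s in (0 : ℝ)..t, H s)) := by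
    have hc := intervalIntegral.continuousOn_primitive_interval_left (f := H) (μ := volume)
      (a := 0) (b := t) (by rw [uIcc_of_le h0.le, integrableOn_Icc_iff_integrableOn_Ioo]
                            exact hH.mono_set (Ioo_subset_Ioo le_rfl ht.2.le))
    have := hc 0 left_mem_uIcc
    refine this.tendsto.mono_left ?_
    rw [uIcc_of_le h0.le, ← nhdsWithin_Ioo_eq_nhdsGT h0]
    exact nhdsWithin_mono _ Ioo_subset_Icc_self
  rw [← intervalIntegral.integral_of_le h0.le |>.trans integral_Ioc_eq_integral_Ioo]
  refine tendsto_nhds_unique hlimJ (hlimH.congr' ?_)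
  filter_upwards [Ioo_mem_nhdsGT h0] with a ha
  rw [intervalIntegral.integral_of_le ha.2.le, integral_Ioc_eq_integral_Ioo]
  exact (key a t ha.1 ha.2 ht.2).symm

end DuBoisReymond

/-! ### Weak solutions of the heat equation and their time slices. -/

section WeakHeat
open Filter Topology

variable {E : Type*} [NormedAddCommGroup E] [InnerProductSpace ℝ E] [FiniteDimensional ℝ E]
  [MeasurableSpace E] [BorelSpace E]

/-- Translated mollifiers are admissible φ, so the mollifications of g are nonnegative, and they
converge to g almost everywhere by Lebesgue differentiation. -/
theorem ae_nonneg_of_forall_integral_mul_nonneg {g : E → ℝ} (hg : LocallyIntegrable g)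
    (h : ∀ φ : E → ℝ, ContDiff ℝ ∞ φ → HasCompactSupport φ → (∀ x, 0 ≤ φ x) →
      0 ≤ ∫ x, g x * φ x) : ∀ᵐ x, 0 ≤ g x := by
  set φ : ℕ → ContDiffBump (0 : E) := fun k =>
    ⟨1 / (k + 1 : ℝ) / 2, 1 / (k + 1 : ℝ), by positivity, half_lt_self (by positivity)⟩
  have hr0 : Tendsto (fun k => (φ k).rOut) atTop (𝓝 0) := tendsto_one_div_add_atTop_nhds_zero_nat
  filter_upwards [ContDiffBump.ae_convolution_tendsto_right_of_locallyIntegrable (K := 2) hr0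
    (Eventually.of_forall fun k => by change _ ≤ 2 * (_ / 2); linarith) hg] with x hx
  refine ge_of_tendsto' hx fun k => ?_
  rw [convolution_eq_swap]
  have := h (fun y => (φ k).normed volume (x - y))
    ((φ k).contDiff_normed.comp (contDiff_const.sub contDiff_id))
    ((φ k).hasCompactSupport_normed.comp_homeomorph (Homeomorph.subLeft x))
    (fun y => (φ k).nonneg_normed _)
  refine this.trans_eq (integral_congr_ae (ae_of_all _ fun y => ?_))
  simp [mul_comm]

/-- A strict violation at t would persist on an interval to the right of t, which has positive
measure. -/
theorem le_of_ae_le_of_continuousWithinAt {f : ℝ → ℝ} {t T c : ℝ} (ht : t ∈ Ico 0 T)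
    (hf : ContinuousWithinAt f (Ici t) t)
    (hc : ∀ᵐ s ∂volume.restrict (Ioo 0 T), f s ≤ c) : f t ≤ c := by
  by_contra! hlt
  have h1 : ∀ᶠ s in 𝓝[>] t, c < f s :=
    (hf.mono Ioi_subset_Ici_self).tendsto.eventually_const_lt hlt
  obtain ⟨b, hb, hsub⟩ := mem_nhdsGT_iff_exists_Ioo_subset.1 h1
  have hb' : t < min b T := lt_min hb ht.2
  have h2 : ∀ᵐ s ∂volume.restrict (Ioo t (min b T)), f s ≤ c :=
    ae_restrict_of_ae_restrict_of_subset (Ioo_subset_Ioo ht.1 (min_le_right _ _)) hc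
  have h3 : ∀ᵐ s ∂volume.restrict (Ioo t (min b T)), False := by
    filter_upwards [h2, ae_restrict_mem measurableSet_Ioo] with s hs hs'
    exact absurd (hsub ⟨hs'.1, hs'.2.trans_le (min_le_left _ _)⟩) (not_lt.2 hs)
  rw [eventually_false_iff_eq_bot, ae_eq_bot, Measure.restrict_eq_zero, Real.volume_Ioo] at h3
  simp only [ENNReal.ofReal_eq_zero] at h3
  linarith

/-- `v` is a weak solution of `∂ₜ v = Δ v + h` on `E × (0, T)`, weakly continuous in time on
`[0, ∞)`; `U` is a bounded measurable representative of `v` on `E × (0, T)`. -/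
structure IsWeakHeatSolution (T R : ℝ) (v : E → ℝ → ℝ) (U h : E × ℝ → ℝ) : Prop where
  measurable : Measurable U
  bound : ∀ z, |U z| ≤ R
  measurable_source : Measurable h
  bound_source : ∀ z, |h z| ≤ R
  ae_eq : ∀ᵐ s ∂volume.restrict (Ioo 0 T), ∀ᵐ x, v x s = U (x, s)
  locallyIntegrable : ∀ t : ℝ, 0 ≤ t → LocallyIntegrable (fun x => v x t) volume
  continuousOn_pairing : ∀ φ : E → ℝ, ContDiff ℝ ∞ φ → HasCompactSupport φ →
    ContinuousOn (fun t : ℝ => ∫ x, v x t * φ x) (Ici 0)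
  equation : ∀ φ : E × ℝ → ℝ, ContDiff ℝ ∞ φ → HasCompactSupport φ →
    tsupport φ ⊆ univ ×ˢ Ioo 0 T →
      ∫ z : E × ℝ, (U z * (deriv (fun s => φ (z.1, s)) z.2
            + Laplacian.laplacian (fun y => φ (y, z.2)) z.1) + h z * φ z) = 0

namespace IsWeakHeatSolution

variable {T R : ℝ} {v : E → ℝ → ℝ} {U h : E × ℝ → ℝ}

theorem bound_nonneg (H : IsWeakHeatSolution T R v U h) : 0 ≤ R :=
  (abs_nonneg _).trans (H.bound 0)

theorem integrable_mul_test (H : IsWeakHeatSolution T R v U h) {t : ℝ} (ht : 0 ≤ t) {φ : E → ℝ}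
    (hφ : ContDiff ℝ ∞ φ) (hφc : HasCompactSupport φ) : Integrable fun x => v x t * φ x := by
  have := (H.locallyIntegrable t ht).integrable_smul_left_of_hasCompactSupport hφ.continuous hφc
  refine this.congr (ae_of_all _ fun x => ?_)
  simp [mul_comm]

/-- Pairings with nonnegative test functions are continuous in time, so an inequality at almost
every time passes to every time in [0, T), including the initial one. The factor σ serves to cover
upper and lower bounds at once. -/
theorem ae_le_of_ae_le (H : IsWeakHeatSolution T R v U h) {c : ℝ} {t : ℝ} (ht : t ∈ Ico 0 T)
    (σ : ℝ) (hc : ∀ᵐ s ∂volume.restrict (Ioo 0 T), ∀ᵐ x, σ * v x s ≤ c) :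
    ∀ᵐ x, σ * v x t ≤ c := by
  have : ∀ᵐ x, 0 ≤ c - σ * v x t := by
    refine ae_nonneg_of_forall_integral_mul_nonneg
      ((locallyIntegrable_const c).sub ((H.locallyIntegrable t ht.1).smul σ)) fun φ hφ hφc hφ0 => ?_
    have hφi : Integrable φ := hφ.continuous.integrable_of_hasCompactSupport hφc
    have e : ∀ s, 0 ≤ s → ∫ x, (c - σ * v x s) * φ x
        = c * (∫ x, φ x) - σ * ∫ x, v x s * φ x := by
      intro s hs
      have e1 : ∀ x, (c - σ * v x s) * φ x = c * φ x - σ * (v x s * φ x) := fun x => by ring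
      simp only [e1]
      rw [integral_sub (hφi.const_mul c) ((H.integrable_mul_test hs hφ hφc).const_mul σ),
        integral_const_mul, integral_const_mul]
    rw [e t ht.1, sub_nonneg]
    refine le_of_ae_le_of_continuousWithinAt (f := fun s => σ * ∫ x, v x s * φ x) ht
      (((H.continuousOn_pairing φ hφ hφc t ht.1).mono (Ici_subset_Ici.2 ht.1)).const_mul σ) ?_
    filter_upwards [hc, ae_restrict_mem measurableSet_Ioo] with s hs hs'
    rw [← sub_nonneg, ← e s hs'.1.le]
    refine integral_nonneg_of_ae ?_
    filter_upwards [hs] with x hx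
    exact mul_nonneg (by linarith) (hφ0 x)
  filter_upwards [this] with x hx
  linarith

theorem ae_abs_le (H : IsWeakHeatSolution T R v U h) {t : ℝ} (ht : t ∈ Ico 0 T) :
    ∀ᵐ x, |v x t| ≤ R := by
  have h1 := H.ae_le_of_ae_le (c := R) ht 1 (by
    filter_upwards [H.ae_eq] with s hs
    filter_upwards [hs] with x hx
    rw [hx, one_mul]
    exact (abs_le.1 (H.bound _)).2)
  have h2 := H.ae_le_of_ae_le (c := R) ht (-1) (by
    filter_upwards [H.ae_eq] with s hs
    filter_upwards [hs] with x hx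
    rw [hx]
    linarith [(abs_le.1 (H.bound (x, s))).1])
  filter_upwards [h1, h2] with x hx1 hx2
  rw [abs_le]
  constructor <;> linarith

theorem aestronglyMeasurable (H : IsWeakHeatSolution T R v U h) {t : ℝ} (ht : 0 ≤ t) :
    AEStronglyMeasurable (fun x => v x t) :=
  (H.locallyIntegrable t ht).aestronglyMeasurable

/-- Test functions are dense in L¹ and the slices share a sup bound, so weak continuity extends by
uniform approximation to all integrable ψ. The case needed is the heat kernel, which has no compact
support. -/
theorem continuousOn_integral_mul (H : IsWeakHeatSolution T R v U h) {ψ : E → ℝ}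
    (hψ : Integrable ψ) : ContinuousOn (fun t => ∫ x, v x t * ψ x) (Ico 0 T) := by
  refine continuousOn_of_uniform_approx_of_continuousOn fun u hu => ?_
  obtain ⟨ε, hε, hεu⟩ := Metric.mem_uniformity_dist.1 hu
  have hR := H.bound_nonneg
  obtain ⟨φ, hφc, hφ, hφε⟩ := (memLp_one_iff_integrable.2 hψ).exist_eLpNorm_sub_le
    ENNReal.one_ne_top le_rfl (show 0 < ε / (2 * (R + 1)) by positivity)
  refine ⟨fun t => ∫ x, v x t * φ x,
    (H.continuousOn_pairing φ hφ hφc).mono Ico_subset_Ici_self, fun t ht => hεu ?_⟩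
  have hφi : Integrable φ := hφ.continuous.integrable_of_hasCompactSupport hφc
  have hb := H.ae_abs_le ht
  have hm := H.aestronglyMeasurable ht.1
  have hd : ∫ x, ‖ψ x - φ x‖ ≤ ε / (2 * (R + 1)) := by
    rw [eLpNorm_one_eq_lintegral_enorm] at hφε
    have h2 : ENNReal.ofReal (∫ x, ‖ψ x - φ x‖) ≤ ENNReal.ofReal (ε / (2 * (R + 1))) :=
      (ofReal_integral_norm_eq_lintegral_enorm (hψ.sub hφi)).trans_le hφε
    exact (ENNReal.ofReal_le_ofReal_iff (by positivity)).1 h2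
  rw [dist_eq_norm, ← integral_sub (hψ.bdd_mul hm hb) (hφi.bdd_mul hm hb)]
  have h3 : ‖∫ x, (v x t * ψ x - v x t * φ x)‖ ≤ ∫ x, R * ‖ψ x - φ x‖ := by
    refine norm_integral_le_of_norm_le ((hψ.sub hφi).norm.const_mul R) ?_
    filter_upwards [hb] with x hx
    rw [← mul_sub, norm_mul]
    exact mul_le_mul_of_nonneg_right hx (norm_nonneg _)
  rw [integral_const_mul] at h3
  have h4 : R * (∫ x, ‖ψ x - φ x‖) ≤ R * (ε / (2 * (R + 1))) := by gcongr
  have h5 : R * (ε / (2 * (R + 1))) < ε := by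
    rw [mul_div_assoc', div_lt_iff₀ (by positivity)]
    nlinarith
  linarith

/-- Kernel and slice both move with s. Freezing the kernel leaves a pairing with a fixed L¹
function; the error from freezing it is the L¹ modulus of the kernel times the common sup bound. -/
theorem continuousOn_heatConv (H : IsWeakHeatSolution T R v U h) (S : ℝ) (z : E) :
    ContinuousOn (fun s => heatConv (S - s) (fun x => v x s) z) (Ico 0 (min S T)) := by
  intro s₀ hs₀
  have hR := H.bound_nonneg
  have hτ₀ : 0 < S - s₀ := sub_pos.2 (hs₀.2.trans_le (min_le_left _ _))
  have hsub : Ico 0 (min S T) ⊆ Ico 0 T := Ico_subset_Ico_right (min_le_right _ _)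
  have h1 : ContinuousWithinAt (fun s => heatConv (S - s₀) (fun x => v x s) z)
      (Ico 0 (min S T)) s₀ := by
    have := (H.continuousOn_integral_mul (integrable_heatKernel_sub hτ₀ z)) s₀ (hsub hs₀)
    refine (this.mono hsub).congr (fun s _ => ?_) ?_ <;> simp only [heatConv, mul_comm]
  have h2 : Tendsto (fun s => heatConv (S - s) (fun x => v x s) z
      - heatConv (S - s₀) (fun x => v x s) z) (𝓝[Ico 0 (min S T)] s₀) (𝓝 0) := by
    have h3 : Tendsto (fun s => (∫ x : E, |heatKernel (S - s) x - heatKernel (S - s₀) x|) * R)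
        (𝓝 s₀) (𝓝 0) := by
      have h4 : Tendsto (fun s : ℝ => S - s) (𝓝 s₀) (𝓝 (S - s₀)) :=
        tendsto_const_nhds.sub tendsto_id
      simpa using ((tendsto_integral_abs_heatKernel_sub (E := E) hτ₀).comp h4).mul_const R
    rw [tendsto_zero_iff_norm_tendsto_zero]
    refine squeeze_zero' (Eventually.of_forall fun _ => norm_nonneg _) ?_
      (h3.mono_left nhdsWithin_le_nhds)
    filter_upwards [self_mem_nhdsWithin] with s hs
    exact abs_heatConv_sub_heatConv_le (sub_pos.2 (hs.2.trans_le (min_le_left _ _))) hτ₀ z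
      (H.aestronglyMeasurable hs.1) (H.ae_abs_le (hsub hs))
  have h5 := h2.add h1.tendsto
  simp only [sub_add_cancel, zero_add] at h5
  exact h5

end IsWeakHeatSolution

end WeakHeat

/-! ### The backward heat kernel as a test function. -/

section TestHeatKernel
set_option linter.unusedSectionVars false
open Filter Topology

variable {E : Type*} [NormedAddCommGroup E] [InnerProductSpace ℝ E] [FiniteDimensional ℝ E]

theorem abs_laplacian_le (f : E → ℝ) (x : E) :
    |Laplacian.laplacian f x| ≤ Module.finrank ℝ E * ‖iteratedFDeriv ℝ 2 f x‖ := by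
  rw [InnerProductSpace.laplacian_eq_iteratedFDeriv_stdOrthonormalBasis]
  refine (Finset.abs_sum_le_sum_abs _ _).trans ?_
  have h : ∀ i ∈ Finset.univ, |iteratedFDeriv ℝ 2 f x
      ![stdOrthonormalBasis ℝ E i, stdOrthonormalBasis ℝ E i]| ≤ ‖iteratedFDeriv ℝ 2 f x‖ := by
    intro i _
    refine ((iteratedFDeriv ℝ 2 f x).le_opNorm _).trans ?_
    simp [Fin.prod_univ_two]
  refine (Finset.sum_le_sum h).trans ?_
  simp

/-- Smooth cutoffs tending to `1` with derivatives bounded up to the second order. -/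
theorem exists_smooth_cutoff (E : Type*) [NormedAddCommGroup E] [InnerProductSpace ℝ E]
    [FiniteDimensional ℝ E] : ∃ (B : ℝ) (χ : ℕ → E → ℝ), 0 ≤ B ∧ (∀ k, ContDiff ℝ ∞ (χ k)) ∧
      (∀ k, HasCompactSupport (χ k)) ∧
      (∀ k, ∀ i ≤ 2, ∀ x, ‖iteratedFDeriv ℝ i (χ k) x‖ ≤ B) ∧
      ∀ x, ∀ᶠ k in atTop, χ k =ᶠ[𝓝 x] fun _ => 1 := by
  set f : ContDiffBump (0 : E) := ⟨1, 2, one_pos, one_lt_two⟩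
  have hb : ∀ i : ℕ, ∃ B, ∀ x, ‖iteratedFDeriv ℝ i (f : E → ℝ) x‖ ≤ B := fun i =>
    (f.hasCompactSupport.iteratedFDeriv i).exists_bound_of_continuous
      (f.contDiff.continuous_iteratedFDeriv (n := ∞) (mod_cast le_top))
  choose B hB using hb
  have hB0 : ∀ i, 0 ≤ B i := fun i => (norm_nonneg _).trans (hB i 0)
  have hc : ∀ k : ℕ, 0 < (1 / (k + 1 : ℝ)) ∧ (1 / (k + 1 : ℝ)) ≤ 1 := fun k =>
    ⟨by positivity, by rw [div_le_one (by positivity)]; linarith [(Nat.cast_nonneg k : (0 : ℝ) ≤ k)]⟩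
  refine ⟨∑ i ∈ Finset.range 3, B i, fun k x => f ((1 / (k + 1 : ℝ)) • x),
    Finset.sum_nonneg fun i _ => hB0 i, fun k => f.contDiff.comp (contDiff_const_smul _),
    fun k => f.hasCompactSupport.comp_smul (hc k).1.ne', fun k i hi x => ?_, fun x => ?_⟩
  · rw [iteratedFDeriv_comp_const_smul _ f.contDiff, norm_smul, norm_pow,
      Real.norm_of_nonneg (hc k).1.le]
    refine (mul_le_of_le_one_left (norm_nonneg _) (pow_le_one₀ (hc k).1.le (hc k).2)).trans ?_
    exact (hB i _).trans (Finset.single_le_sum (f := B) (fun i _ => hB0 i)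
      (Finset.mem_range.2 (by omega)))
  · have h1 : Tendsto (fun k : ℕ => (k : ℝ) + 1) atTop atTop :=
      tendsto_atTop_add_const_right _ _ tendsto_natCast_atTop_atTop
    filter_upwards [h1.eventually_gt_atTop ‖x‖] with k hk
    have h2 : ∀ᶠ y in 𝓝 x, ‖y‖ < (k : ℝ) + 1 :=
      continuous_norm.continuousAt.eventually_lt_const hk
    filter_upwards [h2] with y hy
    refine f.one_of_mem_closedBall ?_
    rw [mem_closedBall_zero_iff, norm_smul, Real.norm_of_nonneg (hc k).1.le]
    change _ ≤ (1 : ℝ)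
    rw [one_div, inv_mul_le_iff₀ (by positivity)]
    linarith

/-- Uniform Gaussian bounds for the derivatives of the heat kernel away from time zero. -/
theorem exists_norm_iteratedFDeriv_heatKernel_le {τ₀ S : ℝ} (hτ₀ : 0 < τ₀) :
    ∃ C, 0 ≤ C ∧ ∀ τ ∈ Icc τ₀ S, ∀ i ≤ 2, ∀ x : E,
      ‖iteratedFDeriv ℝ i (heatKernel τ : E → ℝ) x‖ ≤ C * heatKernel (2 * S) x := by
  set c : ℝ := (2 : ℝ) ^ (Module.finrank ℝ E / 2 : ℝ) with hc
  have hc0 : 0 < c := by positivity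
  set q : ℝ := (2 * S / (2 * τ₀)) ^ (Module.finrank ℝ E / 2 : ℝ)
  set C₀ : ℝ := c
  set C₁ : ℝ := c * Real.exp 2 * τ₀ ^ (-(1 / 2) : ℝ)
  set C₂ : ℝ := (c * Real.exp 8 / (2 * τ₀) + c / (2 * τ₀))
  by_cases hS : τ₀ ≤ S
  swap
  · refine ⟨0, le_rfl, fun τ hτ => absurd (hτ.1.trans hτ.2) hS⟩
  have hS0 : 0 < S := hτ₀.trans_le hS
  have hq : 0 ≤ q := by positivity
  refine ⟨(C₀ + C₁ + C₂) * q, by positivity, fun τ hτ i hi x => ?_⟩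
  have hτ0 : 0 < τ := hτ₀.trans_le hτ.1
  have hk := heatKernel_pos hτ0 x
  have hk2 := heatKernel_pos (show 0 < 2 * τ by positivity) x
  have h0 : heatKernel τ x ≤ c * heatKernel (2 * τ) x := by
    simpa using exp_mul_heatKernel_le hτ0 0 x
  have hcmp : heatKernel (2 * τ) x ≤ q * heatKernel (2 * S) x :=
    heatKernel_le_of_le (by positivity) (by linarith [hτ.1]) (by linarith [hτ.2]) x
  suffices hs : ‖iteratedFDeriv ℝ i (heatKernel τ : E → ℝ) x‖
      ≤ (C₀ + C₁ + C₂) * heatKernel (2 * τ) x by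
    refine hs.trans ?_
    rw [mul_assoc]
    exact mul_le_mul_of_nonneg_left hcmp (by positivity)
  have n0 : 0 ≤ C₀ * heatKernel (2 * τ) x := by positivity
  have n1 : 0 ≤ C₁ * heatKernel (2 * τ) x := by positivity
  have n2 : 0 ≤ C₂ * heatKernel (2 * τ) x := by positivity
  rw [add_mul, add_mul]
  interval_cases i
  · rw [norm_iteratedFDeriv_zero, Real.norm_of_nonneg hk.le]
    linarith
  · rw [norm_iteratedFDeriv_one]
    have h1 : τ ^ (-(1 / 2) : ℝ) ≤ τ₀ ^ (-(1 / 2) : ℝ) :=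
      Real.rpow_le_rpow_of_nonpos hτ₀ hτ.1 (by norm_num)
    have h2 : c * Real.exp 2 * τ ^ (-(1 / 2) : ℝ) * heatKernel (2 * τ) x
        ≤ C₁ * heatKernel (2 * τ) x :=
      mul_le_mul_of_nonneg_right (mul_le_mul_of_nonneg_left h1 (by positivity)) hk2.le
    linarith [norm_fderiv_heatKernel_le hτ0 x]
  · have h3 := rpow_mul_heatKernel_le hτ0 zero_le_two x
    have e8 : (2 : ℝ) * 2 ^ 2 = 8 := by norm_num
    rw [e8, Real.rpow_two, div_self two_ne_zero, Real.rpow_one] at h3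
    have h4 := norm_iteratedFDeriv_two_heatKernel_le hτ0 x
    have h5 : heatKernel τ x / (2 * τ) * (‖x‖ ^ 2 / (2 * τ) + 1)
        ≤ C₂ * heatKernel (2 * τ) x := by
      calc heatKernel τ x / (2 * τ) * (‖x‖ ^ 2 / (2 * τ) + 1)
          = (‖x‖ ^ 2 * heatKernel τ x) / (2 * τ) / (2 * τ) + heatKernel τ x / (2 * τ) := by
            field_simp
        _ ≤ (c * Real.exp 8 * τ * heatKernel (2 * τ) x) / (2 * τ) / (2 * τ)
            + (c * heatKernel (2 * τ) x) / (2 * τ) := by gcongr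
        _ = (c * Real.exp 8 / 2 + c) * heatKernel (2 * τ) x / (2 * τ) := by
            field_simp
        _ ≤ (c * Real.exp 8 + c) * heatKernel (2 * τ) x / (2 * τ₀) := by
            have := hτ.1
            have : c * Real.exp 8 / 2 ≤ c * Real.exp 8 := half_le_self (by positivity)
            gcongr
        _ = _ := by ring
    linarith

theorem continuous_laplacian_fst {φ : E × ℝ → ℝ} (hφ : ContDiff ℝ ∞ φ) :
    Continuous fun q : E × ℝ => Laplacian.laplacian (fun y => φ (y, q.2)) q.1 := by
  have e : ∀ q : E × ℝ, Laplacian.laplacian (fun y => φ (y, q.2)) q.1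
      = ∑ i, iteratedFDeriv ℝ 2 φ q (fun _ => (stdOrthonormalBasis ℝ E i, (0 : ℝ))) := by
    intro q
    rw [InnerProductSpace.laplacian_eq_iteratedFDeriv_stdOrthonormalBasis]
    refine Finset.sum_congr rfl fun i _ => ?_
    have h1 : (fun y => φ (y, q.2))
        = (fun p : E × ℝ => φ (p + (0, q.2))) ∘ (ContinuousLinearMap.inl ℝ E ℝ) := by
      ext y
      simp
    have h2 : ContDiff ℝ ∞ (fun p : E × ℝ => φ (p + (0, q.2))) :=
      hφ.comp (contDiff_id.add contDiff_const)
    rw [h1, ContinuousLinearMap.iteratedFDeriv_comp_right _ h2 _ (i := 2)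
        ENat.LEInfty.out,
      iteratedFDeriv_comp_add_right]
    simp only [ContinuousMultilinearMap.compContinuousLinearMap_apply, ContinuousLinearMap.inl_apply,
      Prod.mk_add_mk, add_zero, zero_add]
    congr 1
    ext j <;> fin_cases j <;> rfl
  rw [funext e]
  refine continuous_finsetSum _ fun i _ => ?_
  exact (ContinuousMultilinearMap.apply ℝ (fun _ : Fin 2 => E × ℝ) ℝ
    (fun _ => (stdOrthonormalBasis ℝ E i, (0 : ℝ)))).continuous.comp
    (hφ.continuous_iteratedFDeriv (m := 2)
      ENat.LEInfty.out)

theorem continuous_deriv_snd {φ : E × ℝ → ℝ} (hφ : ContDiff ℝ ∞ φ) :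
    Continuous fun q : E × ℝ => deriv (fun s => φ (q.1, s)) q.2 := by
  have e : ∀ q : E × ℝ, deriv (fun s => φ (q.1, s)) q.2 = fderiv ℝ φ q (0, 1) := by
    intro q
    have h1 : HasFDerivAt φ (fderiv ℝ φ q) (q.1, q.2) :=
      (hφ.differentiable (by simp)).differentiableAt.hasFDerivAt
    exact (h1.comp_hasDerivAt q.2 ((hasDerivAt_const q.2 q.1).prodMk (hasDerivAt_id q.2))).deriv
  rw [funext e]
  exact (hφ.continuous_fderiv (by simp)).clm_apply continuous_const

variable [MeasurableSpace E] [BorelSpace E] {T R : ℝ} {v : E → ℝ → ℝ} {U h : E × ℝ → ℝ}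

/-- The test function is η(s) p_{S−s}(x − z). The backward kernel satisfies ∂ₛ + Δ = 0, so only the
derivative of η survives. Compact support in x is provided by cutoffs, which are removed by
dominated convergence: all derivatives involved are bounded by a multiple of p_{2S}(x − z). -/
theorem IsWeakHeatSolution.equation_mul_heatKernel (H : IsWeakHeatSolution T R v U h) {S : ℝ}
    (z : E) {η : ℝ → ℝ} (hη : ContDiff ℝ ∞ η) (hηc : HasCompactSupport η)
    (hsupp : tsupport η ⊆ Ioo 0 (min S T)) :
    Integrable (fun q : E × ℝ => (U q * deriv η q.2 + h q * η q.2) * heatKernel (S - q.2) (q.1 - z))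
    ∧ ∫ q : E × ℝ, (U q * deriv η q.2 + h q * η q.2) * heatKernel (S - q.2) (q.1 - z) = 0 := by
  have hR := H.bound_nonneg
  obtain ⟨B, χ, hB, hχ, hχc, hχB, hχ1⟩ := exists_smooth_cutoff E
  have hS : ∀ s ∈ tsupport η, s < S := fun s hs => (hsupp hs).2.trans_le (min_le_left _ _)
  -- the support of `η` stays away from `S`
  obtain ⟨τ₀, hτ₀, hτ₀S⟩ : ∃ τ₀ : ℝ, 0 < τ₀ ∧ ∀ s ∈ tsupport η, S - s ∈ Icc τ₀ S := by
    rcases (tsupport η).eq_empty_or_nonempty with he | hne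
    · exact ⟨1, one_pos, by simp [he]⟩
    · obtain ⟨s₁, hs₁, hmax⟩ := hηc.exists_isMaxOn hne continuousOn_id
      refine ⟨S - s₁, sub_pos.2 (hS _ hs₁), fun s hs => ⟨?_, ?_⟩⟩
      · have : s ≤ s₁ := hmax hs
        linarith
      · linarith [(hsupp hs).1]
  obtain ⟨C, hC, hCb⟩ := exists_norm_iteratedFDeriv_heatKernel_le (E := E) (S := S) hτ₀
  obtain ⟨D, hD⟩ := hηc.exists_bound_of_continuous hη.continuous
  obtain ⟨D', hD'⟩ := hηc.deriv.exists_bound_of_continuous (hη.continuous_deriv (by simp))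
  have hD0 : 0 ≤ D := (norm_nonneg _).trans (hD 0)
  have hD0' : 0 ≤ D' := (norm_nonneg _).trans (hD' 0)
  set d : ℝ := ((Module.finrank ℝ E : ℕ) : ℝ)
  have hd : 0 ≤ d := Nat.cast_nonneg _
  have hηz : ∀ s, s ∉ tsupport η → η s = 0 := fun s hs => image_eq_zero_of_notMem_tsupport hs
  have hηz' : ∀ s, s ∉ tsupport η → deriv η s = 0 := fun s hs =>
    image_eq_zero_of_notMem_tsupport fun hh => hs (tsupport_deriv_subset hh)
  set φ : ℕ → E × ℝ → ℝ := fun k q =>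
    η q.2 * (χ k (q.1 - z) * heatKernel (S - q.2) (q.1 - z)) with hφ
  have hφz : ∀ k q, q.2 ∉ tsupport η → φ k q = 0 := fun k q hq => by
    simp only [hφ, hηz _ hq, zero_mul]
  have hφs : ∀ k, ContDiff ℝ ∞ (φ k) := by
    intro k
    rw [contDiff_iff_contDiffAt]
    intro q
    -- The kernel is singular at time S, but the support of η lies strictly before S, so the product
    -- vanishes near every point with time at least S.
    by_cases hq : q.2 < S
    · refine (hη.comp contDiff_snd).contDiffAt.mul
        (((hχ k).comp (contDiff_fst.sub contDiff_const)).contDiffAt.mul ?_)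
      have h1 : ContDiffAt ℝ ∞ (fun p : E × ℝ => heatKernel p.2 p.1) (q.1 - z, S - q.2) :=
        contDiffAt_heatKernel_uncurry (sub_pos.2 hq)
      exact h1.comp q ((contDiffAt_fst.sub contDiffAt_const).prodMk
        (contDiffAt_const.sub contDiffAt_snd))
    · have h1 : ∀ᶠ p : E × ℝ in 𝓝 q, p.2 ∉ tsupport η :=
        continuous_snd.continuousAt.eventually
          ((isClosed_tsupport η).isOpen_compl.mem_nhds fun hh => hq (hS _ hh))
      refine (contDiffAt_const (c := (0 : ℝ))).congr_of_eventuallyEq ?_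
      filter_upwards [h1] with p hp
      exact hφz k p hp
  have hsub : ∀ k, Function.support (φ k)
      ⊆ ((fun y => y + z) '' tsupport (χ k)) ×ˢ tsupport η := by
    intro k q hq
    have hq1 : η q.2 ≠ 0 := left_ne_zero_of_mul hq
    have hq2 : χ k (q.1 - z) ≠ 0 := left_ne_zero_of_mul (right_ne_zero_of_mul hq)
    exact ⟨⟨q.1 - z, subset_tsupport _ hq2, sub_add_cancel _ _⟩, subset_tsupport _ hq1⟩
  have hK : ∀ k, IsCompact (((fun y => y + z) '' tsupport (χ k)) ×ˢ tsupport η) := fun k =>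
    ((hχc k).isCompact.image (continuous_add_const z)).prod hηc.isCompact
  have hφc : ∀ k, HasCompactSupport (φ k) := fun k =>
    HasCompactSupport.of_support_subset_isCompact (hK k) (hsub k)
  have hφt : ∀ k, tsupport (φ k) ⊆ univ ×ˢ Ioo 0 T := fun k q hq =>
    ⟨mem_univ _, (hsupp ((closure_minimal (hsub k) (hK k).isClosed) hq).2).1,
      (hsupp ((closure_minimal (hsub k) (hK k).isClosed) hq).2).2.trans_le (min_le_right _ _)⟩
  have heq := fun k => H.equation (φ k) (hφs k) (hφc k) (hφt k)
  -- derivatives of the test functions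
  have hdt : ∀ k (q : E × ℝ), q.2 ∈ tsupport η → deriv (fun s => φ k (q.1, s)) q.2
      = deriv η q.2 * (χ k (q.1 - z) * heatKernel (S - q.2) (q.1 - z))
        - η q.2 * (χ k (q.1 - z) * Laplacian.laplacian (heatKernel (S - q.2) : E → ℝ) (q.1 - z)) := by
    intro k q hq
    have hpos : 0 < S - q.2 := sub_pos.2 (hS _ hq)
    have h1 := ((hasDerivAt_heatKernel_time hpos (q.1 - z)).comp_const_sub S q.2).const_mul
      (χ k (q.1 - z))
    have h2 := ((hη.differentiable (by simp)).differentiableAt (x := q.2)).hasDerivAt.mul h1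
    rw [laplacian_heatKernel hpos]
    refine h2.deriv.trans ?_
    ring
  have hlap : ∀ k (q : E × ℝ), Laplacian.laplacian (fun y => φ k (y, q.2)) q.1
      = η q.2 * Laplacian.laplacian (fun y => χ k y * heatKernel (S - q.2) y) (q.1 - z) := by
    intro k q
    have hs : ContDiff ℝ 2 (fun y => χ k (y - z) * heatKernel (S - q.2) (y - z)) :=
      (((hχ k).of_le ENat.LEInfty.out).mul (contDiff_heatKernel _)).comp
        (contDiff_id.sub contDiff_const)
    have h1 := InnerProductSpace.laplacian_smul (η q.2) hs.contDiffAt (x := q.1)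
    refine h1.trans ?_
    rw [smul_eq_mul, InnerProductSpace.laplacian_eq_iteratedFDeriv_stdOrthonormalBasis,
      InnerProductSpace.laplacian_eq_iteratedFDeriv_stdOrthonormalBasis]
    congr 1
    refine Finset.sum_congr rfl fun i _ => ?_
    rw [iteratedFDeriv_comp_sub (f := fun y => χ k y * heatKernel (S - q.2) y)]
  have hlapB : ∀ k, ∀ s ∈ tsupport η, ∀ y : E,
      |Laplacian.laplacian (fun y => χ k y * heatKernel (S - s) y) y|
        ≤ d * (4 * B * C * heatKernel (2 * S) y) := by
    intro k s hs y
    refine (abs_laplacian_le _ y).trans (mul_le_mul_of_nonneg_left ?_ hd)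
    refine (norm_iteratedFDeriv_mul_le (N := 2) ((hχ k).of_le ENat.LEInfty.out)
      (contDiff_heatKernel _) y (n := 2) le_rfl).trans ?_
    have hb : ∀ i ∈ Finset.range (2 + 1), ((2).choose i : ℝ) * ‖iteratedFDeriv ℝ i (χ k) y‖
        * ‖iteratedFDeriv ℝ (2 - i) (heatKernel (S - s) : E → ℝ) y‖
        ≤ ((2).choose i : ℝ) * B * (C * heatKernel (2 * S) y) := by
      intro i hi
      have hi' : i ≤ 2 := Nat.lt_succ_iff.1 (Finset.mem_range.1 hi)
      have h1 := hχB k i hi' y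
      have h2 := hCb (S - s) (hτ₀S s hs) (2 - i) (Nat.sub_le _ _) y
      gcongr
    refine (Finset.sum_le_sum hb).trans (le_of_eq ?_)
    simp [Finset.sum_range_succ]
    ring
  have hkB : ∀ s ∈ tsupport η, ∀ y : E, heatKernel (S - s) y ≤ C * heatKernel (2 * S) y := by
    intro s hs y
    have := hCb (S - s) (hτ₀S s hs) 0 (by omega) y
    rw [norm_iteratedFDeriv_zero] at this
    exact (Real.le_norm_self _).trans this
  have hlapB' : ∀ s ∈ tsupport η, ∀ y : E,
      |Laplacian.laplacian (heatKernel (S - s) : E → ℝ) y| ≤ d * (C * heatKernel (2 * S) y) :=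
    fun s hs y => (abs_laplacian_le _ y).trans
      (mul_le_mul_of_nonneg_left (hCb _ (hτ₀S s hs) 2 le_rfl y) hd)
  have hχB0 : ∀ k y, |χ k y| ≤ B := fun k y => by
    have := hχB k 0 (by omega) y
    rwa [norm_iteratedFDeriv_zero] at this
  set F : ℕ → E × ℝ → ℝ := fun k q => U q * (deriv (fun s => φ k (q.1, s)) q.2
    + Laplacian.laplacian (fun y => φ k (y, q.2)) q.1) + h q * φ k q with hF
  set G : E × ℝ → ℝ := fun q => (U q * deriv η q.2 + h q * η q.2)
    * heatKernel (S - q.2) (q.1 - z) with hG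
  have hFz : ∀ k q, q.2 ∉ tsupport η → F k q = 0 := by
    intro k q hq
    have h1 : deriv (fun s => φ k (q.1, s)) q.2 = 0 := by
      have : (fun s => φ k (q.1, s)) =ᶠ[𝓝 q.2] fun _ => 0 := by
        filter_upwards [(isClosed_tsupport η).isOpen_compl.mem_nhds hq] with s hs
        exact hφz k (q.1, s) hs
      rw [this.deriv_eq, deriv_const]
    simp only [hF, h1, hlap, hηz _ hq, hφz k q hq]
    simp
  have hGz : ∀ q : E × ℝ, q.2 ∉ tsupport η → G q = 0 := by
    intro q hq
    simp only [hG, hηz _ hq, hηz' _ hq]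
    simp
  set M : ℝ := R * (D' * (B * C) + D * (B * (d * C)) + D * (d * (4 * B * C))) + R * (D * (B * C))
    with hM
  set bound : E × ℝ → ℝ := fun q =>
    heatKernel (2 * S) (q.1 - z) * (tsupport η).indicator (fun _ => M) q.2 with hbound
  have hFb : ∀ k q, ‖F k q‖ ≤ bound q := by
    intro k q
    by_cases hq : q.2 ∈ tsupport η
    swap
    · rw [hFz k q hq, norm_zero, hbound]
      simp [hq]
    simp only [hbound, indicator_of_mem hq, hF]
    have hSpos : 0 < S := by
      have := (hsupp hq).1
      linarith [hS _ hq]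
    have hp := heatKernel_pos (show 0 < 2 * S by positivity) (q.1 - z)
    have hp' := heatKernel_pos (sub_pos.2 (hS _ hq)) (q.1 - z)
    set p := heatKernel (2 * S) (q.1 - z)
    have hUb := H.bound q
    have hhb := H.bound_source q
    have e1 : |deriv (fun s => φ k (q.1, s)) q.2| ≤ (D' * (B * C) + D * (B * (d * C))) * p := by
      rw [hdt k q hq]
      refine (abs_sub _ _).trans ?_
      rw [abs_mul, abs_mul, abs_mul, abs_mul, abs_of_pos hp']
      have i1 := hD q.2
      have i2 := hD' q.2
      have i3 := hχB0 k (q.1 - z)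
      have i4 := hkB q.2 hq (q.1 - z)
      have i5 := hlapB' q.2 hq (q.1 - z)
      rw [Real.norm_eq_abs] at i1 i2
      calc _ ≤ D' * (B * (C * p)) + D * (B * (d * (C * p))) := by gcongr
        _ = _ := by ring
    have e2 : |Laplacian.laplacian (fun y => φ k (y, q.2)) q.1| ≤ D * (d * (4 * B * C)) * p := by
      rw [hlap, abs_mul]
      have i1 := hD q.2
      have i5 := hlapB k q.2 hq (q.1 - z)
      rw [Real.norm_eq_abs] at i1
      calc _ ≤ D * (d * (4 * B * C * p)) := by gcongr
        _ = _ := by ring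
    have e3 : |φ k q| ≤ D * (B * C) * p := by
      simp only [hφ]
      rw [abs_mul, abs_mul, abs_of_pos hp']
      have i1 := hD q.2
      have i3 := hχB0 k (q.1 - z)
      have i4 := hkB q.2 hq (q.1 - z)
      rw [Real.norm_eq_abs] at i1
      calc _ ≤ D * (B * (C * p)) := by gcongr
        _ = _ := by ring
    rw [Real.norm_eq_abs]
    refine (abs_add_le _ _).trans ?_
    rw [abs_mul, abs_mul]
    have e4 := (abs_add_le (deriv (fun s => φ k (q.1, s)) q.2)
      (Laplacian.laplacian (fun y => φ k (y, q.2)) q.1)).trans (add_le_add e1 e2)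
    calc _ ≤ R * ((D' * (B * C) + D * (B * (d * C))) * p + D * (d * (4 * B * C)) * p)
          + R * (D * (B * C) * p) := by gcongr
      _ = p * M := by rw [hM]; ring
  have hFm : ∀ k, AEStronglyMeasurable (F k) := fun k =>
    ((H.measurable.mul ((continuous_deriv_snd (hφs k)).measurable.add
      (continuous_laplacian_fst (hφs k)).measurable)).add
      (H.measurable_source.mul (hφs k).continuous.measurable)).aestronglyMeasurable
  have hFG : ∀ q, Tendsto (fun k => F k q) atTop (𝓝 (G q)) := by
    intro q
    by_cases hq : q.2 ∈ tsupport η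
    swap
    · simp only [hFz _ q hq, hGz q hq]
      exact tendsto_const_nhds
    refine tendsto_const_nhds.congr' ?_
    -- For large k the cutoff equals 1 near q.1 − z, so the integrands do not merely converge but
    -- are eventually equal to the limit.
    filter_upwards [hχ1 (q.1 - z)] with k hk
    have e1 : Laplacian.laplacian (fun y => χ k y * heatKernel (S - q.2) y) (q.1 - z)
        = Laplacian.laplacian (heatKernel (S - q.2) : E → ℝ) (q.1 - z) := by
      refine (InnerProductSpace.laplacian_congr_nhds ?_).eq_of_nhds
      filter_upwards [hk] with y hy
      rw [hy, one_mul]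
    have e2 : χ k (q.1 - z) = 1 := hk.eq_of_nhds
    have e3 : φ k q = η q.2 * (1 * heatKernel (S - q.2) (q.1 - z)) := by rw [← e2]
    simp only [hF, hG]
    rw [hdt k q hq, hlap, e1, e2, e3]
    ring
  have hbi : Integrable bound := by
    by_cases hSpos : 0 < S
    · refine Integrable.mul_prod (f := fun x : E => heatKernel (2 * S) (x - z))
        ((integrable_heatKernel (by positivity)).comp_sub_right z) ?_
      exact (integrable_indicator_iff (isClosed_tsupport η).measurableSet).2
        (integrableOn_const hηc.isCompact.measure_lt_top.ne)
    · have : tsupport η = ∅ := by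
        rw [eq_empty_iff_forall_notMem]
        intro s hs
        exact hSpos ((hsupp hs).1.trans (hS s hs))
      have : bound = 0 := by
        ext q
        simp [hbound, this]
      rw [this]
      exact integrable_zero _ _ _
  have hGb : ∀ q, ‖G q‖ ≤ bound q := fun q =>
    le_of_tendsto' ((hFG q).norm) fun k => hFb k q
  have hGm : AEStronglyMeasurable G :=
    aestronglyMeasurable_of_tendsto_ae atTop hFm (ae_of_all _ hFG)
  refine ⟨hbi.mono' hGm (ae_of_all _ hGb), ?_⟩
  have hlim := tendsto_integral_of_dominated_convergence bound hFm hbi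
    (fun k => ae_of_all _ (hFb k)) (ae_of_all _ hFG)
  exact tendsto_nhds_unique hlim (tendsto_const_nhds.congr fun k => (heq k).symm)

end TestHeatKernel

/-! ### Duhamel's formula for weak solutions. -/

section Duhamel
open Filter Topology
set_option linter.unusedSectionVars false

variable {E : Type*} [NormedAddCommGroup E] [InnerProductSpace ℝ E] [FiniteDimensional ℝ E]
  [MeasurableSpace E] [BorelSpace E]

/-- These moments turn a translation modulus of order ‖y‖^β into a power τ^(β/2). -/
theorem lintegral_heatKernel_mul_rpow_le {τ β : ℝ} (hτ : 0 < τ) (hβ : 0 ≤ β) :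
    ∫⁻ y : E, ENNReal.ofReal (heatKernel τ y) * ENNReal.ofReal (‖y‖ ^ β)
      ≤ ENNReal.ofReal (((2 : ℝ) ^ (Module.finrank ℝ E / 2 : ℝ) * Real.exp (2 * β ^ 2))
        * τ ^ (β / 2)) := by
  calc ∫⁻ y : E, ENNReal.ofReal (heatKernel τ y) * ENNReal.ofReal (‖y‖ ^ β)
      ≤ ∫⁻ y : E, ENNReal.ofReal (((2 : ℝ) ^ (Module.finrank ℝ E / 2 : ℝ) * Real.exp (2 * β ^ 2))
        * τ ^ (β / 2)) * ENNReal.ofReal (heatKernel (2 * τ) y) := by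
        refine lintegral_mono fun y => ?_
        rw [← ENNReal.ofReal_mul (heatKernel_pos hτ y).le, ← ENNReal.ofReal_mul (by positivity),
          mul_comm (heatKernel τ y)]
        exact ENNReal.ofReal_le_ofReal (rpow_mul_heatKernel_le hτ hβ y)
    _ = _ := by
        rw [lintegral_const_mul _ (continuous_heatKernel _).measurable.ennreal_ofReal,
          lintegral_heatKernel (by positivity), mul_one]

/-- Since the kernel has mass 1, p_τ * g − g is the p_τ-average over y of g(· − y) − g; Tonelli does
the rest. -/
theorem lintegral_enorm_heatConv_sub_le {τ : ℝ} (hτ : 0 < τ) {g : E → ℝ} {R : ℝ}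
    (hg : Measurable g) (hR : ∀ x, |g x| ≤ R) :
    ∫⁻ z, ‖heatConv τ g z - g z‖ₑ
      ≤ ∫⁻ y, ENNReal.ofReal (heatKernel τ y) * ∫⁻ z, ‖g (z - y) - g z‖ₑ := by
  have h1 : ∀ z, ‖heatConv τ g z - g z‖ₑ
      ≤ ∫⁻ y, ENNReal.ofReal (heatKernel τ y) * ‖g (z - y) - g z‖ₑ := by
    intro z
    have e : heatConv τ g z - g z = ∫ y, heatKernel τ y * (g (z - y) - g z) := by
      have e1 : heatConv τ g z = ∫ y, heatKernel τ y * g (z - y) := by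
        rw [heatConv, ← integral_sub_left_eq_self _ volume z]
        simp
      have e2 : g z = ∫ y : E, heatKernel τ y * g z := by
        rw [integral_mul_const, integral_heatKernel hτ, one_mul]
      have hi : Integrable fun y : E => heatKernel τ y * g (z - y) :=
        (integrable_heatKernel hτ).mul_bdd (c := R)
          (hg.comp (measurable_const.sub measurable_id)).aestronglyMeasurable
          (ae_of_all _ fun y => hR _)
      conv_lhs => rw [e1, e2]
      rw [← integral_sub hi ((integrable_heatKernel hτ).mul_const _)]
      simp only [mul_sub]
    rw [e]
    refine (enorm_integral_le_lintegral_enorm _).trans (le_of_eq (lintegral_congr fun y => ?_))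
    rw [enorm_mul, Real.enorm_of_nonneg (heatKernel_pos hτ y).le]
  have hm : Measurable fun q : E × E =>
      ENNReal.ofReal (heatKernel τ q.2) * ‖g (q.1 - q.2) - g q.1‖ₑ :=
    ((continuous_heatKernel τ).measurable.comp measurable_snd).ennreal_ofReal.mul
      ((hg.comp (measurable_fst.sub measurable_snd)).sub (hg.comp measurable_fst)).enorm
  calc ∫⁻ z, ‖heatConv τ g z - g z‖ₑ
      ≤ ∫⁻ z, ∫⁻ y, ENNReal.ofReal (heatKernel τ y) * ‖g (z - y) - g z‖ₑ := lintegral_mono h1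
    _ = ∫⁻ y, ∫⁻ z, ENNReal.ofReal (heatKernel τ y) * ‖g (z - y) - g z‖ₑ :=
        lintegral_lintegral_swap hm.aemeasurable
    _ = _ := by
        refine lintegral_congr fun y => ?_
        rw [lintegral_const_mul]
        exact ((hg.comp (measurable_id.sub measurable_const)).sub hg).enorm

/-- A compactly supported Lipschitz function differs from its translate by O(‖y‖), and only on two
copies of its support, so the first moment of the kernel gives a bound of order √τ. -/
theorem tendsto_lintegral_enorm_heatConv_sub {ψ : E → ℝ} (hψ : ContDiff ℝ ∞ ψ)
    (hψc : HasCompactSupport ψ) :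
    Tendsto (fun τ => ∫⁻ z, ‖heatConv τ ψ z - ψ z‖ₑ) (𝓝[>] 0) (𝓝 0) := by
  obtain ⟨K, hK⟩ := ContDiff.lipschitzWith_of_hasCompactSupport hψc hψ (by simp)
  obtain ⟨D, hD⟩ := hψc.exists_bound_of_continuous hψ.continuous
  set V := volume (tsupport ψ) with hV
  have hVt : V ≠ ⊤ := hψc.isCompact.measure_lt_top.ne
  have hmod : ∀ y, ∫⁻ z, ‖ψ (z - y) - ψ z‖ₑ ≤ ENNReal.ofReal (‖y‖ ^ (1 : ℝ)) * (K * (V + V)) := by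
    intro y
    have hmt : MeasurableSet (tsupport ψ) := (isClosed_tsupport ψ).measurableSet
    calc ∫⁻ z, ‖ψ (z - y) - ψ z‖ₑ
        ≤ ∫⁻ z, ENNReal.ofReal (‖y‖ ^ (1 : ℝ)) * K *
          ((tsupport ψ).indicator (fun _ => 1) (z - y) + (tsupport ψ).indicator (fun _ => 1) z) := by
          refine lintegral_mono fun z => ?_
          have h1 : ‖ψ (z - y) - ψ z‖ₑ ≤ ENNReal.ofReal (‖y‖ ^ (1 : ℝ)) * K := by
            have := hK (z - y) z
            rw [edist_eq_enorm_sub, edist_eq_enorm_sub] at this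
            refine this.trans_eq ?_
            rw [sub_sub_cancel_left, enorm_neg, Real.rpow_one, ofReal_norm, mul_comm]
          by_cases hz : z ∈ tsupport ψ
          · refine h1.trans ?_
            simp only [indicator_of_mem hz]
            exact le_mul_of_one_le_right zero_le le_add_self
          by_cases hzy : z - y ∈ tsupport ψ
          · refine h1.trans ?_
            simp only [indicator_of_mem hzy]
            exact le_mul_of_one_le_right zero_le le_self_add
          · simp [image_eq_zero_of_notMem_tsupport hz, image_eq_zero_of_notMem_tsupport hzy]
      _ = _ := by
          have hmi : Measurable ((tsupport ψ).indicator (fun _ => (1 : ℝ≥0∞))) :=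
            measurable_const.indicator hmt
          have hmi' : Measurable fun z => (tsupport ψ).indicator (fun _ => (1 : ℝ≥0∞)) (z - y) :=
            hmi.comp (measurable_id.sub measurable_const)
          rw [lintegral_const_mul' _ _ (ENNReal.mul_ne_top ENNReal.ofReal_ne_top ENNReal.coe_ne_top),
            lintegral_add_right _ hmi,
            lintegral_sub_right_eq_self (fun z => (tsupport ψ).indicator (fun _ => (1 : ℝ≥0∞)) z) y,
            lintegral_indicator_const hmt, one_mul, mul_assoc]
  set c : ℝ := (2 : ℝ) ^ (Module.finrank ℝ E / 2 : ℝ) * Real.exp (2 * 1 ^ 2)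
  have hlim : Tendsto (fun τ : ℝ => ENNReal.ofReal (c * τ ^ (1 / 2 : ℝ)) * (K * (V + V))) (𝓝[>] 0)
      (𝓝 0) := by
    have h1 : Tendsto (fun τ : ℝ => c * τ ^ (1 / 2 : ℝ)) (𝓝 0) (𝓝 0) := by
      have := (Real.continuousAt_rpow_const 0 (1 / 2) (Or.inr (by norm_num))).tendsto.const_mul c
      simpa using this
    have h2 := ENNReal.Tendsto.mul_const (b := (K * (V + V) : ℝ≥0∞))
      (ENNReal.tendsto_ofReal (h1.mono_left (nhdsWithin_le_nhds (s := Ioi 0))))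
      (Or.inr (ENNReal.mul_ne_top ENNReal.coe_ne_top (by simp [hVt])))
    simpa using h2
  refine tendsto_of_tendsto_of_tendsto_of_le_of_le' tendsto_const_nhds hlim
    (Eventually.of_forall fun _ => zero_le) ?_
  filter_upwards [self_mem_nhdsWithin] with τ hτ
  have hτ' : 0 < τ := hτ
  calc ∫⁻ z, ‖heatConv τ ψ z - ψ z‖ₑ
      ≤ ∫⁻ y, ENNReal.ofReal (heatKernel τ y) * ∫⁻ z, ‖ψ (z - y) - ψ z‖ₑ :=
        lintegral_enorm_heatConv_sub_le hτ' hψ.continuous.measurable hD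
    _ ≤ ∫⁻ y, ENNReal.ofReal (heatKernel τ y) * ENNReal.ofReal (‖y‖ ^ (1 : ℝ)) * (K * (V + V)) := by
        refine lintegral_mono fun y => ?_
        rw [mul_assoc]
        exact mul_le_mul_right (hmod y) _
    _ = (∫⁻ y : E, ENNReal.ofReal (heatKernel τ y) * ENNReal.ofReal (‖y‖ ^ (1 : ℝ)))
        * (K * (V + V)) := by
        refine lintegral_mul_const _ ?_
        exact (continuous_heatKernel τ).measurable.ennreal_ofReal.mul
          (measurable_norm.pow_const _).ennreal_ofReal
    _ ≤ _ := mul_le_mul_left (lintegral_heatKernel_mul_rpow_le hτ' zero_le_one) _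

/-- The kernel is even, so Fubini moves the semigroup onto ψ, where it converges in L¹; boundedness
of g is then enough. -/
theorem tendsto_integral_heatConv_mul {g ψ : E → ℝ} {R : ℝ} (hg : AEStronglyMeasurable g)
    (hR : ∀ᵐ x, |g x| ≤ R) (hψ : ContDiff ℝ ∞ ψ) (hψc : HasCompactSupport ψ) :
    Tendsto (fun τ => ∫ z, ψ z * heatConv τ g z) (𝓝[>] 0) (𝓝 (∫ z, ψ z * g z)) := by
  have hψi : Integrable ψ := hψ.continuous.integrable_of_hasCompactSupport hψc
  obtain ⟨D, hD⟩ := hψc.exists_bound_of_continuous hψ.continuous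
  have hR0 : 0 ≤ R := by
    obtain ⟨x, hx⟩ := hR.exists
    exact (abs_nonneg _).trans hx
  rw [tendsto_iff_edist_tendsto_0]
  have hlim : Tendsto (fun τ => ENNReal.ofReal R * ∫⁻ z, ‖heatConv τ ψ z - ψ z‖ₑ) (𝓝[>] 0)
      (𝓝 0) := by
    have := ENNReal.Tendsto.const_mul (a := ENNReal.ofReal R)
      (tendsto_lintegral_enorm_heatConv_sub hψ hψc) (Or.inr ENNReal.ofReal_ne_top)
    simpa using this
  refine tendsto_of_tendsto_of_tendsto_of_le_of_le' tendsto_const_nhds hlim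
    (Eventually.of_forall fun _ => zero_le) ?_
  filter_upwards [self_mem_nhdsWithin] with τ hτ
  have hτ' : 0 < τ := hτ
  have hprod : Integrable (fun q : E × E => ψ q.1 * (heatKernel τ (q.1 - q.2) * g q.2))
      (volume.prod volume) := by
    have h1 : Integrable (fun q : E × E => ψ q.1 * heatKernel τ (q.1 - q.2))
        (volume.prod volume) := by
      rw [integrable_prod_iff]
      · refine ⟨ae_of_all _ fun z => (integrable_heatKernel_sub hτ' z).const_mul (ψ z), ?_⟩
        refine hψi.norm.congr (ae_of_all _ fun z => ?_)
        simp only [norm_mul]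
        rw [integral_const_mul]
        simp_rw [Real.norm_of_nonneg (heatKernel_pos hτ' _).le]
        rw [integral_heatKernel_sub hτ', mul_one]
      · exact ((hψ.continuous.comp continuous_fst).mul
          ((continuous_heatKernel τ).comp (continuous_fst.sub continuous_snd))).aestronglyMeasurable
    have h2 := h1.mul_bdd (c := R) (hg.comp_snd (μ := volume))
      (Measure.quasiMeasurePreserving_snd.ae hR)
    refine h2.congr (ae_of_all _ fun q => ?_)
    simp only [mul_assoc]
  have e1 : ∫ z, ψ z * heatConv τ g z = ∫ x, g x * heatConv τ ψ x := by
    have e2 : ∀ z, ψ z * heatConv τ g z = ∫ x, ψ z * (heatKernel τ (z - x) * g x) := fun z => by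
      rw [integral_const_mul, heatConv]
    simp only [e2]
    rw [integral_integral_swap hprod]
    refine integral_congr_ae (ae_of_all _ fun x => ?_)
    simp only [heatConv]
    rw [← integral_const_mul]
    refine integral_congr_ae (ae_of_all _ fun z => ?_)
    simp only
    rw [heatKernel_sub_comm]
    ring
  have hi2 : Integrable fun x => g x * heatConv τ ψ x := by
    have := hprod.integral_prod_right
    refine this.congr (ae_of_all _ fun x => ?_)
    simp only [heatConv]
    rw [← integral_const_mul]
    refine integral_congr_ae (ae_of_all _ fun z => ?_)
    simp only
    rw [heatKernel_sub_comm]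
    ring
  have hi3 : Integrable fun x => g x * ψ x := hψi.bdd_mul hg hR
  have e3 : ∫ z, ψ z * g z = ∫ x, g x * ψ x := by simp only [mul_comm]
  rw [e1, e3, edist_eq_enorm_sub, ← integral_sub hi2 hi3]
  refine (enorm_integral_le_lintegral_enorm _).trans ?_
  rw [← lintegral_const_mul' _ _ ENNReal.ofReal_ne_top]
  refine lintegral_mono_ae ?_
  filter_upwards [hR] with x hx
  rw [← mul_sub, enorm_mul]
  refine mul_le_mul_left ?_ _
  rw [← ofReal_norm]
  exact ENNReal.ofReal_le_ofReal hx

theorem heatConv_add_const_mul {τ : ℝ} (hτ : 0 < τ) {g₁ g₂ : E → ℝ} {R : ℝ}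
    (h₁ : Measurable g₁) (h₂ : Measurable g₂) (hR₁ : ∀ x, |g₁ x| ≤ R) (hR₂ : ∀ x, |g₂ x| ≤ R)
    (a : ℝ) (z : E) :
    heatConv τ (fun x => a * g₁ x + g₂ x) z = a * heatConv τ g₁ z + heatConv τ g₂ z := by
  have i₁ := integrable_heatKernel_mul hτ z h₁.aestronglyMeasurable (ae_of_all _ hR₁)
  have i₂ := integrable_heatKernel_mul hτ z h₂.aestronglyMeasurable (ae_of_all _ hR₂)
  rw [heatConv, heatConv, heatConv, ← integral_const_mul, ← integral_add (i₁.const_mul a) i₂]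
  refine integral_congr_ae (ae_of_all _ fun x => ?_)
  simp only
  ring

theorem heatConv_congr_ae {τ : ℝ} {g₁ g₂ : E → ℝ} (h : ∀ᵐ x, g₁ x = g₂ x) (z : E) :
    heatConv τ g₁ z = heatConv τ g₂ z := by
  refine integral_congr_ae ?_
  filter_upwards [h] with x hx
  rw [hx]

namespace IsWeakHeatSolution

variable {T R : ℝ} {v : E → ℝ → ℝ} {U h : E × ℝ → ℝ}

theorem measurable_duhamel_source (H : IsWeakHeatSolution T R v U h) (lam : ℝ) :
    Measurable fun q => lam * U q + h q :=
  (H.measurable.const_mul lam).add H.measurable_source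

theorem abs_duhamel_source_le (H : IsWeakHeatSolution T R v U h) (lam : ℝ) (q : E × ℝ) :
    |lam * U q + h q| ≤ |lam| * R + R := by
  refine (abs_add_le _ _).trans (add_le_add ?_ (H.bound_source q))
  rw [abs_mul]
  exact mul_le_mul_of_nonneg_left (H.bound q) (abs_nonneg _)

theorem integrableOn_exp_mul_heatConv (H : IsWeakHeatSolution T R v U h) (lam : ℝ) {S b : ℝ}
    (hb : b ≤ S) (z : E) : IntegrableOn
      (fun s => Real.exp (lam * s) * heatConv (S - s) (fun x => lam * U (x, s) + h (x, s)) z)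
      (Ioo 0 b) := by
  refine Integrable.mono' (g := fun _ => Real.exp (|lam| * b) * (|lam| * R + R))
    (integrableOn_const measure_Ioo_lt_top.ne) ?_ ?_
  · exact ((measurable_const.mul measurable_id).exp.mul
      (measurable_heatConv_time (H.measurable_duhamel_source lam) S z)).aestronglyMeasurable
  · filter_upwards [ae_restrict_mem measurableSet_Ioo] with s hs
    rw [norm_mul, Real.norm_of_nonneg (Real.exp_pos _).le]
    have h1 := abs_heatConv_le (sub_pos.2 (hs.2.trans_le hb)) z
      (ae_of_all _ fun x => H.abs_duhamel_source_le lam (x, s))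
    have h2 : lam * s ≤ |lam| * b :=
      (mul_le_mul_of_nonneg_right (le_abs_self _) hs.1.le).trans
        (mul_le_mul_of_nonneg_left hs.2.le (abs_nonneg _))
    exact mul_le_mul (Real.exp_le_exp.2 h2) h1 (abs_nonneg _) (Real.exp_pos _).le

/-- The function s ↦ e^(λs) (p_{S−s} * v(s))(z) is continuous, and testing with η e^(λs) times the
backward kernel identifies its weak derivative; the du Bois-Reymond lemma integrates it. Because t <
S, the singular time of the kernel is never reached. -/
theorem duhamel_heatConv (H : IsWeakHeatSolution T R v U h) (lam : ℝ) {S : ℝ} (z : E) {t : ℝ}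
    (ht : t ∈ Ico 0 (min S T)) :
    Real.exp (lam * t) * heatConv (S - t) (fun x => v x t) z - heatConv S (fun x => v x 0) z
      = ∫ s in Ioo 0 t, Real.exp (lam * s) *
          heatConv (S - s) (fun x => lam * U (x, s) + h (x, s)) z := by
  have hJ : ContinuousOn (fun s => Real.exp (lam * s) * heatConv (S - s) (fun x => v x s) z)
      (Ico 0 (min S T)) :=
    (by fun_prop : Continuous fun s : ℝ => Real.exp (lam * s)).continuousOn.mul
      (H.continuousOn_heatConv S z)
  have key := sub_eq_integral_of_weak_deriv hJ
    (H.integrableOn_exp_mul_heatConv lam (min_le_left S T) z) ?_ ht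
  · simpa using key
  intro η hη hηc hsupp
  have hexp : ContDiff ℝ ∞ fun s : ℝ => Real.exp (lam * s) :=
    (contDiff_const.mul contDiff_id).exp
  have hts : tsupport (fun s => η s * Real.exp (lam * s)) ⊆ tsupport η :=
    tsupport_mul_subset_left
  obtain ⟨hi, h0⟩ := H.equation_mul_heatKernel z (hη.mul hexp) hηc.mul_right (hts.trans hsupp)
  have hd : ∀ s, deriv (fun s => η s * Real.exp (lam * s)) s
      = Real.exp (lam * s) * (deriv η s + lam * η s) := by
    intro s
    have h1 := ((hη.differentiable (by simp)).differentiableAt (x := s)).hasDerivAt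
    have h2 := ((hasDerivAt_id s).const_mul lam).exp
    refine (h1.mul h2).deriv.trans ?_
    simp
    ring
  rw [Measure.volume_eq_prod] at hi h0
  rw [integral_prod_symm _ hi] at h0
  refine Eq.trans (Eq.trans ?_
    (setIntegral_eq_integral_of_forall_compl_eq_zero (s := Ioo 0 (min S T)) ?_)) h0
  · refine setIntegral_congr_ae measurableSet_Ioo ?_
    have hae := (ae_restrict_iff' measurableSet_Ioo).1 H.ae_eq
    filter_upwards [hae] with s hs hsI
    have hpos : 0 < S - s := sub_pos.2 (hsI.2.trans_le (min_le_left _ _))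
    have hm : Measurable fun x => U (x, s) := H.measurable.comp (by fun_prop)
    have hm' : Measurable fun x => h (x, s) := H.measurable_source.comp (by fun_prop)
    rw [heatConv_congr_ae (hs ⟨hsI.1, hsI.2.trans_le (min_le_right _ _)⟩) z,
      heatConv_add_const_mul hpos hm hm' (fun x => H.bound _) (fun x => H.bound_source _)]
    have e : ∀ x, (U (x, s) * deriv (fun s => η s * Real.exp (lam * s)) s
          + h (x, s) * (η s * Real.exp (lam * s))) * heatKernel (S - s) (x - z)
        = Real.exp (lam * s) * (deriv η s + lam * η s) * (heatKernel (S - s) (z - x) * U (x, s))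
          + η s * Real.exp (lam * s) * (heatKernel (S - s) (z - x) * h (x, s)) := by
      intro x
      rw [hd, heatKernel_sub_comm]
      ring
    simp only [e]
    rw [integral_add ((integrable_heatKernel_mul hpos z hm.aestronglyMeasurable
        (ae_of_all _ fun x => H.bound _)).const_mul _)
      ((integrable_heatKernel_mul hpos z hm'.aestronglyMeasurable
        (ae_of_all _ fun x => H.bound_source _)).const_mul _), integral_const_mul,
      integral_const_mul]
    change _ = _ * heatConv (S - s) (fun x => U (x, s)) z + _ * heatConv (S - s)
      (fun x => h (x, s)) z
    ring
  · intro s hs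
    have h1 : s ∉ tsupport η := fun hh => hs (hsupp hh)
    have h2 : η s = 0 := image_eq_zero_of_notMem_tsupport h1
    have h3 : deriv η s = 0 :=
      image_eq_zero_of_notMem_tsupport fun hh => h1 (tsupport_deriv_subset hh)
    simp only [hd, h2, h3]
    simp

/-- **Duhamel's formula** for bounded weak solutions of the heat equation, with an exponential
weight in time. -/
theorem duhamel (H : IsWeakHeatSolution T R v U h) (lam : ℝ) {t : ℝ} (ht : t ∈ Ioo 0 T) :
    ∀ᵐ z, Real.exp (lam * t) * v z t = heatConv t (fun x => v x 0) z
      + ∫ s in Ioo 0 t, Real.exp (lam * s) *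
          heatConv (t - s) (fun x => lam * U (x, s) + h (x, s)) z := by
  have hR := H.bound_nonneg
  -- At S = t + σ with σ > 0 the formula is already known for every z. As σ ↓ 0 the right-hand side
  -- converges boundedly pointwise, while p_σ * v(t) → v(t) is available only against test
  -- functions; this is why the conclusion holds almost everywhere.
  set Q : ℝ → E → ℝ := fun S z => heatConv S (fun x => v x 0) z + ∫ s in Ioo 0 t,
    Real.exp (lam * s) * heatConv (S - s) (fun x => lam * U (x, s) + h (x, s)) z with hQ
  set M : ℝ := |lam| * R + R with hM
  have hM0 : 0 ≤ M := by positivity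
  have h0T : (0 : ℝ) ∈ Ico 0 T := ⟨le_rfl, ht.1.trans ht.2⟩
  have hv0 := H.ae_abs_le h0T
  have hv0m := H.aestronglyMeasurable (le_refl (0 : ℝ))
  have hvt := H.ae_abs_le (Ioo_subset_Ico_self ht)
  have hvtm := H.aestronglyMeasurable ht.1.le
  set B : ℝ := R + ∫ s in Ioo 0 t, Real.exp (|lam| * t) * M with hB
  have hib : IntegrableOn (fun _ : ℝ => Real.exp (|lam| * t) * M) (Ioo 0 t) :=
    integrableOn_const measure_Ioo_lt_top.ne
  have hpt : ∀ S, t ≤ S → ∀ z, ∀ s ∈ Ioo 0 t, ‖Real.exp (lam * s) *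
      heatConv (S - s) (fun x => lam * U (x, s) + h (x, s)) z‖ ≤ Real.exp (|lam| * t) * M := by
    intro S hS z s hs
    rw [norm_mul, Real.norm_of_nonneg (Real.exp_pos _).le]
    have h1 := abs_heatConv_le (sub_pos.2 (hs.2.trans_le hS)) z
      (ae_of_all _ fun x => H.abs_duhamel_source_le lam (x, s))
    have h2 : lam * s ≤ |lam| * t :=
      (mul_le_mul_of_nonneg_right (le_abs_self _) hs.1.le).trans
        (mul_le_mul_of_nonneg_left hs.2.le (abs_nonneg _))
    exact mul_le_mul (Real.exp_le_exp.2 h2) h1 (abs_nonneg _) (Real.exp_pos _).le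
  have hQb : ∀ S, t ≤ S → ∀ z, |Q S z| ≤ B := by
    intro S hS z
    refine (abs_add_le _ _).trans (add_le_add (abs_heatConv_le (ht.1.trans_le hS) z hv0) ?_)
    change ‖(_ : ℝ)‖ ≤ _
    refine norm_integral_le_of_norm_le hib ?_
    filter_upwards [ae_restrict_mem measurableSet_Ioo] with s hs
    exact hpt S hS z s hs
  have hQm : ∀ S, AEStronglyMeasurable (Q S) := by
    intro S
    obtain ⟨g, hg, hge⟩ := hv0m
    have e : heatConv S (fun x => v x 0) = heatConv S g := by
      ext z
      exact heatConv_congr_ae hge z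
    have h1 : Measurable (heatConv S (fun x => v x 0)) := by
      rw [e]
      exact measurable_heatConv hg.measurable S
    refine (h1.add ?_).aestronglyMeasurable
    refine (StronglyMeasurable.integral_prod_right (ν := volume.restrict (Ioo 0 t))
      (f := fun q : E => fun s : ℝ => Real.exp (lam * s) *
        heatConv (S - s) (fun x => lam * U (x, s) + h (x, s)) q) ?_).measurable
    refine Measurable.stronglyMeasurable ?_
    exact (measurable_const.mul measurable_snd).exp.mul
      (measurable_heatConv_uncurry (H.measurable_duhamel_source lam) S)
  have hQlim : ∀ z, Tendsto (fun σ => Q (t + σ) z) (𝓝[>] 0) (𝓝 (Q t z)) := by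
    intro z
    have hadd : ∀ s : ℝ, Tendsto (fun σ : ℝ => t + σ - s) (𝓝[>] 0) (𝓝 (t - s)) := fun s => by
      have : Tendsto (fun σ : ℝ => t + σ - s) (𝓝 0) (𝓝 (t + 0 - s)) :=
        ((continuous_const.add continuous_id).sub continuous_const).tendsto 0
      rw [add_zero] at this
      exact this.mono_left nhdsWithin_le_nhds
    refine Tendsto.add ?_ ?_
    · have := (tendsto_heatConv_time ht.1 z hv0m hv0).comp (by simpa using hadd 0)
      exact this
    · refine tendsto_integral_filter_of_dominated_convergence
        (fun _ => Real.exp (|lam| * t) * M) ?_ ?_ hib ?_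
      · filter_upwards [self_mem_nhdsWithin] with σ hσ
        exact (H.integrableOn_exp_mul_heatConv lam
          (le_add_of_nonneg_right (le_of_lt hσ)) z).aestronglyMeasurable
      · filter_upwards [self_mem_nhdsWithin] with σ hσ
        filter_upwards [ae_restrict_mem measurableSet_Ioo] with s hs
        exact hpt _ (le_add_of_nonneg_right (le_of_lt hσ)) z s hs
      · filter_upwards [ae_restrict_mem measurableSet_Ioo] with s hs
        have hm : Measurable fun x => lam * U (x, s) + h (x, s) :=
          (H.measurable_duhamel_source lam).comp (by fun_prop : Measurable fun x : E => (x, s))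
        exact ((tendsto_heatConv_time (sub_pos.2 hs.2) z hm.aestronglyMeasurable
          (ae_of_all _ fun x => H.abs_duhamel_source_le lam (x, s))).comp (hadd s)).const_mul _
  have hid : ∀ σ, 0 < σ → ∀ z, Real.exp (lam * t) * heatConv σ (fun x => v x t) z
      = Q (t + σ) z := by
    intro σ hσ z
    have := H.duhamel_heatConv lam (S := t + σ) z (t := t)
      ⟨ht.1.le, lt_min (by linarith) ht.2⟩
    rw [add_sub_cancel_left] at this
    simp only [hQ]
    linarith
  have hQloc : ∀ S, t ≤ S → LocallyIntegrable (Q S) := fun S hS =>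
    (locallyIntegrable_const B).mono (hQm S) (ae_of_all _ fun z => (hQb S hS z).trans (le_abs_self _))
  refine ae_eq_of_integral_contDiff_smul_eq ((H.locallyIntegrable t ht.1.le).smul (Real.exp (lam * t)))
    (hQloc t le_rfl) fun ψ hψ hψc => ?_
  have hψi : Integrable ψ := hψ.continuous.integrable_of_hasCompactSupport hψc
  simp only [smul_eq_mul]
  have l1 := (tendsto_integral_heatConv_mul hvtm hvt hψ hψc).const_mul (Real.exp (lam * t))
  have l2 : Tendsto (fun σ => ∫ z, ψ z * Q (t + σ) z) (𝓝[>] 0) (𝓝 (∫ z, ψ z * Q t z)) := by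
    refine tendsto_integral_filter_of_dominated_convergence (fun z => |ψ z| * B) ?_ ?_
      (hψi.abs.mul_const B) (ae_of_all _ fun z => (hQlim z).const_mul _)
    · exact Eventually.of_forall fun σ => hψ.continuous.aestronglyMeasurable.mul (hQm _)
    · filter_upwards [self_mem_nhdsWithin] with σ hσ
      refine ae_of_all _ fun z => ?_
      rw [norm_mul]
      exact mul_le_mul_of_nonneg_left (hQb _ (le_add_of_nonneg_right (le_of_lt hσ)) z)
        (abs_nonneg _)
  have e1 : ∫ z, ψ z * (Real.exp (lam * t) * v z t) = Real.exp (lam * t) * ∫ z, ψ z * v z t := by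
    rw [← integral_const_mul]
    simp only [mul_left_comm]
  rw [e1]
  refine tendsto_nhds_unique l1 (l2.congr' ?_)
  filter_upwards [self_mem_nhdsWithin] with σ hσ
  rw [← integral_const_mul]
  refine integral_congr_ae (ae_of_all _ fun z => ?_)
  simp only
  rw [← hid σ hσ z]
  ring

end IsWeakHeatSolution

end Duhamel

/-! ### Grönwall inequalities, in time and in L¹ for heat potentials. -/

section Gronwall
open Filter Topology

theorem lintegral_Ioo_ofReal_exp {A L t : ℝ} (hA : 0 ≤ A) (hL : 0 < L) (ht : 0 ≤ t) :
    ∫⁻ s in Ioo 0 t, ENNReal.ofReal (A * Real.exp (L * s))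
      = ENNReal.ofReal (A * (Real.exp (L * t) - 1) / L) := by
  have hc : Continuous fun s : ℝ => A * Real.exp (L * s) := by fun_prop
  rw [← ofReal_integral_eq_lintegral_ofReal]
  · congr 1
    rw [← integral_Ioc_eq_integral_Ioo, ← intervalIntegral.integral_of_le ht,
      intervalIntegral.integral_const_mul, intervalIntegral.integral_comp_mul_left _ hL.ne']
    simp
    field_simp
  · exact (hc.integrableOn_Icc (a := 0) (b := t)).mono_set Ioo_subset_Icc_self
  · exact ae_of_all _ fun s => by positivity

/-- An integral Grönwall inequality for bounded functions, holding almost everywhere. -/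
theorem ae_le_exp_of_ae_le_add_lintegral {B : ℝ → ℝ≥0∞} {N D L t₁ : ℝ} (hN : 0 ≤ N) (hD : 0 ≤ D)
    (hL : 0 < L) (hB : ∀ᵐ t ∂volume.restrict (Ioo 0 t₁), B t ≤ ENNReal.ofReal N)
    (h : ∀ᵐ t ∂volume.restrict (Ioo 0 t₁),
      B t ≤ ENNReal.ofReal D + ENNReal.ofReal L * ∫⁻ s in Ioo 0 t, B s) :
    ∀ᵐ t ∂volume.restrict (Ioo 0 t₁), B t ≤ ENNReal.ofReal (2 * D * Real.exp (2 * L * t)) := by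
  -- Inserting the bound with exponential rate 2L, twice the rate L of the inequality, halves its
  -- constant on integration: 2D + N/2^k becomes D + N/2^(k+1), and the free term restores D.
  -- Iteration needs no continuity of B.
  have key : ∀ k : ℕ, ∀ᵐ t ∂volume.restrict (Ioo 0 t₁),
      B t ≤ ENNReal.ofReal ((2 * D + N / 2 ^ k) * Real.exp (2 * L * t)) := by
    intro k
    induction k with
    | zero =>
      filter_upwards [hB, ae_restrict_mem measurableSet_Ioo] with t ht htI
      refine ht.trans (ENNReal.ofReal_le_ofReal ?_)
      have : 1 ≤ Real.exp (2 * L * t) := Real.one_le_exp (by have := htI.1; positivity)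
      rw [pow_zero, div_one]
      nlinarith
    | succ k ih =>
      filter_upwards [h, ae_restrict_mem measurableSet_Ioo] with t ht htI
      refine ht.trans ?_
      have h1 : ∫⁻ s in Ioo 0 t, B s
          ≤ ∫⁻ s in Ioo 0 t, ENNReal.ofReal ((2 * D + N / 2 ^ k) * Real.exp (2 * L * s)) :=
        lintegral_mono_ae (ae_restrict_of_ae_restrict_of_subset
          (Ioo_subset_Ioo le_rfl htI.2.le) ih)
      rw [lintegral_Ioo_ofReal_exp (by positivity) (by positivity) htI.1.le] at h1
      have he : 1 ≤ Real.exp (2 * L * t) := Real.one_le_exp (by have := htI.1; positivity)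
      calc _ ≤ ENNReal.ofReal D + ENNReal.ofReal L * ENNReal.ofReal
            ((2 * D + N / 2 ^ k) * (Real.exp (2 * L * t) - 1) / (2 * L)) := by gcongr
        _ = ENNReal.ofReal (D + L *
            ((2 * D + N / 2 ^ k) * (Real.exp (2 * L * t) - 1) / (2 * L))) := by
            have : 0 ≤ (2 * D + N / 2 ^ k) * (Real.exp (2 * L * t) - 1) / (2 * L) :=
              div_nonneg (mul_nonneg (by positivity) (by linarith)) (by positivity)
            rw [← ENNReal.ofReal_mul hL.le, ← ENNReal.ofReal_add hD (by positivity)]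
        _ ≤ _ := by
            refine ENNReal.ofReal_le_ofReal ?_
            have e : L * ((2 * D + N / 2 ^ k) * (Real.exp (2 * L * t) - 1) / (2 * L))
                = (D + N / 2 ^ (k + 1)) * (Real.exp (2 * L * t) - 1) := by
              field_simp
              ring
            rw [e]
            have : 0 ≤ N / 2 ^ (k + 1) := by positivity
            nlinarith
  filter_upwards [ae_all_iff.2 key] with t ht
  have hlim : Tendsto (fun k : ℕ => ENNReal.ofReal ((2 * D + N / 2 ^ k) * Real.exp (2 * L * t)))
      atTop (𝓝 (ENNReal.ofReal ((2 * D + 0) * Real.exp (2 * L * t)))) := by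
    refine ENNReal.tendsto_ofReal ((tendsto_const_nhds.add ?_).mul_const _)
    have := (tendsto_pow_atTop_nhds_zero_of_lt_one (r := (1 / 2 : ℝ)) (by norm_num)
      (by norm_num)).const_mul N
    simpa [div_eq_mul_inv] using this
  rw [add_zero] at hlim
  exact ge_of_tendsto' hlim ht

variable {E : Type*} [NormedAddCommGroup E] [InnerProductSpace ℝ E] [FiniteDimensional ℝ E]
  [MeasurableSpace E] [BorelSpace E]

theorem lintegral_exp_neg_mul_norm_lt_top {η : ℝ} (hη : 0 < η) (hη1 : η ≤ 1) :
    ∫⁻ x : E, ENNReal.ofReal (Real.exp (-(η * ‖x‖))) < ⊤ := by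
  set d := Module.finrank ℝ E
  -- Chosen so that the (d+1)-st power of exp(m‖x‖) is exp(η‖x‖); the exponential then decays at
  -- least like the integrable function (1 + ‖x‖)^(−(d+1)).
  set m : ℝ := η / (d + 1) with hm
  have hm0 : 0 < m := by positivity
  have hm1 : m ≤ 1 := by
    rw [hm, div_le_one (by positivity)]
    have : (0 : ℝ) ≤ d := Nat.cast_nonneg _
    linarith
  have hi : Integrable fun x : E => m⁻¹ ^ (d + 1) * (1 + ‖x‖) ^ (-(d + 1 : ℝ)) :=
    (integrable_one_add_norm (by simp [d])).const_mul _
  refine lt_of_le_of_lt (lintegral_mono fun x => ENNReal.ofReal_le_ofReal ?_) hi.lintegral_lt_top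
  have h1 : 1 + ‖x‖ ≤ m⁻¹ * Real.exp (m * ‖x‖) := by
    rw [le_inv_mul_iff₀ hm0]
    have := Real.add_one_le_exp (m * ‖x‖)
    nlinarith
  have h2 : (1 + ‖x‖) ^ (d + 1) ≤ m⁻¹ ^ (d + 1) * Real.exp (η * ‖x‖) := by
    calc (1 + ‖x‖) ^ (d + 1) ≤ (m⁻¹ * Real.exp (m * ‖x‖)) ^ (d + 1) := by gcongr
      _ = _ := by
        rw [mul_pow, ← Real.exp_nat_mul]
        congr 2
        rw [hm]
        push_cast
        field_simp
  have e : (1 + ‖x‖) ^ (-(d + 1 : ℝ)) = ((1 + ‖x‖) ^ (d + 1))⁻¹ := by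
    rw [Real.rpow_neg (by positivity)]
    congr 1
    exact_mod_cast Real.rpow_natCast (1 + ‖x‖) (d + 1)
  rw [e, Real.exp_neg, ← div_eq_mul_inv, le_div_iff₀ (by positivity), inv_mul_le_iff₀ (Real.exp_pos _)]
  linarith

/-- By the triangle inequality the weight at z is at most the weight at x times exp(η‖z − x‖), which
the Gaussian absorbs. The constant is the same for all η ≤ 1, so the weight can be sent to 1
afterwards. -/
theorem lintegral_exp_mul_heatKernel_le {η τ : ℝ} (hη : 0 ≤ η) (hη1 : η ≤ 1) (hτ : 0 < τ)
    (hτ1 : τ ≤ 1) (x : E) :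
    ∫⁻ z, ENNReal.ofReal (Real.exp (-(η * ‖z‖))) * ENNReal.ofReal (heatKernel τ (z - x))
      ≤ ENNReal.ofReal ((2 : ℝ) ^ (Module.finrank ℝ E / 2 : ℝ) * Real.exp 2)
        * ENNReal.ofReal (Real.exp (-(η * ‖x‖))) := by
  set c : ℝ := (2 : ℝ) ^ (Module.finrank ℝ E / 2 : ℝ) * Real.exp 2 with hc
  have hc0 : 0 ≤ c := by positivity
  calc _ ≤ ∫⁻ z, ENNReal.ofReal (c * Real.exp (-(η * ‖x‖)))
          * ENNReal.ofReal (heatKernel (2 * τ) (z - x)) := by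
        refine lintegral_mono fun z => ?_
        rw [← ENNReal.ofReal_mul (Real.exp_pos _).le, ← ENNReal.ofReal_mul (by positivity)]
        refine ENNReal.ofReal_le_ofReal ?_
        have h1 := exp_mul_heatKernel_le hτ η (z - x)
        have hk := heatKernel_pos (show 0 < 2 * τ by positivity) (z - x)
        have hk' := heatKernel_pos hτ (z - x)
        have h2 : Real.exp (-(η * ‖z‖)) ≤ Real.exp (-(η * ‖x‖)) * Real.exp (η * ‖z - x‖) := by
          rw [← Real.exp_add]
          refine Real.exp_le_exp.2 ?_
          have := norm_sub_norm_le x z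
          rw [norm_sub_rev] at this
          nlinarith
        have h3 : Real.exp (2 * η ^ 2 * τ) ≤ Real.exp 2 := by
          refine Real.exp_le_exp.2 ?_
          have : η ^ 2 ≤ 1 := pow_le_one₀ hη hη1
          nlinarith [sq_nonneg η]
        calc Real.exp (-(η * ‖z‖)) * heatKernel τ (z - x)
            ≤ Real.exp (-(η * ‖x‖)) * Real.exp (η * ‖z - x‖) * heatKernel τ (z - x) := by gcongr
          _ = Real.exp (-(η * ‖x‖)) * (Real.exp (η * ‖z - x‖) * heatKernel τ (z - x)) := by ring
          _ ≤ Real.exp (-(η * ‖x‖)) * ((2 : ℝ) ^ (Module.finrank ℝ E / 2 : ℝ)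
              * Real.exp (2 * η ^ 2 * τ) * heatKernel (2 * τ) (z - x)) := by gcongr
          _ ≤ Real.exp (-(η * ‖x‖)) * ((2 : ℝ) ^ (Module.finrank ℝ E / 2 : ℝ)
              * Real.exp 2 * heatKernel (2 * τ) (z - x)) := by gcongr
          _ = _ := by rw [hc]; ring
    _ = _ := by
        rw [lintegral_const_mul' _ _ ENNReal.ofReal_ne_top,
          lintegral_sub_right_eq_self (fun z => ENNReal.ofReal (heatKernel (2 * τ) z)) x,
          lintegral_heatKernel (by positivity), mul_one, ENNReal.ofReal_mul hc0]

/-- A Schur test: Tonelli lets the z-integral be taken first, where the hypothesis on ρ applies. -/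
theorem lintegral_mul_lintegral_le {ρ k b : E → ℝ≥0∞} {c : ℝ≥0∞} (hρ : Measurable ρ)
    (hk : Measurable k) (hb : Measurable b) (h : ∀ x, ∫⁻ z, ρ z * k (z - x) ≤ c * ρ x) :
    ∫⁻ z, ρ z * ∫⁻ x, k (z - x) * b x ≤ c * ∫⁻ x, ρ x * b x := by
  have hkb : Measurable fun q : E × E => k (q.1 - q.2) * b q.2 :=
    (hk.comp (measurable_fst.sub measurable_snd)).mul (hb.comp measurable_snd)
  have hm : Measurable fun q : E × E => ρ q.1 * (k (q.1 - q.2) * b q.2) :=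
    (hρ.comp measurable_fst).mul hkb
  have e1 : ∀ z, ρ z * ∫⁻ x, k (z - x) * b x = ∫⁻ x, ρ z * (k (z - x) * b x) := fun z => by
    have h1 : Measurable fun x => k (z - x) * b x := hkb.comp measurable_prodMk_left
    rw [lintegral_const_mul _ h1]
  have e2 : ∀ x, ∫⁻ z, ρ z * (k (z - x) * b x) ≤ c * (ρ x * b x) := fun x => by
    have h1 : Measurable fun z => ρ z * k (z - x) :=
      hρ.mul (hk.comp (measurable_id.sub measurable_const))
    simp only [← mul_assoc]
    rw [lintegral_mul_const _ h1]
    exact mul_le_mul_left (h x) _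
  simp only [e1]
  rw [lintegral_lintegral_swap hm.aemeasurable]
  refine (lintegral_mono e2).trans (le_of_eq ?_)
  have h2 : Measurable fun x => ρ x * b x := hρ.mul hb
  rw [lintegral_const_mul _ h2]

theorem measurable_potential {k b : E × ℝ → ℝ≥0∞} (hk : Measurable k) (hb : Measurable b) (t : ℝ) :
    Measurable fun q : E × ℝ => ∫⁻ x, k (q.1 - x, t - q.2) * b (x, q.2) := by
  have h : Measurable fun q : (E × ℝ) × E => k (q.1.1 - q.2, t - q.1.2) * b (q.2, q.1.2) :=
    (hk.comp (by fun_prop)).mul (hb.comp (by fun_prop))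
  exact h.lintegral_prod_right'

theorem lintegral_mul_potential_le {ρ : E → ℝ≥0∞} {k b : E × ℝ → ℝ≥0∞} {c : ℝ → ℝ≥0∞} {t : ℝ}
    (hρ : Measurable ρ) (hk : Measurable k) (hb : Measurable b)
    (h : ∀ τ ∈ Ioo 0 t, ∀ x, ∫⁻ z, ρ z * k (z - x, τ) ≤ c τ * ρ x) :
    ∫⁻ z, ρ z * ∫⁻ s in Ioo 0 t, ∫⁻ x, k (z - x, t - s) * b (x, s)
      ≤ ∫⁻ s in Ioo 0 t, c (t - s) * ∫⁻ x, ρ x * b (x, s) := by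
  have hm := measurable_potential hk hb t
  have e1 : ∀ z, ρ z * ∫⁻ s in Ioo 0 t, ∫⁻ x, k (z - x, t - s) * b (x, s)
      = ∫⁻ s in Ioo 0 t, ρ z * ∫⁻ x, k (z - x, t - s) * b (x, s) := fun z => by
    have h1 : Measurable fun s => ∫⁻ x, k (z - x, t - s) * b (x, s) := hm.comp measurable_prodMk_left
    rw [lintegral_const_mul _ h1]
  have hm2 : Measurable fun q : E × ℝ => ρ q.1 * ∫⁻ x, k (q.1 - x, t - q.2) * b (x, q.2) :=
    (hρ.comp measurable_fst).mul hm
  simp only [e1]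
  rw [lintegral_lintegral_swap hm2.aemeasurable]
  refine lintegral_mono_ae ?_
  filter_upwards [ae_restrict_mem measurableSet_Ioo] with s hs
  have h1 : Measurable fun y => k (y, t - s) := hk.comp measurable_prodMk_right
  have h2 : Measurable fun y => b (y, s) := hb.comp measurable_prodMk_right
  exact lintegral_mul_lintegral_le hρ h1 h2
    (h (t - s) ⟨sub_pos.2 hs.2, by linarith [hs.1]⟩)

/-- An `L¹` Grönwall inequality for functions dominated by their own heat potentials. -/
theorem ae_lintegral_le_of_le_add_heatPotential {b : E × ℝ → ℝ≥0∞} {g : ℝ → E → ℝ≥0∞}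
    {N D K t₁ : ℝ} (hb : Measurable b) (hN : 0 ≤ N) (hbN : ∀ q, b q ≤ ENNReal.ofReal N)
    (hD : 0 ≤ D) (hK : 0 < K) (ht₁ : t₁ ≤ 1)
    (hg : ∀ t ∈ Ioo 0 t₁, ∫⁻ z, g t z ≤ ENNReal.ofReal D)
    (h : ∀ᵐ t ∂volume.restrict (Ioo 0 t₁), ∀ᵐ z, b (z, t) ≤ g t z + ENNReal.ofReal K *
      ∫⁻ s in Ioo 0 t, ∫⁻ x, ENNReal.ofReal (heatKernel (t - s) (z - x)) * b (x, s)) :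
    ∀ᵐ t ∂volume.restrict (Ioo 0 t₁), ∫⁻ z, b (z, t) ≤ ENNReal.ofReal (2 * D * Real.exp
      (2 * (K * ((2 : ℝ) ^ (Module.finrank ℝ E / 2 : ℝ) * Real.exp 2)) * t)) := by
  set c : ℝ := (2 : ℝ) ^ (Module.finrank ℝ E / 2 : ℝ) * Real.exp 2 with hc
  have hc0 : 0 < c := by positivity
  -- The L¹ norm of b might a priori be infinite, and the Grönwall iteration needs a finite starting
  -- bound. Integrable weights increasing to 1 supply it, and Fatou's lemma removes them at the end.
  set ρ : ℕ → E → ℝ≥0∞ := fun k x => ENNReal.ofReal (Real.exp (-(1 / (k + 1 : ℝ) * ‖x‖))) with hρ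
  have hη : ∀ k : ℕ, 0 < 1 / (k + 1 : ℝ) ∧ 1 / (k + 1 : ℝ) ≤ 1 := fun k =>
    ⟨by positivity, by rw [div_le_one (by positivity)]; linarith [(Nat.cast_nonneg k : (0 : ℝ) ≤ k)]⟩
  have hρm : ∀ k, Measurable (ρ k) := fun k => by
    simp only [hρ]
    exact (by fun_prop : Continuous fun x : E =>
      Real.exp (-(1 / (k + 1 : ℝ) * ‖x‖))).measurable.ennreal_ofReal
  have hρ1 : ∀ k x, ρ k x ≤ 1 := fun k x => by
    simp only [hρ]
    rw [ENNReal.ofReal_le_one]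
    refine Real.exp_le_one_iff.2 (neg_nonpos.2 (mul_nonneg (hη k).1.le (norm_nonneg _)))
  have hstep : ∀ k, ∀ᵐ t ∂volume.restrict (Ioo 0 t₁),
      ∫⁻ z, ρ k z * b (z, t) ≤ ENNReal.ofReal (2 * D * Real.exp (2 * (K * c) * t)) := by
    intro k
    have hfin := lintegral_exp_neg_mul_norm_lt_top (E := E) (hη k).1 (hη k).2
    refine ae_le_exp_of_ae_le_add_lintegral (B := fun t => ∫⁻ z, ρ k z * b (z, t))
      (N := (∫⁻ z, ρ k z).toReal * N) (by positivity) hD (by positivity) ?_ ?_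
    · refine ae_of_all _ fun t => ?_
      calc ∫⁻ z, ρ k z * b (z, t) ≤ ∫⁻ z, ρ k z * ENNReal.ofReal N :=
            lintegral_mono fun z => by gcongr; exact hbN _
        _ = _ := by
            rw [lintegral_mul_const _ (hρm k), ENNReal.ofReal_mul ENNReal.toReal_nonneg,
              ENNReal.ofReal_toReal hfin.ne]
    · filter_upwards [h, ae_restrict_mem measurableSet_Ioo] with t ht htI
      have hk : Measurable fun q : E × ℝ => ENNReal.ofReal (heatKernel q.2 q.1) :=
        measurable_heatKernel_uncurry.ennreal_ofReal
      have hF2 : Measurable fun z : E => ∫⁻ s in Ioo 0 t,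
          ∫⁻ x, ENNReal.ofReal (heatKernel (t - s) (z - x)) * b (x, s) :=
        (measurable_potential hk hb t).lintegral_prod_right'
      have hgb : ∫⁻ z, ρ k z * g t z ≤ ENNReal.ofReal D :=
        (lintegral_mono fun z => mul_le_of_le_one_left zero_le (hρ1 k z)).trans (hg t htI)
      have hpot := lintegral_mul_potential_le (t := t) (c := fun _ => ENNReal.ofReal c) (hρm k) hk hb
        fun τ hτ x => lintegral_exp_mul_heatKernel_le (hη k).1.le (hη k).2 hτ.1
          (by linarith [hτ.2, htI.2]) x
      have hbm : Measurable fun s => ∫⁻ x, ρ k x * b (x, s) :=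
        Measurable.lintegral_prod_right' (f := fun q : ℝ × E => ρ k q.2 * b (q.2, q.1))
          (((hρm k).comp measurable_snd).mul (hb.comp measurable_swap))
      rw [lintegral_const_mul _ hbm] at hpot
      set P : E → ℝ≥0∞ := fun z => ∫⁻ s in Ioo 0 t,
          ∫⁻ x, ENNReal.ofReal (heatKernel (t - s) (z - x)) * b (x, s) with hP
      have hρP : Measurable fun z => ρ k z * P z := (hρm k).mul hF2
      calc ∫⁻ z, ρ k z * b (z, t)
          ≤ ∫⁻ z, (ρ k z * g t z + ENNReal.ofReal K * (ρ k z * P z)) := by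
            refine lintegral_mono_ae ?_
            filter_upwards [ht] with z hz
            refine (mul_le_mul_right hz (ρ k z)).trans (le_of_eq ?_)
            ring
        _ = (∫⁻ z, ρ k z * g t z) + ENNReal.ofReal K * ∫⁻ z, ρ k z * P z := by
            rw [lintegral_add_right _ (hρP.const_mul _), lintegral_const_mul _ hρP]
        _ ≤ ENNReal.ofReal D + ENNReal.ofReal K * (ENNReal.ofReal c *
              ∫⁻ s in Ioo 0 t, ∫⁻ x, ρ k x * b (x, s)) := by
            gcongr
        _ = _ := by rw [ENNReal.ofReal_mul hK.le, mul_assoc]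
  filter_upwards [ae_all_iff.2 hstep] with t ht
  have hlim : ∀ z, Tendsto (fun k => ρ k z * b (z, t)) atTop (𝓝 (b (z, t))) := by
    intro z
    have h1 : Tendsto (fun k : ℕ => -(1 / (k + 1 : ℝ) * ‖z‖)) atTop (𝓝 (-(0 * ‖z‖))) :=
      (tendsto_one_div_add_atTop_nhds_zero_nat.mul_const _).neg
    have h2 : Tendsto (fun k => ρ k z) atTop (𝓝 1) := by
      have := ENNReal.tendsto_ofReal ((Real.continuous_exp.tendsto _).comp h1)
      rw [zero_mul, neg_zero, Real.exp_zero, ENNReal.ofReal_one] at this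
      exact this
    have h3 := ENNReal.Tendsto.mul_const (b := b (z, t)) h2 (Or.inl one_ne_zero)
    rwa [one_mul] at h3
  calc ∫⁻ z, b (z, t) = ∫⁻ z, liminf (fun k => ρ k z * b (z, t)) atTop :=
        lintegral_congr fun z => (hlim z).liminf_eq.symm
    _ ≤ liminf (fun k => ∫⁻ z, ρ k z * b (z, t)) atTop :=
        lintegral_liminf_le fun k => (hρm k).mul (hb.comp (by fun_prop))
    _ ≤ _ := liminf_le_of_le (by isBoundedDefault) fun a ha => by
        obtain ⟨k, hk⟩ := ha.exists
        exact hk.trans (ht k)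

end Gronwall

/-! ### The volume of tubes around the boundary. -/

section Tube
open Filter Topology

/-- Boundaries with a lower density bound have neighbourhoods of the expected volume. -/
theorem BoundsGeneralisedHypersurface.volume_thickening_mul_le {n : ℕ} {κ δ θ : ℝ}
    {Ω : Set (EuclideanSpace ℝ (Fin (n + 1)))} (hΩ : BoundsGeneralisedHypersurface n κ δ θ Ω)
    {r γ : ℝ} (hγ : γ ∈ Ioc 0 δ) (hγr : γ ≤ r) :
    volume (Metric.thickening r (frontier Ω)) * (ENNReal.ofReal θ * ENNReal.ofReal (γ ^ (n + κ)))
      ≤ Measure.hausdorffMeasure (n + κ) (frontier Ω) * (ENNReal.ofReal ((6 * r) ^ (n + 1))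
        * volume (Metric.ball (0 : EuclideanSpace ℝ (Fin (n + 1))) 1)) := by
  set M := frontier Ω with hM
  set V := volume (Metric.ball (0 : EuclideanSpace ℝ (Fin (n + 1))) 1)
  set μ : Measure (EuclideanSpace ℝ (Fin (n + 1))) := Measure.hausdorffMeasure (n + κ) with hμ
  have hr : 0 < r := hγ.1.trans_le hγr
  -- The balls B(p, γ), p ∈ u, are disjoint while their fivefold enlargements cover M. Disjointness
  -- and the density bound limit the number of centres by the mass of M.
  obtain ⟨u, huM, hud, hcov⟩ := Vitali.exists_disjoint_subfamily_covering_enlargement_ball M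
    (fun p => p) (fun _ => γ) γ (fun _ _ => le_rfl) 5 (by norm_num)
  have huc : u.Countable := hud.countable_of_isOpen (fun _ _ => Metric.isOpen_ball)
    fun p _ => ⟨p, Metric.mem_ball_self hγ.1⟩
  have h1 : u.encard * (ENNReal.ofReal θ * ENNReal.ofReal (γ ^ (n + κ))) ≤ μ M := by
    have hd : u.PairwiseDisjoint fun p => M ∩ Metric.ball p γ :=
      hud.mono fun p => inter_subset_right
    calc _ = ∑' _ : u, ENNReal.ofReal θ * ENNReal.ofReal (γ ^ (n + κ)) :=
          (ENNReal.tsum_set_const _ _).symm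
      _ ≤ ∑' p : u, μ (M ∩ Metric.ball p γ) := by
          refine ENNReal.tsum_le_tsum fun p => ?_
          have h2 := hΩ.lower_density p (huM p.2) γ hγ
          exact (ENNReal.le_div_iff_mul_le
            (Or.inl (ENNReal.ofReal_pos.2 (Real.rpow_pos_of_pos hγ.1 _)).ne')
            (Or.inl ENNReal.ofReal_ne_top)).1 h2
      _ = μ (⋃ p ∈ u, M ∩ Metric.ball p γ) :=
          (measure_biUnion huc hd fun p _ =>
            isClosed_frontier.measurableSet.inter Metric.isOpen_ball.measurableSet).symm
      _ ≤ μ M := measure_mono (iUnion₂_subset fun _ _ => inter_subset_left)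
  have h2 : volume (Metric.thickening r M) ≤ u.encard * (ENNReal.ofReal ((6 * r) ^ (n + 1)) * V) := by
    -- The radius comes from r + 5γ ≤ 6r.
    have hsub : Metric.thickening r M ⊆ ⋃ p ∈ u, Metric.ball p (6 * r) := by
      intro x hx
      obtain ⟨q, hq, hxq⟩ := Metric.mem_thickening_iff.1 hx
      obtain ⟨p, hp, hqp⟩ := hcov q hq
      refine mem_iUnion₂.2 ⟨p, hp, Metric.mem_ball.2 ?_⟩
      have h3 : dist q p < 5 * γ := hqp (Metric.mem_ball_self hγ.1)
      linarith [dist_triangle x q p]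
    calc _ ≤ volume (⋃ p ∈ u, Metric.ball p (6 * r)) := measure_mono hsub
      _ ≤ ∑' p : u, volume (Metric.ball (p : EuclideanSpace ℝ (Fin (n + 1))) (6 * r)) :=
          measure_biUnion_le _ huc _
      _ = ∑' _ : u, ENNReal.ofReal ((6 * r) ^ (n + 1)) * V := by
          refine tsum_congr fun p => ?_
          rw [Measure.addHaar_ball _ _ (by positivity)]
          simp [V]
      _ = _ := ENNReal.tsum_set_const _ _
  calc _ ≤ u.encard * (ENNReal.ofReal ((6 * r) ^ (n + 1)) * V)
          * (ENNReal.ofReal θ * ENNReal.ofReal (γ ^ (n + κ))) := by gcongr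
    _ = u.encard * (ENNReal.ofReal θ * ENNReal.ofReal (γ ^ (n + κ)))
          * (ENNReal.ofReal ((6 * r) ^ (n + 1)) * V) := by ring
    _ ≤ _ := by gcongr

theorem exists_volume_thickening_le (n : ℕ) {κ δ θ : ℝ} (hδ : 0 < δ) (hθ : 0 < θ) (A : ℝ≥0) :
    ∃ C : ℝ, 0 ≤ C ∧ ∀ Ω : Set (EuclideanSpace ℝ (Fin (n + 1))),
      BoundsGeneralisedHypersurface n κ δ θ Ω →
      Measure.hausdorffMeasure ((n : ℝ) + κ) (frontier Ω) ≤ (A : ℝ≥0∞) → ∀ r : ℝ, 0 < r →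
        volume (Metric.thickening r (frontier Ω))
          ≤ ENNReal.ofReal (C * (r ^ (1 - κ) + r ^ ((n : ℝ) + 1))) := by
  set V := volume (Metric.ball (0 : EuclideanSpace ℝ (Fin (n + 1))) 1) with hV
  have hVt : V ≠ ⊤ := measure_ball_lt_top.ne
  set s : ℝ := n + κ with hs
  refine ⟨A * 6 ^ (n + 1) * V.toReal / θ * (1 + δ ^ (-s)), by positivity, fun Ω hΩ hA r hr => ?_⟩
  -- The density bound is available only up to scale δ. For r ≤ δ the choice γ = r gives r^(n+1)
  -- r^(−(n+κ)) = r^(1−κ); for larger r the choice γ = δ costs the term r^(n+1).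
  set γ := min r δ with hγ
  have hγ0 : 0 < γ := lt_min hr hδ
  have h := hΩ.volume_thickening_mul_le (γ := γ) ⟨hγ0, min_le_right _ _⟩ (min_le_left r δ)
  have hγs : 0 < γ ^ s := Real.rpow_pos_of_pos hγ0 _
  rw [← ENNReal.ofReal_mul hθ.le, ← ENNReal.le_div_iff_mul_le
    (Or.inl (ENNReal.ofReal_pos.2 (by positivity)).ne') (Or.inl ENNReal.ofReal_ne_top)] at h
  refine h.trans ?_
  have hr' : (0 : ℝ) ≤ (6 * r) ^ (n + 1) := by positivity
  calc _ ≤ (A : ℝ≥0∞) * (ENNReal.ofReal ((6 * r) ^ (n + 1)) * V) / ENNReal.ofReal (θ * γ ^ s) := by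
        gcongr
    _ = ENNReal.ofReal (A * ((6 * r) ^ (n + 1) * V.toReal) / (θ * γ ^ s)) := by
        rw [ENNReal.ofReal_div_of_pos (by positivity), ENNReal.ofReal_mul NNReal.zero_le_coe,
          ENNReal.ofReal_mul hr', ENNReal.ofReal_toReal hVt, ENNReal.ofReal_coe_nnreal]
    _ ≤ _ := by
        refine ENNReal.ofReal_le_ofReal ?_
        have e1 : (γ ^ s)⁻¹ ≤ r ^ (-s) + δ ^ (-s) := by
          rw [← Real.rpow_neg hγ0.le]
          rcases min_choice r δ with hm | hm <;> rw [hγ, hm]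
          · exact le_add_of_nonneg_right (by positivity)
          · exact le_add_of_nonneg_left (by positivity)
        have e2 : r ^ (n + 1) * r ^ (-s) = r ^ (1 - κ) := by
          rw [← Real.rpow_natCast, ← Real.rpow_add hr, hs]
          congr 1
          push_cast
          ring
        have e3 : r ^ ((n : ℝ) + 1) = r ^ (n + 1) := by
          rw [← Real.rpow_natCast]
          push_cast
          rfl
        rw [e3]
        calc A * ((6 * r) ^ (n + 1) * V.toReal) / (θ * γ ^ s)
            = A * 6 ^ (n + 1) * V.toReal / θ * (r ^ (n + 1) * (γ ^ s)⁻¹) := by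
              rw [mul_pow]
              field_simp
          _ ≤ A * 6 ^ (n + 1) * V.toReal / θ * (r ^ (n + 1) * (r ^ (-s) + δ ^ (-s))) := by gcongr
          _ = A * 6 ^ (n + 1) * V.toReal / θ * (r ^ (1 - κ) + δ ^ (-s) * r ^ (n + 1)) := by
              rw [mul_add, e2]
              ring
          _ ≤ A * 6 ^ (n + 1) * V.toReal / θ * ((1 + δ ^ (-s)) * (r ^ (1 - κ) + r ^ (n + 1))) := by
              have p1 : 0 ≤ r ^ (1 - κ) := by positivity
              have p2 : 0 ≤ r ^ (n + 1) := by positivity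
              have p3 : 0 ≤ δ ^ (-s) := by positivity
              gcongr
              nlinarith [mul_nonneg p3 p1]
          _ = _ := by ring

/-- The integrand is nonzero only if exactly one of z and z − y lies in Ω. That point has a frontier
point within ‖y‖, hence z has one within 2‖y‖; the factor 3 gives strict inequality. -/
theorem lintegral_enorm_indicator_translate_sub_le {E : Type*} [NormedAddCommGroup E]
    [NormedSpace ℝ E] [FiniteDimensional ℝ E] [MeasureSpace E] [BorelSpace E] {Ω : Set E}
    (hΩ : Ω ≠ univ) (y : E) (hy : y ≠ 0) :
    ∫⁻ z, ‖Ω.indicator (fun _ => (1 : ℝ)) (z - y) - Ω.indicator (fun _ => (1 : ℝ)) z‖ₑ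
      ≤ volume (Metric.thickening (3 * ‖y‖) (frontier Ω)) := by
  have hy0 : 0 < ‖y‖ := norm_pos_iff.2 hy
  rw [← lintegral_indicator_one Metric.isOpen_thickening.measurableSet]
  have hcross : ∀ a b : E, a ∈ Ω → b ∉ Ω → ∃ q ∈ frontier Ω, dist a q ≤ dist a b := by
    intro a b ha hb
    obtain ⟨q, hq, hqd⟩ := exists_mem_frontier_infDist_compl_eq_dist ha hΩ
    exact ⟨q, hq, hqd ▸ Metric.infDist_le_dist_of_mem hb⟩
  refine lintegral_mono fun z => ?_
  by_cases h1 : z - y ∈ Ω <;> by_cases h2 : z ∈ Ω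
  · simp [h1, h2]
  · obtain ⟨q, hq, hd⟩ := hcross _ _ h1 h2
    have hz : z ∈ Metric.thickening (3 * ‖y‖) (frontier Ω) := by
      refine Metric.mem_thickening_iff.2 ⟨q, hq, ?_⟩
      have h3 : dist (z - y) z = ‖y‖ := by simp
      have h4 := dist_triangle z (z - y) q
      rw [dist_comm z (z - y)] at h4
      linarith
    simp [h1, h2, hz]
  · obtain ⟨q, hq, hd⟩ := hcross _ _ h2 h1
    have hz : z ∈ Metric.thickening (3 * ‖y‖) (frontier Ω) := by
      refine Metric.mem_thickening_iff.2 ⟨q, hq, ?_⟩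
      have h3 : dist z (z - y) = ‖y‖ := by simp
      linarith
    simp [h1, h2, hz]
  · simp [h1, h2]

end Tube

/-! ### The reaction term as a source, and the maximum principle. -/

section AllenCahn
open Filter Topology
set_option linter.unusedSectionVars false

theorem measurable_wellForce : Measurable wellForce := by
  unfold wellForce
  fun_prop

theorem abs_wellForce_le {w r : ℝ} (hw : |w| ≤ r) : |wellForce w| ≤ 2 * r * (r ^ 2 + 1) := by
  unfold wellForce
  have h0 := abs_nonneg w
  have h1 : |w ^ 2 - 1| ≤ r ^ 2 + 1 := by
    rw [abs_le]
    have : w ^ 2 ≤ r ^ 2 := sq_le_sq' (abs_le.1 hw).1 (abs_le.1 hw).2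
    constructor <;> nlinarith [sq_nonneg w]
  rw [abs_mul, abs_mul, abs_two]
  have : 0 ≤ r := h0.trans hw
  gcongr

theorem phaseDatum_eq_or {X : Type*} (Ω : Set X) (x : X) :
    phaseDatum Ω x = 1 ∨ phaseDatum Ω x = -1 := by
  by_cases hx : x ∈ Ω
  · left; simp [phaseDatum, hx]; norm_num
  · right; simp [phaseDatum, hx]

theorem measurable_phaseDatum {X : Type*} [MeasurableSpace X] {Ω : Set X} (hΩ : MeasurableSet Ω) :
    Measurable (phaseDatum Ω) :=
  ((measurable_const.indicator hΩ).const_mul 2).sub_const 1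

variable {d : ℕ} {ε : ℝ} {u₀ : EuclideanSpace ℝ (Fin d) → ℝ} {u : EuclideanSpace ℝ (Fin d) → ℝ → ℝ}

/-- Evaluated on a bounded representative, the reaction becomes a bounded source and the linear
theory applies. The horizon 1 suffices because times below ε² < 1 are all that matter. -/
theorem IsAllenCahnSolution.isWeakHeatSolution (hu : IsAllenCahnSolution ε u₀ u)
    {U : EuclideanSpace ℝ (Fin d) × ℝ → ℝ} {R : ℝ} (hU : Measurable U) (hR : ∀ z, |U z| ≤ R)
    (hUu : ∀ᵐ z ∂volume.restrict ((univ : Set (EuclideanSpace ℝ (Fin d))) ×ˢ Ioo (0 : ℝ) 1),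
      u z.1 z.2 = U z) :
    IsWeakHeatSolution 1 (R + 1 / ε ^ 2 * (2 * R * (R ^ 2 + 1))) u U
      (fun q => -(1 / ε ^ 2 * wellForce (U q))) where
  measurable := hU
  bound z := (hR z).trans (le_add_of_nonneg_right (by
    have : 0 ≤ R := (abs_nonneg _).trans (hR z)
    positivity))
  measurable_source := ((measurable_wellForce.comp hU).const_mul _).neg
  bound_source z := by
    have h0 : 0 ≤ R := (abs_nonneg _).trans (hR z)
    rw [abs_neg, abs_mul, abs_of_nonneg (by positivity)]
    have := abs_wellForce_le (hR z)
    have : 1 / ε ^ 2 * |wellForce (U z)| ≤ 1 / ε ^ 2 * (2 * R * (R ^ 2 + 1)) := by gcongr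
    linarith
  ae_eq := by
    rw [Measure.volume_eq_prod, ← Measure.prod_restrict, Measure.restrict_univ] at hUu
    exact Measure.ae_ae_of_ae_prod
      (Measure.measurePreserving_swap.quasiMeasurePreserving.ae hUu)
  locallyIntegrable := hu.locallyIntegrable
  continuousOn_pairing := hu.continuousOn_pairing
  equation φ hφ hφc hφt := by
    rw [← hu.equation φ hφ hφc (hφt.trans (prod_mono_right Ioo_subset_Ioi_self))]
    refine integral_congr_ae ?_
    have h1 := (ae_restrict_iff' (MeasurableSet.univ.prod measurableSet_Ioo)).1 hUu
    filter_upwards [h1] with z hz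
    -- On the support of φ the representative may replace u; elsewhere φ and its derivatives vanish,
    -- so a discrepancy there is harmless.
    by_cases hzt : z ∈ tsupport φ
    · rw [hz (hφt hzt)]
      ring
    · have h0 : φ =ᶠ[𝓝 z] fun _ => 0 := notMem_tsupport_iff_eventuallyEq.1 hzt
      have e1 : deriv (fun s => φ (z.1, s)) z.2 = 0 := by
        have : (fun s => φ (z.1, s)) =ᶠ[𝓝 z.2] fun _ => 0 :=
          (Continuous.prodMk_right z.1).continuousAt.eventually h0
        rw [this.deriv_eq, deriv_const]
      have e2 : Laplacian.laplacian (fun y => φ (y, z.2)) z.1 = 0 := by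
        have : (fun y => φ (y, z.2)) =ᶠ[𝓝 z.1] fun _ => 0 :=
          (Continuous.prodMk_left z.2).continuousAt.eventually h0
        rw [(InnerProductSpace.laplacian_congr_nhds this).eq_of_nhds]
        exact congrFun InnerProductSpace.laplacian_const z.1
      rw [e1, e2, h0.eq_of_nhds]
      simp

/-- Truncation of a real number to `[-R, R]`. -/
noncomputable def truncate (R w : ℝ) : ℝ := max (-R) (min R w)

theorem measurable_truncate (R : ℝ) : Measurable (truncate R) :=
  measurable_const.max (measurable_const.min measurable_id)

theorem abs_truncate_le {R : ℝ} (hR : 0 ≤ R) (w : ℝ) : |truncate R w| ≤ R := by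
  rw [abs_le]
  exact ⟨le_max_left _ _, max_le (by linarith) (min_le_left _ _)⟩

theorem truncate_of_abs_le {R w : ℝ} (hw : |w| ≤ R) : truncate R w = w := by
  rw [abs_le] at hw
  rw [truncate, min_eq_right hw.2, max_eq_right hw.1]

theorem IsAllenCahnSolution.exists_bounded_representative (hu : IsAllenCahnSolution ε u₀ u) :
    ∃ (R : ℝ) (U : EuclideanSpace ℝ (Fin d) × ℝ → ℝ), 0 ≤ R ∧ Measurable U ∧ (∀ z, |U z| ≤ R) ∧
      ∀ᵐ z ∂volume.restrict ((univ : Set (EuclideanSpace ℝ (Fin d))) ×ˢ Ioo (0 : ℝ) 1),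
        u z.1 z.2 = U z := by
  have h := hu.memLp_top 1 one_pos
  obtain ⟨g, hg, hge⟩ := h.1
  set R : ℝ := (eLpNormEssSup (fun z : EuclideanSpace ℝ (Fin d) × ℝ => u z.1 z.2)
    (volume.restrict (univ ×ˢ Icc 0 1))).toReal with hRdef
  have hfin : eLpNormEssSup (fun z : EuclideanSpace ℝ (Fin d) × ℝ => u z.1 z.2)
    (volume.restrict (univ ×ˢ Icc 0 1)) ≠ ⊤ := by
    have := h.2
    rw [eLpNorm_exponent_top] at this
    exact this.ne
  refine ⟨R, fun z => truncate R (g z), ENNReal.toReal_nonneg,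
    (measurable_truncate R).comp hg.measurable, fun z => abs_truncate_le ENNReal.toReal_nonneg _, ?_⟩
  refine ae_restrict_of_ae_restrict_of_subset (prod_mono_right Ioo_subset_Icc_self) ?_
  filter_upwards [hge, enorm_ae_le_eLpNormEssSup (fun z : EuclideanSpace ℝ (Fin d) × ℝ =>
    u z.1 z.2) (volume.restrict (univ ×ˢ Icc 0 1))] with z hz1 hz2
  rw [← hz1, truncate_of_abs_le]
  rw [hRdef, ← Real.norm_eq_abs, ← toReal_enorm]
  exact ENNReal.toReal_mono hfin hz2

/-- For w ≥ 1 the force is nonnegative and may be dropped. For w ≤ 1 the left-hand side is (w − 1)(λ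
− 2kw(w + 1)), and λ makes the second factor nonnegative. -/
theorem sub_le_mul_max_of_abs_le {k lam R w : ℝ} (hk : 0 ≤ k) (hw : |w| ≤ R)
    (hlam : 2 * k * (R * (R + 1)) ≤ lam) :
    lam * w - k * wellForce w - lam ≤ lam * max (w - 1) 0 := by
  have hR : 0 ≤ R := (abs_nonneg w).trans hw
  have hw' := abs_le.1 hw
  have hlam0 : 0 ≤ lam := le_trans (by positivity) hlam
  unfold wellForce
  rcases le_total 1 w with h | h
  · rw [max_eq_left (by linarith)]
    have : 0 ≤ k * (2 * w * (w ^ 2 - 1)) :=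
      mul_nonneg hk (mul_nonneg (by linarith) (by nlinarith))
    linarith
  · rw [max_eq_right (by linarith)]
    have h1 : w * (w + 1) ≤ R * (R + 1) := by nlinarith
    have h2 : 2 * k * (w * (w + 1)) ≤ lam :=
      (mul_le_mul_of_nonneg_left h1 (by positivity)).trans hlam
    nlinarith [mul_le_mul_of_nonneg_right h2 (show 0 ≤ 1 - w by linarith)]

theorem heatConv_mono {E : Type*} [NormedAddCommGroup E] [InnerProductSpace ℝ E]
    [FiniteDimensional ℝ E] [MeasurableSpace E] [BorelSpace E] {τ : ℝ} (hτ : 0 < τ)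
    {g₁ g₂ : E → ℝ} {R : ℝ} (h₁ : AEStronglyMeasurable g₁) (h₂ : AEStronglyMeasurable g₂)
    (hR₁ : ∀ᵐ x, |g₁ x| ≤ R) (hR₂ : ∀ᵐ x, |g₂ x| ≤ R) (h : ∀ᵐ x, g₁ x ≤ g₂ x) (z : E) :
    heatConv τ g₁ z ≤ heatConv τ g₂ z := by
  refine integral_mono_ae (integrable_heatKernel_mul hτ z h₁ hR₁)
    (integrable_heatKernel_mul hτ z h₂ hR₂) ?_
  filter_upwards [h] with x hx
  exact mul_le_mul_of_nonneg_left hx (heatKernel_pos hτ _).le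

theorem ofReal_heatConv {E : Type*} [NormedAddCommGroup E] [InnerProductSpace ℝ E]
    [FiniteDimensional ℝ E] [MeasurableSpace E] [BorelSpace E] {τ : ℝ} (hτ : 0 < τ)
    {g : E → ℝ} {R : ℝ} (hg : Measurable g) (hR : ∀ x, |g x| ≤ R) (h0 : ∀ x, 0 ≤ g x) (z : E) :
    ENNReal.ofReal (heatConv τ g z)
      = ∫⁻ x, ENNReal.ofReal (heatKernel τ (z - x)) * ENNReal.ofReal (g x) := by
  rw [heatConv, ofReal_integral_eq_lintegral_ofReal
    (integrable_heatKernel_mul hτ z hg.aestronglyMeasurable (ae_of_all _ hR))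
    (ae_of_all _ fun x => mul_nonneg (heatKernel_pos hτ _).le (h0 x))]
  simp only [ENNReal.ofReal_mul (heatKernel_pos hτ _).le]

/-- One half of the maximum principle; `σ = ±1` selects the upper or the lower bound. -/
theorem IsAllenCahnSolution.ae_mul_le_one (hu : IsAllenCahnSolution ε u₀ u)
    (hu₀ : ∀ x, |u₀ x| ≤ 1)
    {U : EuclideanSpace ℝ (Fin d) × ℝ → ℝ} {R : ℝ} (hU : Measurable U) (hR : ∀ z, |U z| ≤ R)
    (hUu : ∀ᵐ z ∂volume.restrict ((univ : Set (EuclideanSpace ℝ (Fin d))) ×ˢ Ioo (0 : ℝ) 1),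
      u z.1 z.2 = U z) {σ : ℝ} (hσ : σ = 1 ∨ σ = -1) :
    ∀ᵐ t ∂volume.restrict (Ioo (0 : ℝ) 1), ∀ᵐ x, σ * U (x, t) ≤ 1 := by
  have H := hu.isWeakHeatSolution hU hR hUu
  set k : ℝ := 1 / ε ^ 2 with hk
  have hk0 : 0 ≤ k := by positivity
  have hR0 : 0 ≤ R := (abs_nonneg _).trans (hR 0)
  set R' : ℝ := R + k * (2 * R * (R ^ 2 + 1)) with hR'
  -- Large enough for `sub_le_mul_max_of_abs_le` on [−R, R]; the added 1 keeps it positive.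
  set lam : ℝ := 2 * k * (R * (R + 1)) + 1 with hlam
  have hlam0 : 0 < lam := by positivity
  have hσa : |σ| = 1 := by rcases hσ with h | h <;> simp [h]
  have hσf : ∀ w, wellForce (σ * w) = σ * wellForce w := by
    intro w
    rcases hσ with h | h <;> simp [h, wellForce]
  have hσR : ∀ z, |σ * U z| ≤ R := fun z => by rw [abs_mul, hσa, one_mul]; exact hR z
  -- The excess over the barrier 1 will be dominated by λ times its own heat potential, with no free
  -- term, so the L¹ Grönwall inequality with D = 0 forces it to vanish. Oddness of f lets both
  -- signs σ be treated together.
  set m : EuclideanSpace ℝ (Fin d) × ℝ → ℝ := fun q => max (σ * U q - 1) 0 with hm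
  have hmm : Measurable m := ((hU.const_mul σ).sub_const 1).max measurable_const
  have hm0 : ∀ q, 0 ≤ m q := fun q => le_max_right _ _
  have hmR : ∀ q, |m q| ≤ R + 1 := fun q => by
    rw [abs_of_nonneg (hm0 q)]
    refine max_le ?_ (by positivity)
    linarith [(abs_le.1 (hσR q)).2]
  have hkey := ae_lintegral_le_of_le_add_heatPotential (b := fun q => ENNReal.ofReal (m q))
    (g := fun _ _ => 0) (N := R + 1) (D := 0) (K := lam) (t₁ := 1) hmm.ennreal_ofReal
    (by positivity) (fun q => ENNReal.ofReal_le_ofReal ((le_abs_self _).trans (hmR q))) le_rfl hlam0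
    le_rfl (by simp) ?_
  · filter_upwards [hkey] with t ht
    simp only [mul_zero, zero_mul, ENNReal.ofReal_zero, nonpos_iff_eq_zero] at ht
    have hmt : Measurable fun x => ENNReal.ofReal (m (x, t)) :=
      (hmm.comp measurable_prodMk_right).ennreal_ofReal
    rw [lintegral_eq_zero_iff hmt] at ht
    filter_upwards [ht] with x hx
    have h1 : m (x, t) ≤ 0 := ENNReal.ofReal_eq_zero.1 hx
    have h2 : σ * U (x, t) - 1 ≤ m (x, t) := le_max_left _ _
    linarith
  filter_upwards [H.ae_eq, ae_restrict_mem measurableSet_Ioo] with t ht htI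
  filter_upwards [ht, H.duhamel lam htI] with z hz hduh
  have hI : IntegrableOn (fun s => Real.exp (lam * s) * heatConv (t - s)
      (fun x => lam * U (x, s) + -(k * wellForce (U (x, s)))) z) (Ioo 0 t) :=
    H.integrableOn_exp_mul_heatConv lam le_rfl z
  have hI2 : IntegrableOn (fun s : ℝ => lam * Real.exp (lam * s)) (Ioo 0 t) :=
    ((by fun_prop : Continuous fun s : ℝ => lam * Real.exp (lam * s)).integrableOn_Icc
      (a := 0) (b := t)).mono_set Ioo_subset_Icc_self
  have hI3 : IntegrableOn (fun s => Real.exp (lam * t) * (lam * heatConv (t - s)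
      (fun x => m (x, s)) z)) (Ioo 0 t) := by
    refine Integrable.const_mul (Integrable.const_mul ?_ _) _
    refine Integrable.mono' (g := fun _ => R + 1) (integrableOn_const measure_Ioo_lt_top.ne)
      (measurable_heatConv_time hmm t z).aestronglyMeasurable ?_
    filter_upwards [ae_restrict_mem measurableSet_Ioo] with s hs
    exact abs_heatConv_le (sub_pos.2 hs.2) z (ae_of_all _ fun x => hmR _)
  -- Duhamel's formula for the constant solution 1; subtracting it from that of σu cancels the
  -- initial bound and leaves λ inside the integral.
  have hexp : Real.exp (lam * t) = 1 + ∫ s in Ioo 0 t, lam * Real.exp (lam * s) := by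
    rw [← integral_Ioc_eq_integral_Ioo, ← intervalIntegral.integral_of_le htI.1.le,
      intervalIntegral.integral_const_mul, intervalIntegral.integral_comp_mul_left _ hlam0.ne']
    simp
    field_simp
    ring
  have h0 : σ * heatConv t (fun x => u x 0) z ≤ 1 := by
    have h1 : |heatConv t (fun x => u x 0) z| ≤ 1 := abs_heatConv_le htI.1 z (by
      filter_upwards [hu.initial] with x hx
      rw [hx]
      exact hu₀ x)
    refine (le_abs_self _).trans ?_
    rw [abs_mul, hσa, one_mul]
    exact h1
  have hle : ∀ s ∈ Ioo 0 t, σ * (Real.exp (lam * s) * heatConv (t - s)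
      (fun x => lam * U (x, s) + -(k * wellForce (U (x, s)))) z) - lam * Real.exp (lam * s)
      ≤ Real.exp (lam * t) * (lam * heatConv (t - s) (fun x => m (x, s)) z) := by
    intro s hs
    have hpos : 0 < t - s := sub_pos.2 hs.2
    have hUs : Measurable fun x => U (x, s) := hU.comp measurable_prodMk_right
    have hms : Measurable fun x => m (x, s) := hmm.comp measurable_prodMk_right
    have hfs : Measurable fun x => lam * U (x, s) + -(k * wellForce (U (x, s))) :=
      (hUs.const_mul lam).add ((measurable_wellForce.comp hUs).const_mul k).neg
    have e1 : σ * heatConv (t - s) (fun x => lam * U (x, s) + -(k * wellForce (U (x, s)))) z - lam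
        = heatConv (t - s) (fun x => σ * (lam * U (x, s) + -(k * wellForce (U (x, s)))) + -lam) z := by
      rw [heatConv_add_const_mul (R := max (|lam| * R' + R') |lam|) hpos hfs measurable_const
        (fun x => (H.abs_duhamel_source_le lam (x, s)).trans (le_max_left _ _))
        (fun x => by rw [abs_neg]; exact le_max_right _ _), heatConv_const hpos]
      ring
    have e2 : lam * heatConv (t - s) (fun x => m (x, s)) z
        = heatConv (t - s) (fun x => lam * m (x, s) + 0) z := by
      rw [heatConv_add_const_mul (R := R + 1) hpos hms measurable_const
        (fun x => hmR _) (fun x => by simp; positivity), heatConv_const hpos, add_zero]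
    have h2 : σ * heatConv (t - s) (fun x => lam * U (x, s) + -(k * wellForce (U (x, s)))) z - lam
        ≤ lam * heatConv (t - s) (fun x => m (x, s)) z := by
      rw [e1, e2]
      refine heatConv_mono (R := |lam| * R' + R' + lam + lam * (R + 1)) hpos
        ((hfs.const_mul σ).add_const (-lam)).aestronglyMeasurable
        ((hms.const_mul lam).add_const 0).aestronglyMeasurable (ae_of_all _ fun x => ?_)
        (ae_of_all _ fun x => ?_) (ae_of_all _ fun x => ?_) z
      · refine (abs_add_le _ _).trans ?_
        rw [abs_mul, hσa, one_mul, abs_neg, abs_of_pos hlam0]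
        have h3 := H.abs_duhamel_source_le lam (x, s)
        rw [abs_of_pos hlam0] at h3
        have : 0 ≤ lam * (R + 1) := by positivity
        linarith
      · rw [add_zero, abs_mul, abs_of_pos hlam0]
        have h3 : lam * |m (x, s)| ≤ lam * (R + 1) := mul_le_mul_of_nonneg_left (hmR _) hlam0.le
        have : 0 ≤ R' := H.bound_nonneg
        have : 0 ≤ lam * R' + R' + lam := by positivity
        linarith
      · have h3 := sub_le_mul_max_of_abs_le hk0 (hσR (x, s)) (show _ ≤ lam by rw [hlam]; linarith)
        rw [hσf] at h3
        simp only [hm, add_zero]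
        linarith
    have hmc : 0 ≤ lam * heatConv (t - s) (fun x => m (x, s)) z :=
      mul_nonneg hlam0.le (integral_nonneg fun x =>
        mul_nonneg (heatKernel_pos hpos _).le (hm0 _))
    have h4 : Real.exp (lam * s) ≤ Real.exp (lam * t) :=
      Real.exp_le_exp.2 (mul_le_mul_of_nonneg_left hs.2.le hlam0.le)
    calc _ = Real.exp (lam * s) * (σ * heatConv (t - s)
          (fun x => lam * U (x, s) + -(k * wellForce (U (x, s)))) z - lam) := by ring
      _ ≤ Real.exp (lam * s) * (lam * heatConv (t - s) (fun x => m (x, s)) z) :=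
          mul_le_mul_of_nonneg_left h2 (Real.exp_pos _).le
      _ ≤ _ := mul_le_mul_of_nonneg_right h4 hmc
  have hmain : σ * u z t - 1 ≤ ∫ s in Ioo 0 t, lam * heatConv (t - s) (fun x => m (x, s)) z := by
    have h5 : ∫ s in Ioo 0 t, (σ * (Real.exp (lam * s) * heatConv (t - s)
        (fun x => lam * U (x, s) + -(k * wellForce (U (x, s)))) z) - lam * Real.exp (lam * s))
        ≤ ∫ s in Ioo 0 t, Real.exp (lam * t) * (lam * heatConv (t - s) (fun x => m (x, s)) z) := by
      refine setIntegral_mono_on ((hI.const_mul σ).sub hI2) hI3 measurableSet_Ioo hle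
    rw [integral_sub (hI.const_mul σ) hI2, integral_const_mul σ,
      integral_const_mul (Real.exp (lam * t))] at h5
    have h6 : Real.exp (lam * t) * (σ * u z t - 1) ≤ Real.exp (lam * t)
        * ∫ s in Ioo 0 t, lam * heatConv (t - s) (fun x => m (x, s)) z := by
      have : Real.exp (lam * t) * (σ * u z t - 1)
          = σ * (Real.exp (lam * t) * u z t) - Real.exp (lam * t) := by ring
      rw [this, hduh, mul_add]
      linarith
    exact le_of_mul_le_mul_left h6 (Real.exp_pos _)
  rw [zero_add]
  have hmz : m (z, t) ≤ ∫ s in Ioo 0 t, lam * heatConv (t - s) (fun x => m (x, s)) z := by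
    refine max_le (by rw [← hz]; exact hmain) (setIntegral_nonneg measurableSet_Ioo fun s hs => ?_)
    exact mul_nonneg hlam0.le (integral_nonneg fun x =>
        mul_nonneg (heatKernel_pos (sub_pos.2 hs.2) _).le (hm0 _))
  have hI4 : IntegrableOn (fun s => heatConv (t - s) (fun x => m (x, s)) z) (Ioo 0 t) := by
    refine Integrable.mono' (g := fun _ => R + 1) (integrableOn_const measure_Ioo_lt_top.ne)
      (measurable_heatConv_time hmm t z).aestronglyMeasurable ?_
    filter_upwards [ae_restrict_mem measurableSet_Ioo] with s hs
    exact abs_heatConv_le (sub_pos.2 hs.2) z (ae_of_all _ fun x => hmR _)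
  refine (ENNReal.ofReal_le_ofReal hmz).trans (le_of_eq ?_)
  rw [integral_const_mul, ENNReal.ofReal_mul hlam0.le, ofReal_integral_eq_lintegral_ofReal hI4]
  · congr 1
    refine setLIntegral_congr_fun measurableSet_Ioo fun s hs => ?_
    exact ofReal_heatConv (sub_pos.2 hs.2) (hmm.comp measurable_prodMk_right) (fun x => hmR _)
      (fun x => hm0 _) z
  · filter_upwards [ae_restrict_mem measurableSet_Ioo] with s hs
    exact integral_nonneg fun x => mul_nonneg (heatKernel_pos (sub_pos.2 hs.2) _).le (hm0 _)

/-- A solution with initial values in `[-1, 1]` has a measurable representative with values in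
`[-1, 1]`. -/
theorem IsAllenCahnSolution.exists_representative_abs_le_one (hu : IsAllenCahnSolution ε u₀ u)
    (hu₀ : ∀ x, |u₀ x| ≤ 1) :
    ∃ U : EuclideanSpace ℝ (Fin d) × ℝ → ℝ, Measurable U ∧ (∀ z, |U z| ≤ 1) ∧
      ∀ᵐ z ∂volume.restrict ((univ : Set (EuclideanSpace ℝ (Fin d))) ×ˢ Ioo (0 : ℝ) 1),
        u z.1 z.2 = U z := by
  obtain ⟨R, U, hR0, hU, hR, hUu⟩ := hu.exists_bounded_representative
  refine ⟨fun z => truncate 1 (U z), (measurable_truncate 1).comp hU,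
    fun z => abs_truncate_le zero_le_one _, ?_⟩
  have h1 := hu.ae_mul_le_one hu₀ hU hR hUu (Or.inl rfl)
  have h2 := hu.ae_mul_le_one hu₀ hU hR hUu (Or.inr rfl)
  have h3 : ∀ᵐ t ∂volume.restrict (Ioo (0 : ℝ) 1), ∀ᵐ x, |U (x, t)| ≤ 1 := by
    filter_upwards [h1, h2] with t ht1 ht2
    filter_upwards [ht1, ht2] with x hx1 hx2
    rw [abs_le]
    constructor <;> linarith
  have h4 : ∀ᵐ q ∂(volume.restrict (Ioo (0 : ℝ) 1)).prod
      (volume : Measure (EuclideanSpace ℝ (Fin d))), |U q.swap| ≤ 1 := by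
    refine (Measure.ae_prod_iff_ae_ae ?_).2 h3
    exact measurableSet_le (hU.comp measurable_swap).norm measurable_const
  have h5 : ∀ᵐ z ∂volume.restrict ((univ : Set (EuclideanSpace ℝ (Fin d))) ×ˢ Ioo (0 : ℝ) 1),
      |U z| ≤ 1 := by
    rw [Measure.volume_eq_prod, ← Measure.prod_restrict, Measure.restrict_univ]
    exact Measure.measurePreserving_swap.quasiMeasurePreserving.ae h4
  filter_upwards [hUu, h5] with z hz1 hz2
  rw [hz1, truncate_of_abs_le hz2]

end AllenCahn

/-! ### The averaged translation modulus of the phase datum. -/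

section TranslationModulus
set_option linter.unusedSectionVars false

/-- The average over `y`, with weight `p_τ`, of the `L¹` distance between `phaseDatum Ω` and its
translate by `y` is `O(τ ^ ((1 - κ) / 2))`, uniformly in `Ω`. -/
theorem exists_lintegral_heatKernel_mul_translate_le (n : ℕ) {κ δ θ : ℝ} (hκ : κ ∈ Ioo (0 : ℝ) 1)
    (hδ : 0 < δ) (hθ : 0 < θ) (A : ℝ≥0) :
    ∃ C : ℝ, 0 ≤ C ∧ ∀ Ω : Set (EuclideanSpace ℝ (Fin (n + 1))),
      BoundsGeneralisedHypersurface n κ δ θ Ω →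
      Measure.hausdorffMeasure ((n : ℝ) + κ) (frontier Ω) ≤ (A : ℝ≥0∞) → ∀ τ ∈ Ioc (0 : ℝ) 2,
        ∫⁻ y, ENNReal.ofReal (heatKernel τ y) * ∫⁻ z, ‖phaseDatum Ω (z - y) - phaseDatum Ω z‖ₑ
          ≤ ENNReal.ofReal (C * τ ^ ((1 - κ) / 2)) := by
  obtain ⟨C₀, hC₀, hvol⟩ := exists_volume_thickening_le (κ := κ) n hδ hθ A
  set β₁ : ℝ := 1 - κ with hβ₁
  set β₂ : ℝ := (n : ℝ) + 1 with hβ₂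
  have h₁ : 0 ≤ β₁ := by linarith [hκ.2]
  have h₂ : 0 ≤ β₂ := by positivity
  have h₁₂ : β₁ ≤ β₂ := by linarith [hκ.1, (Nat.cast_nonneg n : (0 : ℝ) ≤ n)]
  set E := EuclideanSpace ℝ (Fin (n + 1))
  set K : ℝ → ℝ := fun β => (2 : ℝ) ^ (Module.finrank ℝ E / 2 : ℝ) * Real.exp (2 * β ^ 2) with hK
  have hK0 : ∀ β, 0 ≤ K β := fun β => by positivity
  -- The factor 2 is the jump of the datum, 3^β comes from tubes of radius 3‖y‖, K β from the
  -- moments of the kernel, and the last power of 2 absorbs the larger exponent into the smaller one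
  -- for τ ≤ 2.
  refine ⟨2 * C₀ * 3 ^ β₁ * K β₁ + 2 * C₀ * 3 ^ β₂ * (K β₂ * 2 ^ (β₂ / 2 - β₁ / 2)), ?_, ?_⟩
  · have := hK0 β₁
    have := hK0 β₂
    positivity
  intro Ω hΩ hA τ hτ
  have hΩu : Ω ≠ univ := fun h => NormedSpace.unbounded_univ ℝ E (h ▸ hΩ.isBounded)
  have hmod : ∀ y : E, ∫⁻ z, ‖phaseDatum Ω (z - y) - phaseDatum Ω z‖ₑ
      ≤ ENNReal.ofReal (2 * C₀ * 3 ^ β₁) * ENNReal.ofReal (‖y‖ ^ β₁)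
        + ENNReal.ofReal (2 * C₀ * 3 ^ β₂) * ENNReal.ofReal (‖y‖ ^ β₂) := by
    intro y
    rcases eq_or_ne y 0 with rfl | hy
    · simp
    have hy0 : 0 < ‖y‖ := norm_pos_iff.2 hy
    have e : ∀ z, ‖phaseDatum Ω (z - y) - phaseDatum Ω z‖ₑ = ENNReal.ofReal 2 *
        ‖Ω.indicator (fun _ => (1 : ℝ)) (z - y) - Ω.indicator (fun _ => (1 : ℝ)) z‖ₑ := by
      intro z
      have : phaseDatum Ω (z - y) - phaseDatum Ω z = 2 *
          (Ω.indicator (fun _ => (1 : ℝ)) (z - y) - Ω.indicator (fun _ => (1 : ℝ)) z) := by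
        unfold phaseDatum; ring
      rw [this, enorm_mul, Real.enorm_eq_ofReal (by norm_num)]
    simp only [e]
    rw [lintegral_const_mul' _ _ (by simp)]
    calc _ ≤ ENNReal.ofReal 2 * ENNReal.ofReal (C₀ * ((3 * ‖y‖) ^ β₁ + (3 * ‖y‖) ^ β₂)) := by
          gcongr
          exact (lintegral_enorm_indicator_translate_sub_le hΩu y hy).trans
            (hvol Ω hΩ hA _ (by positivity))
      _ = _ := by
          rw [← ENNReal.ofReal_mul (by positivity), ← ENNReal.ofReal_mul (by positivity),
            ← ENNReal.ofReal_mul (by positivity),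
            ← ENNReal.ofReal_add (by positivity) (by positivity),
            Real.mul_rpow (by norm_num) hy0.le, Real.mul_rpow (by norm_num) hy0.le]
          congr 1
          ring
  have hpm : ∀ β : ℝ, Measurable fun y : E =>
      ENNReal.ofReal (heatKernel τ y) * ENNReal.ofReal (‖y‖ ^ β) := fun β =>
    (continuous_heatKernel τ).measurable.ennreal_ofReal.mul
      (measurable_norm.pow_const β).ennreal_ofReal
  have hpow : τ ^ (β₂ / 2) ≤ 2 ^ (β₂ / 2 - β₁ / 2) * τ ^ (β₁ / 2) := by
    have : τ ^ (β₂ / 2) = τ ^ (β₂ / 2 - β₁ / 2) * τ ^ (β₁ / 2) := by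
      rw [← Real.rpow_add hτ.1]; ring_nf
    rw [this]
    have := hτ.1
    gcongr
    · linarith
    · exact hτ.2
  calc _ ≤ ∫⁻ y : E, (ENNReal.ofReal (2 * C₀ * 3 ^ β₁) *
            (ENNReal.ofReal (heatKernel τ y) * ENNReal.ofReal (‖y‖ ^ β₁))
          + ENNReal.ofReal (2 * C₀ * 3 ^ β₂) *
            (ENNReal.ofReal (heatKernel τ y) * ENNReal.ofReal (‖y‖ ^ β₂))) := by
        refine lintegral_mono fun y => ?_
        refine (mul_le_mul_right (hmod y) _).trans (le_of_eq ?_)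
        ring
    _ = ENNReal.ofReal (2 * C₀ * 3 ^ β₁) *
          (∫⁻ y : E, ENNReal.ofReal (heatKernel τ y) * ENNReal.ofReal (‖y‖ ^ β₁))
        + ENNReal.ofReal (2 * C₀ * 3 ^ β₂) *
          ∫⁻ y : E, ENNReal.ofReal (heatKernel τ y) * ENNReal.ofReal (‖y‖ ^ β₂) := by
        rw [lintegral_add_left ((hpm β₁).const_mul _), lintegral_const_mul _ (hpm β₁),
          lintegral_const_mul _ (hpm β₂)]
    _ ≤ ENNReal.ofReal (2 * C₀ * 3 ^ β₁) * ENNReal.ofReal (K β₁ * τ ^ (β₁ / 2))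
        + ENNReal.ofReal (2 * C₀ * 3 ^ β₂) * ENNReal.ofReal (K β₂ * τ ^ (β₂ / 2)) := by
        gcongr
        · exact lintegral_heatKernel_mul_rpow_le hτ.1 h₁
        · exact lintegral_heatKernel_mul_rpow_le hτ.1 h₂
    _ ≤ _ := by
        have := hτ.1
        rw [← ENNReal.ofReal_mul (by positivity), ← ENNReal.ofReal_mul (by positivity),
          ← ENNReal.ofReal_add (by positivity) (by positivity)]
        refine ENNReal.ofReal_le_ofReal ?_
        have h3 : 2 * C₀ * 3 ^ β₂ * (K β₂ * τ ^ (β₂ / 2))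
            ≤ 2 * C₀ * 3 ^ β₂ * (K β₂ * (2 ^ (β₂ / 2 - β₁ / 2) * τ ^ (β₁ / 2))) := by
          have := hK0 β₂
          gcongr
        linarith

end TranslationModulus

/-! ### Heat potentials of a source. -/

section HeatPotential
set_option linter.unusedSectionVars false

variable {E : Type*} [NormedAddCommGroup E] [InnerProductSpace ℝ E] [FiniteDimensional ℝ E]
  [MeasurableSpace E] [BorelSpace E]

theorem enorm_heatConv_le {τ : ℝ} (hτ : 0 < τ) (g : E → ℝ) (z : E) :
    ‖heatConv τ g z‖ₑ ≤ ∫⁻ x, ENNReal.ofReal (heatKernel τ (z - x)) * ‖g x‖ₑ := by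
  refine (enorm_integral_le_lintegral_enorm _).trans (le_of_eq (lintegral_congr fun x => ?_))
  rw [enorm_mul, Real.enorm_of_nonneg (heatKernel_pos hτ _).le]

theorem enorm_integral_heatConv_le (h : E × ℝ → ℝ) (t : ℝ) (z : E) :
    ‖∫ s in Ioo 0 t, heatConv (t - s) (fun x => h (x, s)) z‖ₑ
      ≤ ∫⁻ s in Ioo 0 t, ∫⁻ x, ENNReal.ofReal (heatKernel (t - s) (z - x)) * ‖h (x, s)‖ₑ :=
  (enorm_integral_le_lintegral_enorm _).trans
    (setLIntegral_mono' measurableSet_Ioo fun _ hs => enorm_heatConv_le (sub_pos.2 hs.2) _ z)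

theorem IsWeakHeatSolution.ae_eq_heatConv_add {T R : ℝ} {v : E → ℝ → ℝ} {U h : E × ℝ → ℝ}
    (H : IsWeakHeatSolution T R v U h) {t : ℝ} (ht : t ∈ Ioo 0 T) :
    ∀ᵐ z, v z t = heatConv t (fun x => v x 0) z
      + ∫ s in Ioo 0 t, heatConv (t - s) (fun x => h (x, s)) z := by
  filter_upwards [H.duhamel 0 ht] with z hz
  simpa using hz

end HeatPotential

/-! ### L¹ closeness of the solution to its datum. -/

section L1Bound
set_option linter.unusedSectionVars false

/-- Both wells are zeros of f, so f(w) = 2w(w + σ)(w − σ) for either sign, with cofactor at most 4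
on [−1, 1]. This makes the reaction linearly small in the distance to the datum, closing the
Grönwall argument. -/
theorem abs_wellForce_le_mul_abs_sub {w σ : ℝ} (hw : |w| ≤ 1) (hσ : σ = 1 ∨ σ = -1) :
    |wellForce w| ≤ 4 * |w - σ| := by
  have h := abs_le.1 hw
  have e : wellForce w = (2 * w * (w + σ)) * (w - σ) := by
    rcases hσ with rfl | rfl <;> (unfold wellForce; ring)
  rw [e, abs_mul]
  refine mul_le_mul_of_nonneg_right ?_ (abs_nonneg _)
  have h1 : |w + σ| ≤ 2 := by
    rw [abs_le]; rcases hσ with rfl | rfl <;> constructor <;> linarith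
  rw [abs_mul, abs_mul, abs_two]
  nlinarith [abs_nonneg w, abs_nonneg (w + σ)]

variable {d : ℕ} {ε : ℝ} {u₀ : EuclideanSpace ℝ (Fin d) → ℝ} {u : EuclideanSpace ℝ (Fin d) → ℝ → ℝ}

/-- While `s < t < ε²`, a solution stays as close in `L¹` to its two-valued initial datum as the
heat flow does, up to a constant factor. -/
theorem IsAllenCahnSolution.ae_lintegral_enorm_sub_le (hε : ε ∈ Ioo (0 : ℝ) 1)
    (hu : IsAllenCahnSolution ε u₀ u) (hu₀m : Measurable u₀) (hu₀ : ∀ x, u₀ x = 1 ∨ u₀ x = -1)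
    {U : EuclideanSpace ℝ (Fin d) × ℝ → ℝ} (hU : Measurable U) (hU1 : ∀ z, |U z| ≤ 1)
    (hUu : ∀ᵐ z ∂volume.restrict ((univ : Set (EuclideanSpace ℝ (Fin d))) ×ˢ Ioo (0 : ℝ) 1),
      u z.1 z.2 = U z) {t D : ℝ} (ht : t ∈ Ioo 0 (ε ^ 2)) (hD : 0 ≤ D)
    (hheat : ∀ s ∈ Ioo 0 t, ∫⁻ z, ‖heatConv s u₀ z - u₀ z‖ₑ ≤ ENNReal.ofReal D) :
    ∀ᵐ s ∂volume.restrict (Ioo 0 t), ∫⁻ x, ‖U (x, s) - u₀ x‖ₑ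
      ≤ ENNReal.ofReal (2 * D * Real.exp (8 * ((2 : ℝ) ^ (d / 2 : ℝ) * Real.exp 2))) := by
  have H := hu.isWeakHeatSolution hU hU1 hUu
  have ht1 : t ≤ 1 := ht.2.le.trans (pow_le_one₀ hε.1.le hε.2.le)
  have hε2 : 0 < ε ^ 2 := pow_pos hε.1 2
  -- The rate K = 4/ε² is large, but it acts for a time s < ε² only, so the Grönwall exponent is at
  -- most 8c whatever ε is.
  have hkey := ae_lintegral_le_of_le_add_heatPotential (b := fun q => ‖U q - u₀ q.1‖ₑ)
    (g := fun s z => ‖heatConv s u₀ z - u₀ z‖ₑ) (N := 2) (D := D) (K := 1 / ε ^ 2 * 4) (t₁ := t)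
    (hU.sub (hu₀m.comp measurable_fst)).enorm (by norm_num) ?_ hD (by positivity) ht1 hheat ?_
  · filter_upwards [hkey, ae_restrict_mem measurableSet_Ioo] with s hs hsI
    refine hs.trans (ENNReal.ofReal_le_ofReal ?_)
    rw [finrank_euclideanSpace_fin]
    refine mul_le_mul_of_nonneg_left (Real.exp_le_exp.2 ?_) (by positivity)
    set c : ℝ := (2 : ℝ) ^ (d / 2 : ℝ) * Real.exp 2
    have hc : 0 < c := by positivity
    have h1 : s / ε ^ 2 ≤ 1 := by
      rw [div_le_one hε2]; exact hsI.2.le.trans ht.2.le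
    have e : 2 * (1 / ε ^ 2 * 4 * c) * s = 8 * c * (s / ε ^ 2) := by ring
    rw [e]
    nlinarith
  · intro q
    rw [← ofReal_norm]
    refine ENNReal.ofReal_le_ofReal ?_
    have h1 : ‖u₀ q.1‖ = 1 := by rcases hu₀ q.1 with h | h <;> simp [h]
    have h2 : ‖U q‖ ≤ 1 := hU1 q
    linarith [norm_sub_le (U q) (u₀ q.1)]
  · have hae : ∀ᵐ s ∂volume.restrict (Ioo 0 t), ∀ᵐ x, u x s = U (x, s) :=
      ae_restrict_of_ae_restrict_of_subset (Ioo_subset_Ioo_right ht1) H.ae_eq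
    filter_upwards [hae, ae_restrict_mem measurableSet_Ioo] with s hs hsI
    filter_upwards [hs, H.ae_eq_heatConv_add (Ioo_subset_Ioo_right ht1 hsI)] with z hz hduh
    rw [heatConv_congr_ae hu.initial, hz] at hduh
    have e : U (z, s) - u₀ z = (heatConv s u₀ z - u₀ z) + ∫ r in Ioo 0 s,
        heatConv (s - r) (fun x => -(1 / ε ^ 2 * wellForce (U (x, r)))) z := by
      rw [hduh]; ring
    simp only
    rw [e]
    refine (enorm_add_le _ _).trans (add_le_add_right ?_ _)
    refine (enorm_integral_heatConv_le (fun q => -(1 / ε ^ 2 * wellForce (U q))) s z).trans ?_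
    rw [← lintegral_const_mul' _ _ ENNReal.ofReal_ne_top]
    refine lintegral_mono fun r => ?_
    rw [← lintegral_const_mul' _ _ ENNReal.ofReal_ne_top]
    refine lintegral_mono fun x => ?_
    rw [mul_left_comm]
    refine mul_le_mul_right ?_ _
    rw [← ofReal_norm, ← ofReal_norm, ← ENNReal.ofReal_mul (by positivity),
      norm_neg, norm_mul, Real.norm_of_nonneg (by positivity : 0 ≤ 1 / ε ^ 2), mul_assoc]
    exact ENNReal.ofReal_le_ofReal (mul_le_mul_of_nonneg_left
      (abs_wellForce_le_mul_abs_sub (hU1 _) (hu₀ x)) (by positivity))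

end L1Bound

/-! ### Gradients of the heat flow and of heat potentials. -/

section Gradient
open Filter Topology
set_option linter.unusedSectionVars false

variable {E : Type*} [NormedAddCommGroup E] [InnerProductSpace ℝ E] [FiniteDimensional ℝ E]
  [MeasurableSpace E] [BorelSpace E]

/-- The differential `(D p_τ) * g` of the heat semigroup. -/
noncomputable def heatConvGrad (τ : ℝ) (g : E → ℝ) (z : E) : E →L[ℝ] ℝ :=
  ∫ x, g x • fderiv ℝ (heatKernel τ : E → ℝ) (z - x)

theorem heatKernel_le_zero {τ : ℝ} (hτ : 0 < τ) (x : E) : heatKernel τ x ≤ heatKernel τ (0 : E) := by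
  unfold heatKernel
  refine mul_le_mul_of_nonneg_left (Real.exp_le_exp.2 ?_) (by positivity)
  rw [norm_zero]
  have : 0 ≤ ‖x‖ ^ 2 / (4 * τ) := by positivity
  simp only [neg_div]
  simpa using this

theorem exists_norm_fderiv_heatKernel_le {τ : ℝ} (hτ : 0 < τ) :
    ∃ M : ℝ, ∀ x : E, ‖fderiv ℝ (heatKernel τ : E → ℝ) x‖ ≤ M := by
  refine ⟨((2 : ℝ) ^ (Module.finrank ℝ E / 2 : ℝ) * Real.exp 2) * τ ^ (-(1 / 2) : ℝ)
    * heatKernel (2 * τ) (0 : E), fun x => (norm_fderiv_heatKernel_le hτ x).trans ?_⟩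
  refine mul_le_mul_of_nonneg_left ?_ (by positivity)
  exact heatKernel_le_zero (by positivity) _

theorem hasFDerivAt_heatConv {τ : ℝ} (hτ : 0 < τ) {g : E → ℝ} (hg : Integrable g) (z : E) :
    HasFDerivAt (heatConv τ g) (heatConvGrad τ g z) z := by
  obtain ⟨M, hM⟩ := exists_norm_fderiv_heatKernel_le (E := E) hτ
  refine hasFDerivAt_integral_of_dominated_of_fderiv_le (s := univ) (bound := fun x => |g x| * M)
    (F' := fun z x => g x • fderiv ℝ (heatKernel τ : E → ℝ) (z - x)) univ_mem ?_ ?_ ?_ ?_ ?_ ?_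
  · exact Eventually.of_forall fun z => (((continuous_heatKernel τ).comp
      (continuous_const.sub continuous_id)).aestronglyMeasurable).mul hg.1
  · refine Integrable.bdd_mul (c := heatKernel τ (0 : E)) hg
      ((continuous_heatKernel τ).comp (continuous_const.sub continuous_id)).aestronglyMeasurable
      (ae_of_all _ fun x => ?_)
    rw [Real.norm_of_nonneg (heatKernel_pos hτ _).le]
    exact heatKernel_le_zero hτ _
  · exact hg.1.smul ((continuous_fderiv_heatKernel τ).comp
      (continuous_const.sub continuous_id)).aestronglyMeasurable
  · refine ae_of_all _ fun x z _ => ?_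
    rw [norm_smul, Real.norm_eq_abs]
    exact mul_le_mul_of_nonneg_left (hM _) (abs_nonneg _)
  · exact hg.abs.mul_const M
  · refine ae_of_all _ fun x z _ => ?_
    have h := (((contDiff_heatKernel (E := E) (k := 1) τ).differentiable one_ne_zero
      (z - x)).hasFDerivAt.comp z ((hasFDerivAt_id z).sub_const x)).mul_const (g x)
    simpa using h

theorem continuous_heatConvGrad {τ : ℝ} (hτ : 0 < τ) {g : E → ℝ} (hg : Integrable g) :
    Continuous (heatConvGrad τ g) := by
  obtain ⟨M, hM⟩ := exists_norm_fderiv_heatKernel_le (E := E) hτ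
  refine continuous_of_dominated (bound := fun x => |g x| * M) (fun z => ?_) (fun z => ?_)
    (hg.abs.mul_const M) (ae_of_all _ fun x => ?_)
  · exact hg.1.smul ((continuous_fderiv_heatKernel τ).comp
      (continuous_const.sub continuous_id)).aestronglyMeasurable
  · refine ae_of_all _ fun x => ?_
    rw [norm_smul, Real.norm_eq_abs]
    exact mul_le_mul_of_nonneg_left (hM _) (abs_nonneg _)
  · exact ((continuous_fderiv_heatKernel τ).comp
      (continuous_id.sub (continuous_const (y := x)))).const_smul (g x)

theorem enorm_heatConvGrad_le {τ : ℝ} (hτ : 0 < τ) (g : E → ℝ) (z : E) :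
    ‖heatConvGrad τ g z‖ₑ ≤ ∫⁻ x, ENNReal.ofReal
      (((2 : ℝ) ^ (Module.finrank ℝ E / 2 : ℝ) * Real.exp 2) * τ ^ (-(1 / 2) : ℝ)
        * heatKernel (2 * τ) (z - x)) * ‖g x‖ₑ := by
  refine (enorm_integral_le_lintegral_enorm _).trans (lintegral_mono fun x => ?_)
  rw [enorm_smul, mul_comm]
  refine mul_le_mul_left ?_ _
  rw [← ofReal_norm]
  exact ENNReal.ofReal_le_ofReal (norm_fderiv_heatKernel_le hτ _)

theorem norm_heatConvGrad_le {τ : ℝ} (hτ : 0 < τ) {g : E → ℝ} {R : ℝ} (hR : ∀ x, |g x| ≤ R)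
    (z : E) : ‖heatConvGrad τ g z‖
      ≤ ((2 : ℝ) ^ (Module.finrank ℝ E / 2 : ℝ) * Real.exp 2) * τ ^ (-(1 / 2) : ℝ) * R := by
  set c : ℝ := ((2 : ℝ) ^ (Module.finrank ℝ E / 2 : ℝ) * Real.exp 2) * τ ^ (-(1 / 2) : ℝ) with hc
  have h2 : 0 < 2 * τ := by positivity
  have hc0 : 0 ≤ c := by positivity
  have h := norm_integral_le_of_norm_le
    (f := fun x => g x • fderiv ℝ (heatKernel τ : E → ℝ) (z - x))
    (((integrable_heatKernel_sub h2 z).const_mul c).mul_const R) (ae_of_all _ fun x => by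
      rw [norm_smul, mul_comm]
      exact mul_le_mul (norm_fderiv_heatKernel_le hτ _) (hR x) (norm_nonneg _)
        (mul_nonneg hc0 (heatKernel_pos h2 _).le))
  rwa [integral_mul_const, integral_const_mul, integral_heatKernel_sub h2, mul_one] at h

theorem integrable_fderiv_heatKernel {τ : ℝ} (hτ : 0 < τ) :
    Integrable (fderiv ℝ (heatKernel τ : E → ℝ)) :=
  Integrable.mono' ((integrable_heatKernel (show 0 < 2 * τ by positivity)).const_mul _)
    (continuous_fderiv_heatKernel τ).aestronglyMeasurable
    (ae_of_all _ fun x => norm_fderiv_heatKernel_le hτ x)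

/-- The differential of an even function is odd. -/
theorem integral_fderiv_heatKernel (τ : ℝ) :
    ∫ x, fderiv ℝ (heatKernel τ : E → ℝ) x = 0 := by
  have h : ∫ x, fderiv ℝ (heatKernel τ : E → ℝ) x = -∫ x, fderiv ℝ (heatKernel τ : E → ℝ) x := by
    rw [← integral_neg, ← integral_neg_eq_self]
    simp only [fderiv_heatKernel_neg]
  ext v
  have hv := DFunLike.congr_fun h v
  rw [neg_apply] at hv
  rw [zero_apply]
  linarith

/-- The gradient kernel has mean zero. Taking c = −g(z) produces the increments g(z − y) − g(z), and
c = 1 replaces the phase datum, equal to −1 far away, by an integrable function. -/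
theorem heatConvGrad_add_const {τ : ℝ} (hτ : 0 < τ) {g : E → ℝ} {R : ℝ} (hg : Measurable g)
    (hR : ∀ x, |g x| ≤ R) (c : ℝ) (z : E) :
    heatConvGrad τ (fun x => g x + c) z = heatConvGrad τ g z := by
  have hi : Integrable fun x => fderiv ℝ (heatKernel τ : E → ℝ) (z - x) :=
    (integrable_fderiv_heatKernel hτ).comp_sub_left z
  have h1 : Integrable fun x => g x • fderiv ℝ (heatKernel τ : E → ℝ) (z - x) :=
    hi.bdd_smul R hg.aestronglyMeasurable (ae_of_all _ hR)
  have h2 : Integrable fun x => c • fderiv ℝ (heatKernel τ : E → ℝ) (z - x) := hi.smul c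
  unfold heatConvGrad
  simp only [add_smul]
  rw [integral_add h1 h2, integral_smul, integral_sub_left_eq_self (fun x => fderiv ℝ (heatKernel τ : E → ℝ) x) volume z,
    integral_fderiv_heatKernel, smul_zero, add_zero]

/-- With g(z) subtracted, the Gaussian bound for the gradient kernel leaves the averaged translation
modulus at time 2τ, at the price of a single factor τ^(−1/2). -/
theorem lintegral_enorm_heatConvGrad_le {τ : ℝ} (hτ : 0 < τ) {g : E → ℝ} {R : ℝ}
    (hg : Measurable g) (hR : ∀ x, |g x| ≤ R) :
    ∫⁻ z, ‖heatConvGrad τ g z‖ₑ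
      ≤ ENNReal.ofReal (((2 : ℝ) ^ (Module.finrank ℝ E / 2 : ℝ) * Real.exp 2)
          * τ ^ (-(1 / 2) : ℝ))
        * ∫⁻ y, ENNReal.ofReal (heatKernel (2 * τ) y) * ∫⁻ z, ‖g (z - y) - g z‖ₑ := by
  set c : ℝ := ((2 : ℝ) ^ (Module.finrank ℝ E / 2 : ℝ) * Real.exp 2) * τ ^ (-(1 / 2) : ℝ) with hc
  have hc0 : 0 ≤ c := by positivity
  have h1 : ∀ z, ‖heatConvGrad τ g z‖ₑ ≤ ENNReal.ofReal c *
      ∫⁻ y, ENNReal.ofReal (heatKernel (2 * τ) y) * ‖g (z - y) - g z‖ₑ := by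
    intro z
    rw [← heatConvGrad_add_const hτ hg hR (-g z)]
    refine (enorm_heatConvGrad_le hτ _ z).trans ?_
    rw [← lintegral_sub_left_eq_self _ z, ← lintegral_const_mul' _ _ ENNReal.ofReal_ne_top]
    refine le_of_eq (lintegral_congr fun y => ?_)
    rw [sub_sub_cancel, ENNReal.ofReal_mul hc0, mul_assoc, sub_eq_add_neg (g _)]
  have hm : Measurable fun q : E × E =>
      ENNReal.ofReal (heatKernel (2 * τ) q.2) * ‖g (q.1 - q.2) - g q.1‖ₑ :=
    ((continuous_heatKernel _).measurable.comp measurable_snd).ennreal_ofReal.mul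
      ((hg.comp (measurable_fst.sub measurable_snd)).sub (hg.comp measurable_fst)).enorm
  refine (lintegral_mono h1).trans ?_
  rw [lintegral_const_mul' _ _ ENNReal.ofReal_ne_top, lintegral_lintegral_swap hm.aemeasurable]
  refine le_of_eq (congrArg _ (lintegral_congr fun y => ?_))
  rw [lintegral_const_mul]
  exact ((hg.comp (measurable_id.sub measurable_const)).sub hg).enorm

theorem stronglyMeasurable_heatConvGrad_time {h : E × ℝ → ℝ} (hh : Measurable h) (t : ℝ) (z : E) :
    StronglyMeasurable fun s : ℝ => heatConvGrad (t - s) (fun x => h (x, s)) z := by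
  refine StronglyMeasurable.integral_prod_right (f := fun (s : ℝ) (x : E) =>
    h (x, s) • fderiv ℝ (heatKernel (t - s) : E → ℝ) (z - x)) ?_
  refine Measurable.stronglyMeasurable ?_
  simp only [fderiv_heatKernel]
  have h1 : Measurable fun q : ℝ × E => heatKernel (t - q.1) (z - q.2) :=
    measurable_heatKernel_uncurry.comp
      (show Measurable fun q : ℝ × E => (z - q.2, t - q.1) by fun_prop)
  have h2 : Measurable fun q : ℝ × E => (innerSL ℝ (z - q.2) : E →L[ℝ] ℝ) :=
    ((innerSL ℝ (E := E)).continuous.comp (by fun_prop : Continuous fun q : ℝ × E => z - q.2)).measurable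
  exact (hh.comp (by fun_prop : Measurable fun q : ℝ × E => (q.2, q.1))).smul
    ((h1.div (by fun_prop)).neg.smul h2)

/-- The gradient kernel is singular at s = t, but integrably so. This permits differentiating the
heat potential under the time integral and gains a factor √t. -/
theorem integrableOn_sub_rpow_neg_half {t : ℝ} (ht : 0 < t) :
    IntegrableOn (fun s => (t - s) ^ (-(1 / 2) : ℝ)) (Ioo 0 t) ∧
      ∫ s in Ioo 0 t, (t - s) ^ (-(1 / 2) : ℝ) = 2 * t ^ (1 / 2 : ℝ) := by
  have h1 : IntervalIntegrable (fun x : ℝ => x ^ (-(1 / 2) : ℝ)) volume 0 t :=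
    intervalIntegral.intervalIntegrable_rpow' (by norm_num)
  have h2 := h1.comp_sub_left t
  rw [sub_zero, sub_self] at h2
  refine ⟨((intervalIntegrable_iff_integrableOn_Ioo_of_le ht.le).1 h2.symm), ?_⟩
  rw [← integral_Ioc_eq_integral_Ioo, ← intervalIntegral.integral_of_le ht.le,
    intervalIntegral.integral_comp_sub_left (fun x : ℝ => x ^ (-(1 / 2) : ℝ)), sub_self, sub_zero,
    integral_rpow (Or.inl (by norm_num))]
  rw [Real.zero_rpow (by norm_num), show (-(1 / 2) + 1 : ℝ) = 1 / 2 by norm_num]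
  ring

/-- The differential of the heat potential of a source. -/
noncomputable def heatPotentialGrad (t : ℝ) (h : E × ℝ → ℝ) (z : E) : E →L[ℝ] ℝ :=
  ∫ s in Ioo 0 t, heatConvGrad (t - s) (fun x => h (x, s)) z

variable {h : E × ℝ → ℝ} {R t : ℝ}

theorem norm_heatPotentialGrad_le (ht : 0 < t) (hR : ∀ q, |h q| ≤ R) (z : E) :
    ‖heatPotentialGrad t h z‖
      ≤ ((2 : ℝ) ^ (Module.finrank ℝ E / 2 : ℝ) * Real.exp 2) * (2 * t ^ (1 / 2 : ℝ)) * R := by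
  obtain ⟨hi, he⟩ := integrableOn_sub_rpow_neg_half ht
  have h := norm_integral_le_of_norm_le
    (f := fun s => heatConvGrad (t - s) (fun x => h (x, s)) z)
    ((hi.const_mul ((2 : ℝ) ^ (Module.finrank ℝ E / 2 : ℝ) * Real.exp 2)).mul_const R) (by
      filter_upwards [ae_restrict_mem measurableSet_Ioo] with s hs
      exact norm_heatConvGrad_le (sub_pos.2 hs.2) (fun x => hR _) z)
  rwa [integral_mul_const, integral_const_mul, he] at h

theorem lintegral_enorm_heatPotentialGrad_le (ht : 0 < t) (hh : Measurable h) {B : ℝ} (hB : 0 ≤ B)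
    (hhB : ∀ᵐ s ∂volume.restrict (Ioo 0 t), ∫⁻ x, ‖h (x, s)‖ₑ ≤ ENNReal.ofReal B) :
    ∫⁻ z, ‖heatPotentialGrad t h z‖ₑ ≤ ENNReal.ofReal
      (((2 : ℝ) ^ (Module.finrank ℝ E / 2 : ℝ) * Real.exp 2) * (2 * t ^ (1 / 2 : ℝ)) * B) := by
  obtain ⟨hi, he⟩ := integrableOn_sub_rpow_neg_half ht
  set c : ℝ := (2 : ℝ) ^ (Module.finrank ℝ E / 2 : ℝ) * Real.exp 2 with hc
  have hk : Measurable fun q : E × ℝ => ENNReal.ofReal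
      (c * q.2 ^ (-(1 / 2) : ℝ) * heatKernel (2 * q.2) q.1) := by
    have : Measurable fun q : E × ℝ => heatKernel (2 * q.2) q.1 :=
      measurable_heatKernel_uncurry.comp
        (show Measurable fun q : E × ℝ => (q.1, 2 * q.2) by fun_prop)
    exact (((measurable_snd.pow_const _).const_mul c).mul this).ennreal_ofReal
  have h0 : 0 ≤ᵐ[volume.restrict (Ioo 0 t)] fun s => c * (t - s) ^ (-(1 / 2) : ℝ) * B := by
    filter_upwards [ae_restrict_mem measurableSet_Ioo] with s hs
    have := sub_pos.2 hs.2
    positivity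
  calc ∫⁻ z, ‖heatPotentialGrad t h z‖ₑ
      ≤ ∫⁻ z, 1 * ∫⁻ s in Ioo 0 t, ∫⁻ x, ENNReal.ofReal
          (c * (t - s) ^ (-(1 / 2) : ℝ) * heatKernel (2 * (t - s)) (z - x)) * ‖h (x, s)‖ₑ := by
        refine lintegral_mono fun z => ?_
        rw [one_mul]
        exact (enorm_integral_le_lintegral_enorm _).trans
          (setLIntegral_mono' measurableSet_Ioo fun s hs =>
            enorm_heatConvGrad_le (sub_pos.2 hs.2) _ z)
    _ ≤ ∫⁻ s in Ioo 0 t, ENNReal.ofReal (c * (t - s) ^ (-(1 / 2) : ℝ)) * ∫⁻ x, 1 * ‖h (x, s)‖ₑ := by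
        refine lintegral_mul_potential_le (ρ := fun _ => 1)
          (k := fun q => ENNReal.ofReal (c * q.2 ^ (-(1 / 2) : ℝ) * heatKernel (2 * q.2) q.1))
          (b := fun q => ‖h q‖ₑ) (c := fun τ => ENNReal.ofReal (c * τ ^ (-(1 / 2) : ℝ)))
          measurable_const hk hh.enorm fun τ hτ x => ?_
        have hτ0 := hτ.1
        simp only [one_mul, mul_one]
        rw [lintegral_sub_right_eq_self (fun z => ENNReal.ofReal
          (c * τ ^ (-(1 / 2) : ℝ) * heatKernel (2 * τ) z)) x]
        simp only [ENNReal.ofReal_mul (show 0 ≤ c * τ ^ (-(1 / 2) : ℝ) by positivity)]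
        rw [lintegral_const_mul' _ _ ENNReal.ofReal_ne_top, lintegral_heatKernel (by positivity),
          mul_one]
    _ ≤ ∫⁻ s in Ioo 0 t, ENNReal.ofReal (c * (t - s) ^ (-(1 / 2) : ℝ) * B) := by
        refine lintegral_mono_ae ?_
        filter_upwards [hhB, ae_restrict_mem measurableSet_Ioo] with s hs hsI
        have := sub_pos.2 hsI.2
        rw [ENNReal.ofReal_mul (show 0 ≤ c * (t - s) ^ (-(1 / 2) : ℝ) by positivity)]
        simp only [one_mul]
        exact mul_le_mul_right hs _
    _ = _ := by
        rw [← ofReal_integral_eq_lintegral_ofReal ((hi.const_mul c).mul_const B) h0,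
          integral_mul_const, integral_const_mul, he]

theorem integrable_of_lintegral_enorm_le {g : E → ℝ} (hg : Measurable g) {B : ℝ}
    (h : ∫⁻ x, ‖g x‖ₑ ≤ ENNReal.ofReal B) : Integrable g :=
  ⟨hg.aestronglyMeasurable, h.trans_lt ENNReal.ofReal_lt_top⟩

theorem hasFDerivAt_heatPotential (ht : 0 < t) (hh : Measurable h) (hR : ∀ q, |h q| ≤ R)
    (hi : ∀ᵐ s ∂volume.restrict (Ioo 0 t), Integrable fun x => h (x, s)) (z : E) :
    HasFDerivAt (fun z => ∫ s in Ioo 0 t, heatConv (t - s) (fun x => h (x, s)) z)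
      (heatPotentialGrad t h z) z := by
  have hint := (integrableOn_sub_rpow_neg_half ht).1
  refine hasFDerivAt_integral_of_dominated_of_fderiv_le (s := univ)
    (bound := fun s => ((2 : ℝ) ^ (Module.finrank ℝ E / 2 : ℝ) * Real.exp 2)
      * (t - s) ^ (-(1 / 2) : ℝ) * R)
    (F' := fun z s => heatConvGrad (t - s) (fun x => h (x, s)) z) univ_mem ?_ ?_ ?_ ?_ ?_ ?_
  · exact Eventually.of_forall fun z => (measurable_heatConv_time hh t z).aestronglyMeasurable
  · refine Integrable.mono' (g := fun _ => R) (integrableOn_const measure_Ioo_lt_top.ne)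
      (measurable_heatConv_time hh t z).aestronglyMeasurable ?_
    filter_upwards [ae_restrict_mem measurableSet_Ioo] with s hs
    exact abs_heatConv_le (sub_pos.2 hs.2) z (ae_of_all _ fun x => hR _)
  · exact (stronglyMeasurable_heatConvGrad_time hh t z).aestronglyMeasurable
  · filter_upwards [ae_restrict_mem measurableSet_Ioo] with s hs z _
    exact norm_heatConvGrad_le (sub_pos.2 hs.2) (fun x => hR _) z
  · exact (hint.const_mul _).mul_const R
  · filter_upwards [hi, ae_restrict_mem measurableSet_Ioo] with s hs hsI z _
    exact hasFDerivAt_heatConv (sub_pos.2 hsI.2) hs z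

theorem continuous_heatPotentialGrad (ht : 0 < t) (hh : Measurable h) (hR : ∀ q, |h q| ≤ R)
    (hi : ∀ᵐ s ∂volume.restrict (Ioo 0 t), Integrable fun x => h (x, s)) :
    Continuous (heatPotentialGrad t h) := by
  have hint := (integrableOn_sub_rpow_neg_half ht).1
  refine continuous_of_dominated
    (bound := fun s => ((2 : ℝ) ^ (Module.finrank ℝ E / 2 : ℝ) * Real.exp 2)
      * (t - s) ^ (-(1 / 2) : ℝ) * R)
    (fun z => (stronglyMeasurable_heatConvGrad_time hh t z).aestronglyMeasurable) (fun z => ?_)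
    ((hint.const_mul _).mul_const R) ?_
  · filter_upwards [ae_restrict_mem measurableSet_Ioo] with s hs
    exact norm_heatConvGrad_le (sub_pos.2 hs.2) (fun x => hR _) z
  · filter_upwards [hi, ae_restrict_mem measurableSet_Ioo] with s hs hsI
    exact continuous_heatConvGrad (sub_pos.2 hsI.2) hs

theorem lintegral_enorm_heatPotential_le (ht : 0 < t) (hh : Measurable h) {B : ℝ}
    (hhB : ∀ᵐ s ∂volume.restrict (Ioo 0 t), ∫⁻ x, ‖h (x, s)‖ₑ ≤ ENNReal.ofReal B) :
    ∫⁻ z, ‖∫ s in Ioo 0 t, heatConv (t - s) (fun x => h (x, s)) z‖ₑ ≤ ENNReal.ofReal (t * B) := by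
  calc _ ≤ ∫⁻ z, 1 * ∫⁻ s in Ioo 0 t, ∫⁻ x, ENNReal.ofReal (heatKernel (t - s) (z - x))
          * ‖h (x, s)‖ₑ := by
        refine lintegral_mono fun z => ?_
        rw [one_mul]
        exact enorm_integral_heatConv_le h t z
    _ ≤ ∫⁻ s in Ioo 0 t, 1 * ∫⁻ x, 1 * ‖h (x, s)‖ₑ := by
        refine lintegral_mul_potential_le (ρ := fun _ => 1)
          (k := fun q => ENNReal.ofReal (heatKernel q.2 q.1)) (b := fun q => ‖h q‖ₑ)
          (c := fun _ => 1) measurable_const measurable_heatKernel_uncurry.ennreal_ofReal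
          hh.enorm fun τ hτ x => ?_
        simp only [one_mul, mul_one]
        rw [lintegral_sub_right_eq_self (fun z => ENNReal.ofReal (heatKernel τ z)) x,
          lintegral_heatKernel hτ.1]
    _ ≤ ∫⁻ s in Ioo 0 t, ENNReal.ofReal B := by
        refine lintegral_mono_ae ?_
        filter_upwards [hhB] with s hs
        simpa only [one_mul] using hs
    _ = _ := by
        rw [setLIntegral_const, Real.volume_Ioo, sub_zero, ENNReal.ofReal_mul ht.le, mul_comm]

theorem abs_heatPotential_le (ht : 0 < t) (hR : ∀ q, |h q| ≤ R) (z : E) :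
    |∫ s in Ioo 0 t, heatConv (t - s) (fun x => h (x, s)) z| ≤ t * R := by
  have := norm_setIntegral_le_of_norm_le_const (μ := volume) (s := Ioo 0 t) (C := R)
    (f := fun s => heatConv (t - s) (fun x => h (x, s)) z) measure_Ioo_lt_top
    fun s hs => abs_heatConv_le (sub_pos.2 hs.2) z (ae_of_all _ fun x => hR _)
  rw [Real.volume_real_Ioo_of_le ht.le, sub_zero, mul_comm] at this
  exact this

end Gradient

/-! ### Bounds for the heat flow plus a source. -/

section FlowBounds
set_option linter.unusedSectionVars false

variable {E : Type*} [NormedAddCommGroup E] [InnerProductSpace ℝ E] [FiniteDimensional ℝ E]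
  [MeasurableSpace E] [BorelSpace E] {t : ℝ} {g : E → ℝ} {h : E × ℝ → ℝ}

theorem hasFDerivAt_heatConv_of_integrable_add_const (ht : 0 < t) (hg : Measurable g)
    (hg1 : ∀ x, |g x| ≤ 1) (hgi : Integrable fun x => g x + 1) (z : E) :
    HasFDerivAt (heatConv t g) (heatConvGrad t g z) z := by
  have h1 := hasFDerivAt_heatConv ht hgi z
  rw [heatConvGrad_add_const ht hg hg1] at h1
  have h2 : heatConv t g = fun z => heatConv t (fun x => g x + 1) z - 1 := funext fun z => by
    have := heatConv_add_const_mul ht hg (measurable_const (a := (1 : ℝ))) hg1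
      (fun _ => abs_one.le) 1 z
    simp only [one_mul] at this
    rw [this, heatConv_const ht, add_sub_cancel_right]
  rw [h2]
  exact h1.sub_const 1

theorem continuous_heatConvGrad_of_integrable_add_const (ht : 0 < t) (hg : Measurable g)
    (hg1 : ∀ x, |g x| ≤ 1) (hgi : Integrable fun x => g x + 1) :
    Continuous (heatConvGrad t g) := by
  have h1 := continuous_heatConvGrad ht hgi
  rwa [funext (heatConvGrad_add_const ht hg hg1 1)] at h1

variable {k D B : ℝ}

/-- Here k stands for the sup bound 4/ε² of the source and t·k ≤ 4 for t ≤ ε²: in this range the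
source contributes no more to the gradient than a multiple of the initial term t^(−1/2). -/
theorem rpow_half_mul_le (ht : 0 < t) (hkt : t * k ≤ 4) :
    t ^ (1 / 2 : ℝ) * k ≤ 4 * t ^ (-(1 / 2) : ℝ) := by
  have : t ^ (1 / 2 : ℝ) = t * t ^ (-(1 / 2) : ℝ) := by
    rw [← Real.rpow_one_add' ht.le (by norm_num)]
    norm_num
  rw [this, mul_right_comm]
  exact mul_le_mul_of_nonneg_right hkt (by positivity)

/-- The 9 is 1 from the initial datum plus 2·4 from the source. -/
theorem norm_heatConvGrad_add_le (ht : 0 < t) (hg1 : ∀ x, |g x| ≤ 1) (hhk : ∀ q, |h q| ≤ k)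
    (hkt : t * k ≤ 4) (z : E) : ‖heatConvGrad t g z + heatPotentialGrad t h z‖
      ≤ 9 * ((2 : ℝ) ^ (Module.finrank ℝ E / 2 : ℝ) * Real.exp 2) * t ^ (-(1 / 2) : ℝ) := by
  have h1 := norm_heatConvGrad_le ht hg1 z
  have h2 := norm_heatPotentialGrad_le ht hhk z
  have hrt := rpow_half_mul_le ht hkt
  set c : ℝ := (2 : ℝ) ^ (Module.finrank ℝ E / 2 : ℝ) * Real.exp 2
  have hc : 0 < c := by positivity
  have h3 : c * (2 * t ^ (1 / 2 : ℝ)) * k ≤ 2 * c * (4 * t ^ (-(1 / 2) : ℝ)) := by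
    rw [show c * (2 * t ^ (1 / 2 : ℝ)) * k = 2 * c * (t ^ (1 / 2 : ℝ) * k) by ring]
    exact mul_le_mul_of_nonneg_left hrt (by positivity)
  refine (norm_add_le _ _).trans ?_
  linarith

theorem lintegral_enorm_heatConvGrad_add_le (ht : 0 < t) (hg : Measurable g)
    (hg1 : ∀ x, |g x| ≤ 1) (hgc : Continuous (heatConvGrad t g)) (hD : 0 ≤ D)
    (hmod : ∫⁻ y, ENNReal.ofReal (heatKernel (2 * t) y) * ∫⁻ z, ‖g (z - y) - g z‖ₑ
      ≤ ENNReal.ofReal D) (hh : Measurable h) (hk : 0 ≤ k) (hkt : t * k ≤ 4) (hB : 0 ≤ B)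
    (hhB : ∀ᵐ s ∂volume.restrict (Ioo 0 t), ∫⁻ x, ‖h (x, s)‖ₑ ≤ ENNReal.ofReal (k * B)) :
    ∫⁻ z, ‖heatConvGrad t g z + heatPotentialGrad t h z‖ₑ ≤ ENNReal.ofReal
      ((2 : ℝ) ^ (Module.finrank ℝ E / 2 : ℝ) * Real.exp 2 * t ^ (-(1 / 2) : ℝ) * (D + 8 * B)) := by
  have h1 := lintegral_enorm_heatConvGrad_le ht hg hg1
  have h2 := lintegral_enorm_heatPotentialGrad_le ht hh (by positivity) hhB
  have hrt := rpow_half_mul_le ht hkt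
  set c : ℝ := (2 : ℝ) ^ (Module.finrank ℝ E / 2 : ℝ) * Real.exp 2
  set r : ℝ := t ^ (-(1 / 2) : ℝ)
  have hr : 0 < r := by positivity
  have hc : 0 < c := by positivity
  calc ∫⁻ z, ‖heatConvGrad t g z + heatPotentialGrad t h z‖ₑ
      ≤ ∫⁻ z, (‖heatConvGrad t g z‖ₑ + ‖heatPotentialGrad t h z‖ₑ) :=
        lintegral_mono fun z => by
          rw [← ofReal_norm, ← ofReal_norm, ← ofReal_norm,
            ← ENNReal.ofReal_add (norm_nonneg _) (norm_nonneg _)]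
          exact ENNReal.ofReal_le_ofReal (norm_add_le _ _)
    _ = (∫⁻ z, ‖heatConvGrad t g z‖ₑ) + ∫⁻ z, ‖heatPotentialGrad t h z‖ₑ :=
        lintegral_add_left hgc.enorm.measurable _
    _ ≤ ENNReal.ofReal (c * r) * ENNReal.ofReal D
        + ENNReal.ofReal (c * (2 * t ^ (1 / 2 : ℝ)) * (k * B)) :=
        add_le_add (h1.trans (mul_le_mul_right hmod _)) h2
    _ ≤ _ := by
        rw [← ENNReal.ofReal_mul (by positivity), ← ENNReal.ofReal_add (by positivity)
          (by positivity)]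
        refine ENNReal.ofReal_le_ofReal ?_
        have h3 : c * (2 * t ^ (1 / 2 : ℝ)) * (k * B) ≤ 2 * c * B * (4 * r) := by
          rw [show c * (2 * t ^ (1 / 2 : ℝ)) * (k * B)
            = 2 * c * B * (t ^ (1 / 2 : ℝ) * k) by ring]
          exact mul_le_mul_of_nonneg_left hrt (by positivity)
        linarith

theorem lintegral_enorm_heatConv_add_sub_le (ht : 0 < t) (hg : Measurable g) (hD : 0 ≤ D)
    (hheat : ∫⁻ z, ‖heatConv t g z - g z‖ₑ ≤ ENNReal.ofReal D) (hh : Measurable h)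
    (hk : 0 ≤ k) (hkt : t * k ≤ 4) (hB : 0 ≤ B)
    (hhB : ∀ᵐ s ∂volume.restrict (Ioo 0 t), ∫⁻ x, ‖h (x, s)‖ₑ ≤ ENNReal.ofReal (k * B)) :
    ∫⁻ z, ‖heatConv t g z + (∫ s in Ioo 0 t, heatConv (t - s) (fun x => h (x, s)) z) - g z‖ₑ
      ≤ ENNReal.ofReal (D + 4 * B) := by
  calc _ ≤ ∫⁻ z, (‖heatConv t g z - g z‖ₑ
          + ‖∫ s in Ioo 0 t, heatConv (t - s) (fun x => h (x, s)) z‖ₑ) := by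
        refine lintegral_mono fun z => ?_
        rw [add_sub_right_comm]
        exact enorm_add_le _ _
    _ = (∫⁻ z, ‖heatConv t g z - g z‖ₑ)
          + ∫⁻ z, ‖∫ s in Ioo 0 t, heatConv (t - s) (fun x => h (x, s)) z‖ₑ :=
        lintegral_add_left ((measurable_heatConv hg t).sub hg).enorm _
    _ ≤ ENNReal.ofReal D + ENNReal.ofReal (t * (k * B)) :=
        add_le_add hheat (lintegral_enorm_heatPotential_le ht hh hhB)
    _ ≤ _ := by
        rw [← ENNReal.ofReal_add hD (by positivity)]
        refine ENNReal.ofReal_le_ofReal ?_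
        have := mul_le_mul_of_nonneg_right hkt hB
        linarith

end FlowBounds

/-! ### The energy bound for a given translation modulus. -/

section Energy
set_option linter.unusedSectionVars false

/-- The potential equals (w − σ)²(w + σ)²/2 and each factor is at most 6, so one factor |w − σ| is
kept and 6³/2 = 108 bounds the rest. -/
theorem wellPotential_le_mul_abs_sub {w σ : ℝ} (hw : |w| ≤ 5) (hσ : σ = 1 ∨ σ = -1) :
    wellPotential w ≤ 108 * |w - σ| := by
  have h := abs_le.1 hw
  have e : wellPotential w = |w - σ| * |w + σ| ^ 2 / 2 * |w - σ| := by
    have : wellPotential w = |w - σ| ^ 2 * |w + σ| ^ 2 / 2 := by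
      rw [sq_abs, sq_abs]
      rcases hσ with rfl | rfl <;> (unfold wellPotential; ring)
    rw [this]; ring
  have hσ5 : |w - σ| ≤ 6 ∧ |w + σ| ≤ 6 := by
    rw [abs_le, abs_le]
    rcases hσ with rfl | rfl <;> refine ⟨⟨?_, ?_⟩, ?_, ?_⟩ <;> linarith
  rw [e]
  refine mul_le_mul_of_nonneg_right ?_ (abs_nonneg _)
  have : |w - σ| * |w + σ| ^ 2 ≤ 6 * 6 ^ 2 := by
    gcongr
    · exact hσ5.1
    · exact hσ5.2
  linarith

variable {d : ℕ} {ε : ℝ} {u₀ : EuclideanSpace ℝ (Fin d) → ℝ} {u : EuclideanSpace ℝ (Fin d) → ℝ → ℝ}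

/-- An interpolation bound for the energy of a bounded function close to a two-valued one. -/
theorem allenCahnEnergy_le (hε : 0 < ε) (hu₀ : ∀ x, u₀ x = 1 ∨ u₀ x = -1)
    {v : EuclideanSpace ℝ (Fin d) → ℝ} (hv : Continuous (fderiv ℝ v)) (hv5 : ∀ x, |v x| ≤ 5)
    {a b m : ℝ} (ha : 0 ≤ a) (hb : 0 ≤ b) (hm : 0 ≤ m) (hsup : ∀ z, ‖fderiv ℝ v z‖ ≤ a)
    (hint : ∫⁻ z, ‖fderiv ℝ v z‖ₑ ≤ ENNReal.ofReal b)
    (hdist : ∫⁻ z, ‖v z - u₀ z‖ₑ ≤ ENNReal.ofReal m) :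
    allenCahnEnergy ε v ≤ ENNReal.ofReal (ε * a / 2 * b + 108 / ε * m) := by
  have hpt : ∀ z, ENNReal.ofReal (ε * ‖fderiv ℝ v z‖ ^ 2 / 2 + wellPotential (v z) / ε)
      ≤ ENNReal.ofReal (ε * a / 2) * ‖fderiv ℝ v z‖ₑ
        + ENNReal.ofReal (108 / ε) * ‖v z - u₀ z‖ₑ := fun z => by
    rw [← ofReal_norm, ← ofReal_norm, ← ENNReal.ofReal_mul (by positivity),
      ← ENNReal.ofReal_mul (by positivity), ← ENNReal.ofReal_add (by positivity) (by positivity)]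
    refine ENNReal.ofReal_le_ofReal (add_le_add ?_ ?_)
    · have h1 := mul_le_mul_of_nonneg_left
        (mul_le_mul_of_nonneg_right (hsup z) (norm_nonneg (fderiv ℝ v z))) hε.le
      rw [sq]
      linarith
    · rw [div_mul_eq_mul_div, Real.norm_eq_abs]
      exact div_le_div_of_nonneg_right (wellPotential_le_mul_abs_sub (hv5 z) (hu₀ z)) hε.le
  calc allenCahnEnergy ε v
      ≤ ∫⁻ z, (ENNReal.ofReal (ε * a / 2) * ‖fderiv ℝ v z‖ₑ
        + ENNReal.ofReal (108 / ε) * ‖v z - u₀ z‖ₑ) := lintegral_mono hpt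
    _ = ENNReal.ofReal (ε * a / 2) * (∫⁻ z, ‖fderiv ℝ v z‖ₑ)
        + ENNReal.ofReal (108 / ε) * ∫⁻ z, ‖v z - u₀ z‖ₑ := by
        rw [lintegral_add_left (hv.enorm.measurable.const_mul _),
          lintegral_const_mul' _ _ ENNReal.ofReal_ne_top,
          lintegral_const_mul' _ _ ENNReal.ofReal_ne_top]
    _ ≤ ENNReal.ofReal (ε * a / 2) * ENNReal.ofReal b
        + ENNReal.ofReal (108 / ε) * ENNReal.ofReal m := by gcongr
    _ = _ := by
        rw [← ENNReal.ofReal_mul (by positivity), ← ENNReal.ofReal_mul (by positivity),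
          ← ENNReal.ofReal_add (by positivity) (by positivity)]

/-- Energy bound in terms of a bound `D` for the translation modulus of the initial datum. -/
theorem IsAllenCahnSolution.exists_contDiff_energy_le (hε : ε ∈ Ioo (0 : ℝ) 1)
    (hu : IsAllenCahnSolution ε u₀ u) (hu₀m : Measurable u₀) (hu₀ : ∀ x, u₀ x = 1 ∨ u₀ x = -1)
    (hu₀i : Integrable fun x => u₀ x + 1) {t D : ℝ} (ht : t ∈ Ioo 0 (ε ^ 2)) (hD : 0 ≤ D)
    (hmod : ∀ τ ∈ Ioc 0 (2 * t), ∫⁻ y, ENNReal.ofReal (heatKernel τ y) *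
      ∫⁻ z, ‖u₀ (z - y) - u₀ z‖ₑ ≤ ENNReal.ofReal D) {c : ℝ}
    (hc : c = (2 : ℝ) ^ (d / 2 : ℝ) * Real.exp 2) :
    ∃ v : EuclideanSpace ℝ (Fin d) → ℝ, ContDiff ℝ 1 v ∧ (∀ᵐ x, u x t = v x) ∧
      allenCahnEnergy ε v ≤ ENNReal.ofReal
        ((5 * c ^ 2 + 108) * (1 + 16 * Real.exp (8 * c)) * D * (ε / t)) := by
  have ht0 := ht.1
  have hε0 := hε.1
  have hε2 : 0 < ε ^ 2 := pow_pos hε0 2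
  have hc0 : 0 < c := by rw [hc]; positivity
  have hcE : (2 : ℝ) ^ (Module.finrank ℝ (EuclideanSpace ℝ (Fin d)) / 2 : ℝ) * Real.exp 2 = c := by
    rw [finrank_euclideanSpace_fin, hc]
  have hu₀1 : ∀ x, |u₀ x| ≤ 1 := fun x => by rcases hu₀ x with h | h <;> simp [h]
  obtain ⟨U, hU, hU1, hUu⟩ := hu.exists_representative_abs_le_one hu₀1
  have H := hu.isWeakHeatSolution hU hU1 hUu
  set h : EuclideanSpace ℝ (Fin d) × ℝ → ℝ := fun q => -(1 / ε ^ 2 * wellForce (U q)) with hh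
  have hhm : Measurable h := H.measurable_source
  set k : ℝ := 1 / ε ^ 2 * 4 with hk
  have hk0 : 0 < k := by positivity
  have hkt : t * k ≤ 4 := by
    have : t / ε ^ 2 ≤ 1 := (div_le_one hε2).2 ht.2.le
    rw [hk, show t * (1 / ε ^ 2 * 4) = 4 * (t / ε ^ 2) by ring]
    linarith
  have hhk : ∀ q, |h q| ≤ k := fun q => by
    have := abs_wellForce_le (hU1 q)
    rw [hh, hk, abs_neg, abs_mul, abs_of_nonneg (by positivity : 0 ≤ 1 / ε ^ 2)]
    refine mul_le_mul_of_nonneg_left (this.trans (by norm_num)) (by positivity)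
  have hheat : ∀ s ∈ Ioc 0 (2 * t), ∫⁻ z, ‖heatConv s u₀ z - u₀ z‖ₑ ≤ ENNReal.ofReal D :=
    fun s hs => (lintegral_enorm_heatConv_sub_le hs.1 hu₀m hu₀1).trans (hmod s hs)
  set B : ℝ := 2 * D * Real.exp (8 * c) with hB
  have hB0 : 0 ≤ B := by positivity
  have hUB := hu.ae_lintegral_enorm_sub_le hε hu₀m hu₀ hU hU1 hUu ht hD
    fun s hs => hheat s ⟨hs.1, by linarith [hs.2]⟩
  rw [← hc, ← hB] at hUB
  have hhB : ∀ᵐ s ∂volume.restrict (Ioo 0 t), ∫⁻ x, ‖h (x, s)‖ₑ ≤ ENNReal.ofReal (k * B) := by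
    filter_upwards [hUB] with s hs
    rw [ENNReal.ofReal_mul hk0.le]
    refine le_trans ?_ (mul_le_mul_right hs _)
    rw [← lintegral_const_mul' _ _ ENNReal.ofReal_ne_top]
    refine lintegral_mono fun x => ?_
    rw [← ofReal_norm, ← ofReal_norm, ← ENNReal.ofReal_mul hk0.le, norm_neg, norm_mul,
      Real.norm_of_nonneg (by positivity : 0 ≤ 1 / ε ^ 2), hk, mul_assoc]
    exact ENNReal.ofReal_le_ofReal (mul_le_mul_of_nonneg_left
      (abs_wellForce_le_mul_abs_sub (hU1 _) (hu₀ x)) (by positivity))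
  have hhi : ∀ᵐ s ∂volume.restrict (Ioo 0 t), Integrable fun x => h (x, s) := by
    filter_upwards [hhB] with s hs
    exact integrable_of_lintegral_enorm_le (hhm.comp measurable_prodMk_right) hs
  set S : EuclideanSpace ℝ (Fin d) → ℝ := fun z =>
    ∫ s in Ioo 0 t, heatConv (t - s) (fun x => h (x, s)) z with hS
  -- The right-hand side of Duhamel's formula is defined at every point and is the C¹
  -- representative.
  set v : EuclideanSpace ℝ (Fin d) → ℝ := fun z => heatConv t u₀ z + S z with hv
  set G : EuclideanSpace ℝ (Fin d) → (EuclideanSpace ℝ (Fin d) →L[ℝ] ℝ) := fun z =>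
    heatConvGrad t u₀ z + heatPotentialGrad t h z with hG
  have hderiv : ∀ z, HasFDerivAt v (G z) z := fun z =>
    (hasFDerivAt_heatConv_of_integrable_add_const ht0 hu₀m hu₀1 hu₀i z).add
      (hasFDerivAt_heatPotential ht0 hhm hhk hhi z)
  have hgc : Continuous (heatConvGrad t u₀) :=
    continuous_heatConvGrad_of_integrable_add_const ht0 hu₀m hu₀1 hu₀i
  have hGc : Continuous G := hgc.add (continuous_heatPotentialGrad ht0 hhm hhk hhi)
  have hfd : fderiv ℝ v = G := funext fun z => (hderiv z).fderiv
  have hvd : Differentiable ℝ v := fun z => (hderiv z).differentiableAt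
  refine ⟨v, contDiff_one_iff_fderiv.2 ⟨hvd, hfd ▸ hGc⟩, ?_, ?_⟩
  · have ht1 : t < 1 := ht.2.trans (pow_lt_one₀ hε0.le hε.2 two_ne_zero)
    filter_upwards [H.ae_eq_heatConv_add ⟨ht0, ht1⟩] with z hz
    rw [hz, heatConv_congr_ae hu.initial]
  set r : ℝ := t ^ (-(1 / 2) : ℝ) with hr
  have hr0 : 0 < r := by positivity
  have hrr : r * r = 1 / t := by
    rw [hr, ← Real.rpow_add ht0, show (-(1 / 2) + -(1 / 2) : ℝ) = -1 by norm_num, Real.rpow_neg_one,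
      one_div]
  have hGsup : ∀ z, ‖G z‖ ≤ 9 * c * r := fun z => by
    have h1 := norm_heatConvGrad_add_le ht0 hu₀1 hhk hkt z
    rwa [hcE] at h1
  have hGint : ∫⁻ z, ‖G z‖ₑ ≤ ENNReal.ofReal (c * r * (D + 8 * B)) := by
    have h1 := lintegral_enorm_heatConvGrad_add_le ht0 hu₀m hu₀1 hgc hD
      (hmod _ ⟨by positivity, le_rfl⟩) hhm hk0.le hkt hB0 hhB
    rwa [hcE] at h1
  -- The crude bound 1 + t·k ≤ 5 is pointwise and needs no transfer of the maximum principle to v.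
  have hv5 : ∀ z, |v z| ≤ 5 := fun z => by
    have h1 : |heatConv t u₀ z| ≤ 1 := abs_heatConv_le ht0 z (ae_of_all _ hu₀1)
    have h2 : |S z| ≤ t * k := abs_heatPotential_le ht0 hhk z
    refine (abs_add_le _ _).trans ?_
    linarith
  have hvint : ∫⁻ z, ‖v z - u₀ z‖ₑ ≤ ENNReal.ofReal (D + 4 * B) :=
    lintegral_enorm_heatConv_add_sub_le ht0 hu₀m hD (hheat t ⟨ht0, by linarith⟩) hhm hk0.le hkt hB0 hhB
  -- This is t ≤ ε²; it brings the potential term, of size D/ε, to the size of the gradient term,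
  -- εD/t.
  have hinv : 1 / ε ≤ ε / t := by
    rw [div_le_div_iff₀ hε0 ht0]
    nlinarith [ht.2]
  refine (allenCahnEnergy_le (a := 9 * c * r) (b := c * r * (D + 8 * B))
    (m := D + 4 * B) hε0 hu₀ (hfd ▸ hGc) hv5 (by positivity) (by positivity)
    (by positivity) (by rw [hfd]; exact hGsup) (by rw [hfd]; exact hGint) hvint).trans
    (ENNReal.ofReal_le_ofReal ?_)
  have h108 : 108 / ε * (D + 4 * B) ≤ 108 * (ε / t) * (D + 4 * B) := by
    rw [show 108 / ε = 108 * (1 / ε) by ring]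
    gcongr
  have e1 : ε * (9 * c * r) / 2 * (c * r * (D + 8 * B))
      = 9 / 2 * c ^ 2 * (D + 8 * B) * (ε / t) := by
    rw [show ε * (9 * c * r) / 2 * (c * r * (D + 8 * B))
      = 9 / 2 * c ^ 2 * (D + 8 * B) * (ε * (r * r)) by ring, hrr]
    ring
  have e2 : (5 * c ^ 2 + 108) * (1 + 16 * Real.exp (8 * c)) * D * (ε / t)
      = (5 * c ^ 2 + 108) * (D + 8 * B) * (ε / t) := by rw [hB]; ring
  rw [e1, e2]
  have h1 : 0 ≤ c ^ 2 * (D + 8 * B) * (ε / t) := by positivity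
  have h2 : 0 ≤ B * (ε / t) := by positivity
  linarith

end Energy

/-! ### Conclusion: inserting the translation modulus of the phase datum. -/

theorem mainTheorem4 (n : ℕ) (κ : ℝ) (hκ : κ ∈ Set.Ioo (0 : ℝ) 1)
    (δ θ : ℝ) (hδ : 0 < δ) (hθ : 0 < θ) (A : ℝ≥0) :
    ∃ C : ℝ, 0 < C ∧
      ∀ Ω : Set (EuclideanSpace ℝ (Fin (n + 1))),
        BoundsGeneralisedHypersurface n κ δ θ Ω →
        MeasureTheory.Measure.hausdorffMeasure ((n : ℝ) + κ) (frontier Ω) ≤ (A : ℝ≥0∞) →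
        ∀ ε ∈ Set.Ioo (0 : ℝ) 1,
        ∀ u : EuclideanSpace ℝ (Fin (n + 1)) → ℝ → ℝ,
          IsAllenCahnSolution ε (phaseDatum Ω) u →
          ∀ t ∈ Set.Ioo (0 : ℝ) (ε ^ 2),
            ∃ v : EuclideanSpace ℝ (Fin (n + 1)) → ℝ,
              ContDiff ℝ 1 v ∧
              (∀ᵐ x, u x t = v x) ∧
              allenCahnEnergy ε v ≤ ENNReal.ofReal (C * ε * t ^ (-(1 + κ) / 2)) := by
  obtain ⟨C₀, hC₀, hmod⟩ := exists_lintegral_heatKernel_mul_translate_le n hκ hδ hθ A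
  set c : ℝ := (2 : ℝ) ^ (((n + 1 : ℕ) : ℝ) / 2 : ℝ) * Real.exp 2 with hc
  set L : ℝ := (5 * c ^ 2 + 108) * (1 + 16 * Real.exp (8 * c)) with hL
  have hL0 : 0 < L := by positivity
  -- C₀ is only known to be nonnegative; adding 1 makes the constant positive.
  refine ⟨L * (C₀ * 2 ^ ((1 - κ) / 2)) + 1, by positivity, fun Ω hΩ hA ε hε u hu t ht => ?_⟩
  have ht0 := ht.1
  have hε0 := hε.1
  have ht1 : t < 1 := ht.2.trans (pow_lt_one₀ hε.1.le hε.2 two_ne_zero)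
  -- The gradient bound uses the modulus at time 2t, which is below 2 and hence in the range of the
  -- modulus estimate.
  set D : ℝ := C₀ * (2 * t) ^ ((1 - κ) / 2) with hD
  have hmeas : MeasurableSet Ω := hΩ.isOpen.measurableSet
  have hint : Integrable fun x => phaseDatum Ω x + 1 := by
    have h1 : Integrable (Ω.indicator fun _ => (1 : ℝ)) :=
      (integrable_indicator_iff hmeas).2 (integrableOn_const hΩ.isBounded.measure_lt_top.ne)
    refine (h1.const_mul 2).congr (ae_of_all _ fun x => ?_)
    simp [phaseDatum]
  obtain ⟨v, hv, hvu, hvE⟩ := hu.exists_contDiff_energy_le hε (measurable_phaseDatum hmeas)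
    (phaseDatum_eq_or Ω) hint (D := D) ht (by positivity) (fun τ hτ => by
      have hτ0 := hτ.1
      refine (hmod Ω hΩ hA τ ⟨hτ.1, by linarith [hτ.2]⟩).trans (ENNReal.ofReal_le_ofReal ?_)
      have : 0 ≤ (1 - κ) / 2 := by linarith [hκ.2]
      rw [hD]
      gcongr
      exact hτ.2) hc
  refine ⟨v, hv, hvu, hvE.trans (ENNReal.ofReal_le_ofReal ?_)⟩
  -- The exponents combine as (1 − κ)/2 − 1 = −(1 + κ)/2.
  have e : D * (ε / t) = C₀ * 2 ^ ((1 - κ) / 2) * ε * t ^ (-(1 + κ) / 2) := by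
    rw [hD, Real.mul_rpow (by norm_num) ht0.le,
      show (-(1 + κ) / 2 : ℝ) = (1 - κ) / 2 - 1 by ring, Real.rpow_sub ht0, Real.rpow_one]
    ring
  rw [← hL, mul_assoc, e]
  have : 0 ≤ ε * t ^ (-(1 + κ) / 2) := by positivity
  linarith
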